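/- **Random triangle removal.** Let $G(0)$ be the complete graph on $n$ vertices and, as long as $G(i)$ contains a triangle, let $G(i+1)$ be obtained from $G(i)$ by deleting the three edges of a triangle chosen uniformly at random among the triangles of $G(i)$. Times are $t=i/n^2$ with $i\ge 0$ an integer; put $p=p(t)=1-6t$ and $\zeta=\zeta(n,p)=n^{-1/2}p^{-1}\log n$. At time $t$ let $Y_u$, $Y_{u,v}$ and $Q$ be the degree of $u$, the co-degree of $u\neq v$ and the number of triangles. Given a constant $C>0$ and a function $w(n)\to\infty$, let $\tau_\star$ be the first time $t>0$ at which one of the following fails: $|Y_u/(np)-1|<C\zeta$ for all $u$; $|Y_{u,v}/(np^2)-1|<C\zeta$ for all $u\ne v$; $|Q/(\tfrac16n^3p^3)-1|<C\zeta^2$; $p>0$ and $\log(1/\zeta)/\log\log n\ge w(n)$. **Extension graphs.** An extension graph $H$ is a finite graph $(V_H,E_H)$ with an independent set $I_H\subseteq V_H$ of distinguished vertices; $v_H=|V_H|$, $e_H=|E_H|$, $\iota_H=|I_H|$. Its scaling is $\mathcal S_H=\mathcal S_H(n,p)=n^{v_H-\iota_H}p^{e_H}$ and its density is $m_H=e_H/(v_H-\iota_H)$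 ($m_H=0$ if $v_H=\iota_H$). A subextension $K$ of $H$ is an extension graph with $V_K\subseteq V_H$, $E_K\subseteq E_H$, $I_K=I_H$. $H$ is balanced if $m_H\ge m_K$ for every subextension $K$, and strictly balanced if $m_H>m_K$ for every subextension $K\ne H$. For an injection $\varphi:I_H\to V_G$, $\Psi_{H,\varphi}$ is the number of injective maps $\psi:V_H\to V_G$ that agree with $\varphi$ on $I_H$ and map edges of $H$ to edges of $G(i)$. Let $t_H=\min\{t:\mathcal S_H(n,p(t))\le1\}$ and $t_H^-(r)=\min\{t:\mathcal S_H(n,p(t))\le\zeta^{-r}\}$ (with $\min\emptyset=\infty$). **Theorem.** For every $L$ there is some $0<\delta<1$ such that for every constant $C>0$ and every function $w(n)\to\infty$, with probability tending to $1$ as $n\to\infty$, the following holds for all times $t\le\tau_\star$, all extension graphs $H$ on $v_H\le L$ vertices and all injections $\varphi:I_H\to V_G$: (i) if $H$ is balanced and $t\le t_H^-(\sqrt\delta)$, then $|\Psi_{H,\varphi}-\mathcal S_H|\le \mathcal S_H\,\zeta^{\delta}$; (ii) if $H$ is strictly balanced and $t_H^-(\sqrt\delta)\le t\le t_H$, then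 $|\Psi_{H,\varphi}-\mathcal S_H|\le \mathcal S_H^{\,1-\sqrt\delta}(\log n)^{\rho}$ with $\rho=3e^{v_H-\iota_H}$. -/

import Mathlib

open Filter Topology

namespace TriangleRemoval

/-! ### The random triangle removal process -/

section Graph

variable {V : Type*} [Fintype V]

open Classical in
/-- The set of triangles of `G`. -/
noncomputable def triangles (G : SimpleGraph V) : Finset (Finset V) :=
  G.cliqueFinset 3

/-- The number `Q` of triangles of `G`. -/
noncomputable def triangleCount (G : SimpleGraph V) : ℕ :=
  (triangles G).card

/-- The degree `Y_u`. -/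
noncomputable def deg (G : SimpleGraph V) (u : V) : ℕ :=
  (G.neighborSet u).ncard

/-- The co-degree `Y_{u,v}`. -/
noncomputable def codeg (G : SimpleGraph V) (u v : V) : ℕ :=
  (G.commonNeighbors u v).ncard

/-- Delete the edges inside the vertex set `T` (the three edges of the triangle `T`). -/
def removeTriangle (G : SimpleGraph V) (T : Finset V) : SimpleGraph V :=
  G.deleteEdges (T.sym2 : Set (Sym2 V))

open Classical in
/-- One step: remove the edges of a uniformly chosen triangle; a triangle-free graph is kept. -/
noncomputable def step (G : SimpleGraph V) : PMF (SimpleGraph V) :=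
  if h : (triangles G).Nonempty then
    (PMF.uniformOfFinset (triangles G) h).map (removeTriangle G)
  else PMF.pure G

end Graph

/-- The law of the trajectory `G(0), G(1), …` started at the complete graph on `n` vertices and run
for `k` steps (and kept constant after step `k`). -/
noncomputable def processUpTo (n : ℕ) : ℕ → PMF (ℕ → SimpleGraph (Fin n))
  | 0 => PMF.pure fun _ => ⊤
  | k + 1 => (processUpTo n k).bind fun G =>
      (step (G k)).map fun G' i => if i ≤ k then G i else G'

/-- The law of the whole trajectory of random triangle removal on `n` vertices. Each step that
finds a triangle deletes three of the at most `n ^ 2 / 2` edges, so after `n ^ 2` steps the process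
has terminated and the trajectory is constant from there on. -/
noncomputable def removalProcess (n : ℕ) : PMF (ℕ → SimpleGraph (Fin n)) :=
  processUpTo n (n ^ 2)

/-- The edge density `p = 1 - 6 t` at time `t = i / n ^ 2`, that is, after `i` steps. -/
noncomputable def density (n i : ℕ) : ℝ :=
  1 - 6 * ((i : ℝ) / (n : ℝ) ^ 2)

/-- `ζ = n ^ (-1/2) p ^ (-1) log n`. -/
noncomputable def zeta (n : ℕ) (p : ℝ) : ℝ :=
  (n : ℝ) ^ (-(1 / 2) : ℝ) * p⁻¹ * Real.log n

/-- Degrees and co-degrees are accurate to relative error `C ζ`, the number of triangles to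
relative error `C ζ ^ 2`. -/
def Accurate (C : ℝ) {n : ℕ} (p : ℝ) (G : SimpleGraph (Fin n)) : Prop :=
  (∀ u, |(deg G u : ℝ) / (n * p) - 1| < C * zeta n p) ∧
  (∀ u v, u ≠ v → |(codeg G u v : ℝ) / (n * p ^ 2) - 1| < C * zeta n p) ∧
  |(triangleCount G : ℝ) / (1 / 6 * (n : ℝ) ^ 3 * p ^ 3) - 1| < C * zeta n p ^ 2

/-- `log (1 / ζ) / log log n` is at least `w n`. For a function `w` that tends to infinity this
expresses that `log (1 / ζ) / log log n → ∞`, with rate `w`. -/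
def ZetaSmall (w : ℕ → ℝ) (n : ℕ) (p : ℝ) : Prop :=
  0 < p ∧ w n ≤ Real.log (1 / zeta n p) / Real.log (Real.log n)

/-- The first step with the property `P`, and `⊤` if there is none. -/
noncomputable def firstStep (P : ℕ → Prop) : ℕ∞ :=
  ⨅ i : {i : ℕ // P i}, ((i : ℕ) : ℕ∞)

/-- The stopping time `τ⋆`, as a number of steps: the first positive time at which the accuracy of
the degrees, co-degrees and triangle count or the bound on `ζ` is violated. -/
noncomputable def tauStar (C : ℝ) (w : ℕ → ℝ) {n : ℕ} (G : ℕ → SimpleGraph (Fin n)) : ℕ∞ :=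
  firstStep fun i => 0 < i ∧ ¬ (Accurate C (density n i) (G i) ∧ ZetaSmall w n (density n i))

/-! ### Extension graphs -/

/-- An extension graph with vertices labelled by elements of `W`: a graph `(V_H, E_H)` with
`V_H ⊆ W` and an independent set `I_H ⊆ V_H` of distinguished vertices (the roots). -/
structure ExtensionGraph (W : Type*) extends (⊤ : SimpleGraph W).Subgraph where
  roots : Set W
  roots_subset : roots ⊆ verts
  roots_indep : ∀ u ∈ roots, ∀ v ∈ roots, ¬ Adj u v

namespace ExtensionGraph

variable {W : Type*}

/-- `v_H - ι_H`. -/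
noncomputable def numFree (H : ExtensionGraph W) : ℕ :=
  H.verts.ncard - H.roots.ncard

/-- `e_H`. -/
noncomputable def numEdges (H : ExtensionGraph W) : ℕ :=
  H.toSubgraph.edgeSet.ncard

/-- The scaling `S_H(n, p) = n ^ (v_H - ι_H) p ^ e_H`. -/
noncomputable def scaling (H : ExtensionGraph W) (n : ℕ) (p : ℝ) : ℝ :=
  (n : ℝ) ^ H.numFree * p ^ H.numEdges

/-- The density `m_H = e_H / (v_H - ι_H)`; it is `0` if `V_H = I_H` (then `e_H = 0` as well). -/
noncomputable def dens (H : ExtensionGraph W) : ℝ :=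
  (H.numEdges : ℝ) / (H.numFree : ℝ)

/-- `K` is a subextension of `H`: `V_K ⊆ V_H`, `E_K ⊆ E_H` and `I_K = I_H`. -/
def IsSubextension (K H : ExtensionGraph W) : Prop :=
  K.toSubgraph ≤ H.toSubgraph ∧ K.roots = H.roots

def Balanced (H : ExtensionGraph W) : Prop :=
  ∀ K : ExtensionGraph W, K.IsSubextension H → K.dens ≤ H.dens

def StrictlyBalanced (H : ExtensionGraph W) : Prop :=
  ∀ K : ExtensionGraph W, K.IsSubextension H → K ≠ H → K.dens < H.dens

/-- The injective maps `ψ : V_H → V_G` that extend `φ` to a copy of `H` in `G`. -/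
def copies (H : ExtensionGraph W) {V : Type*} (G : SimpleGraph V) (φ : H.roots ↪ V) :
    Set (H.verts ↪ V) :=
  {ψ | (∀ x : H.roots, ψ ⟨x, H.roots_subset x.2⟩ = φ x) ∧
    ∀ u v : H.verts, H.Adj u v → G.Adj (ψ u) (ψ v)}

/-- `Ψ_{H,φ}`, the number of labelled copies of `H` in `G` rooted at `φ`. -/
noncomputable def copyCount (H : ExtensionGraph W) {V : Type*} (G : SimpleGraph V)
    (φ : H.roots ↪ V) : ℕ :=
  (H.copies G φ).ncard

/-- `t_H`, as a number of steps: the first time at which `S_H ≤ 1`. -/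
noncomputable def tH (H : ExtensionGraph W) (n : ℕ) : ℕ∞ :=
  firstStep fun i => H.scaling n (density n i) ≤ 1

/-- `t_H^-(r)`, as a number of steps: the first time at which `S_H ≤ 1 / ζ ^ r`. -/
noncomputable def tHMinus (H : ExtensionGraph W) (n : ℕ) (r : ℝ) : ℕ∞ :=
  firstStep fun i => H.scaling n (density n i) ≤ 1 / zeta n (density n i) ^ r

end ExtensionGraph

end TriangleRemoval

open TriangleRemoval

set_option linter.unusedSectionVars false

namespace TriangleRemoval

open scoped ENNReal

/-! ### Expectations under a probability mass function -/

/-! While degrees, co-degrees and the number of triangles are accurate, the triangle removed in one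
step destroys a given copy of `H` with probability close to 6e/(n²p), where e is the number of edges
of `H`: each edge lies in about np² of about n³p³/6 triangles. The scaling S shrinks in one step by
the factor (1 - 6/(n²p))^e. So the quotient X/S, with X the number of copies, has no drift to first
order, and the remaining drifts add up to O(ζ) times the bound on X/S. An exponential
supermartingale (`average_exp_step`, `concentration`, `deviation_le`) bounds |X/S - 1| by any error
whose square exceeds, up to logarithms, the product of a bound `xb` on X/S and a bound `Rb` on the
relative loss of copies in one step.

The heart is the loss in one step. Copies that lose the edge uv are copies rooted at R together with
u and v. Peeling off densest, strictly balanced layers one after the other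
(`exists_card_rootedCopies_le`) bounds their number by a polylogarithm times S_A/S_J for some J with
R ⊂ J ⊆ A. The peeling needs that a strictly balanced extension has at most max(S, 1) copies up to
logarithms; the theorem itself provides this at earlier times, and beyond t_H it follows since
copies are only lost. So the relative loss is governed by the largest 1/S_J.

Before t_H^- balancedness makes every S_J at least a fixed power of 1/ζ, and the error ζ^δ is
affordable (`balanced_failure_le`). Between t_H^- and t_H strict balance gains a factor p for J ≠ A,
and p is by then below a power of ζ; only J = A contributes the larger term 1/S_A, which the error
S^(-√δ) (log n)^ρ outweighs (`strictlyBalanced_failure_le`). The growth of ρ with the number of free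
vertices matches the logarithms accumulated by the peeling.

The argument for one extension assumes control of all extensions at all earlier steps. It therefore
bounds the probability that a given extension, rooting and step form the first failure, by 4
exp(-(log n)²). There are only polynomially many such choices, and a union bound finishes the proof.
-/

/-- The expectation of a nonnegative function. -/
noncomputable def pmfExp {α : Type*} (μ : PMF α) (f : α → ℝ≥0∞) : ℝ≥0∞ :=
  ∑' a, μ a * f a

theorem pmfExp_pure {α : Type*} (a : α) (f : α → ℝ≥0∞) : pmfExp (PMF.pure a) f = f a := by
  classical
  unfold pmfExp
  rw [tsum_eq_single a]
  · simp
  · intro b hb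
    simp [PMF.pure_apply, hb]

theorem pmfExp_bind {α β : Type*} (μ : PMF α) (ν : α → PMF β) (f : β → ℝ≥0∞) :
    pmfExp (μ.bind ν) f = pmfExp μ fun a => pmfExp (ν a) f := by
  unfold pmfExp
  simp only [PMF.bind_apply, ← ENNReal.tsum_mul_right, ← ENNReal.tsum_mul_left]
  rw [ENNReal.tsum_comm]
  simp only [mul_assoc]

theorem pmfExp_map {α β : Type*} (μ : PMF α) (g : α → β) (f : β → ℝ≥0∞) :
    pmfExp (μ.map g) f = pmfExp μ (f ∘ g) := by
  have h : μ.map g = μ.bind (PMF.pure ∘ g) := rfl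
  rw [h, pmfExp_bind]
  simp only [Function.comp_apply, pmfExp_pure]
  rfl

theorem pmfExp_mono {α : Type*} (μ : PMF α) {f g : α → ℝ≥0∞} (h : ∀ a, f a ≤ g a) :
    pmfExp μ f ≤ pmfExp μ g :=
  ENNReal.tsum_le_tsum fun a => mul_le_mul_right (h a) _

theorem pmfExp_const {α : Type*} (μ : PMF α) (c : ℝ≥0∞) : pmfExp μ (fun _ => c) = c := by
  unfold pmfExp
  rw [ENNReal.tsum_mul_right, PMF.tsum_coe, one_mul]

theorem pmfExp_uniformOfFinset {α : Type*} (s : Finset α) (hs : s.Nonempty) (f : α → ℝ≥0∞) :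
    pmfExp (PMF.uniformOfFinset s hs) f = (s.card : ℝ≥0∞)⁻¹ * ∑ a ∈ s, f a := by
  unfold pmfExp
  rw [tsum_eq_sum (s := s), Finset.mul_sum]
  · exact Finset.sum_congr rfl fun a ha => by
      rw [PMF.uniformOfFinset_apply_of_mem _ ha]
  · intro a ha
    rw [PMF.uniformOfFinset_apply_of_notMem _ ha, zero_mul]

theorem toOuterMeasure_le_pmfExp {α : Type*} (μ : PMF α) (s : Set α) (f : α → ℝ≥0∞)
    (h : ∀ a ∈ s, 1 ≤ f a) : μ.toOuterMeasure s ≤ pmfExp μ f := by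
  rw [PMF.toOuterMeasure_apply]
  refine ENNReal.tsum_le_tsum fun a => ?_
  by_cases ha : a ∈ s
  · rw [Set.indicator_of_mem ha]
    exact le_mul_of_one_le_right' (h a ha)
  · rw [Set.indicator_of_notMem ha]
    exact zero_le

/-! ### The trajectory of the process -/

theorem pmfExp_step {V : Type*} [Fintype V] (G : SimpleGraph V) (h : (triangles G).Nonempty)
    (f : SimpleGraph V → ℝ≥0∞) :
    pmfExp (step G) f =
      ((triangles G).card : ℝ≥0∞)⁻¹ * ∑ T ∈ triangles G, f (removeTriangle G T) := by
  rw [step, dif_pos h, pmfExp_map, pmfExp_uniformOfFinset]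
  rfl

theorem pmfExp_processUpTo_succ (n k : ℕ) (f : (ℕ → SimpleGraph (Fin n)) → ℝ≥0∞) :
    pmfExp (processUpTo n (k + 1)) f =
      pmfExp (processUpTo n k) fun G =>
        pmfExp (step (G k)) fun G' => f fun i => if i ≤ k then G i else G' := by
  rw [processUpTo, pmfExp_bind]
  simp only [pmfExp_map]
  rfl

/-- Expectations of functions of the first `k` steps do not depend on how much longer the process
is run. -/
theorem pmfExp_processUpTo_of_le {n k m : ℕ} (hkm : k ≤ m)
    (f : (ℕ → SimpleGraph (Fin n)) → ℝ≥0∞)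
    (hf : ∀ G G' : ℕ → SimpleGraph (Fin n), (∀ j ≤ k, G j = G' j) → f G = f G') :
    pmfExp (processUpTo n m) f = pmfExp (processUpTo n k) f := by
  induction m, hkm using Nat.le_induction with
  | base => rfl
  | succ m hm ih =>
    rw [pmfExp_processUpTo_succ, ← ih]
    congr 1
    funext G
    rw [← pmfExp_const (step (G m)) (f G)]
    congr 1
    funext G'
    refine hf _ _ fun j hj => ?_
    simp [hj.trans hm]

open Classical in
/-- The supermartingale inequality for a function of the current graph, as long as the predicates
`P j` hold. -/
theorem pmfExp_processUpTo_le {n i : ℕ} (F : ℕ → SimpleGraph (Fin n) → ℝ≥0∞)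
    (P : ℕ → SimpleGraph (Fin n) → Prop)
    (h : ∀ j < i, ∀ G, P j G → pmfExp (step G) (F (j + 1)) ≤ F j G) :
    pmfExp (processUpTo n i) (fun G => if ∀ j < i, P j (G j) then F i (G i) else 0) ≤ F 0 ⊤ := by
  induction i with
  | zero => simp [processUpTo, pmfExp_pure]
  | succ i ih =>
    refine le_trans ?_ (ih fun j hj => h j (by omega))
    rw [pmfExp_processUpTo_succ]
    refine pmfExp_mono _ fun G => ?_
    by_cases hG : ∀ j < i + 1, P j (G j)
    · rw [if_pos fun j hj => hG j (by omega)]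
      refine le_trans (pmfExp_mono _ fun G' => ?_) (h i (by omega) (G i) (hG i (by omega)))
      split_ifs
      · simp
      · exact zero_le
    · have : ∀ G' : SimpleGraph (Fin n),
          ¬ ∀ j < i + 1, P j ((fun l => if l ≤ i then G l else G') j) := by
        intro G' hG'
        refine hG fun j hj => ?_
        simpa [Nat.lt_succ_iff.mp hj] using hG' j hj
      simp only [if_neg (this _), pmfExp_const]
      exact zero_le

-- Markov's inequality for a supermartingale that is set to zero as soon as some `P j` fails: the
-- good past becomes part of the event, and no stopping time is needed.
open Classical in
theorem removalProcess_le_of_supermartingale {n i : ℕ} (hi : i ≤ n ^ 2)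
    (F : ℕ → SimpleGraph (Fin n) → ℝ≥0∞) (P : ℕ → SimpleGraph (Fin n) → Prop)
    (B : SimpleGraph (Fin n) → Prop)
    (h : ∀ j < i, ∀ G, P j G → pmfExp (step G) (F (j + 1)) ≤ F j G)
    (hB : ∀ G, B G → 1 ≤ F i G) :
    (removalProcess n).toOuterMeasure {G | (∀ j < i, P j (G j)) ∧ B (G i)} ≤ F 0 ⊤ := by
  refine le_trans ?_ (pmfExp_processUpTo_le F P h)
  rw [← pmfExp_processUpTo_of_le hi]
  · refine toOuterMeasure_le_pmfExp _ _ _ fun G hG => ?_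
    rw [if_pos hG.1]
    exact hB _ hG.2
  · intro G G' hGG'
    have h1 : (∀ j < i, P j (G j)) ↔ ∀ j < i, P j (G' j) :=
      forall₂_congr fun j hj => by rw [hGG' j hj.le]
    simp only [h1, hGG' i le_rfl]

theorem removeTriangle_le {V : Type*} (G : SimpleGraph V) (T : Finset V) :
    removeTriangle G T ≤ G :=
  SimpleGraph.deleteEdges_le _

theorem le_of_mem_support_step {V : Type*} [Fintype V] {G G' : SimpleGraph V}
    (h : G' ∈ (step G).support) : G' ≤ G := by
  unfold step at h
  split_ifs at h with hne
  · rw [PMF.support_map] at h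
    obtain ⟨T, -, rfl⟩ := h
    exact removeTriangle_le G T
  · rw [PMF.support_pure] at h
    exact le_of_eq h

/-- Almost surely, edges are only ever removed. -/
theorem antitone_of_mem_support {n k : ℕ} {G : ℕ → SimpleGraph (Fin n)}
    (h : G ∈ (processUpTo n k).support) : Antitone G := by
  suffices H : Antitone G ∧ ∀ j, k ≤ j → G j = G k from H.1
  induction k generalizing G with
  | zero =>
    rw [processUpTo, PMF.support_pure] at h
    rw [Set.mem_singleton_iff.mp h]
    exact ⟨antitone_const, fun _ _ => rfl⟩
  | succ k ih =>
    rw [processUpTo, PMF.mem_support_bind_iff] at h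
    obtain ⟨G₀, hG₀, h⟩ := h
    rw [PMF.support_map] at h
    obtain ⟨G', hG', rfl⟩ := h
    obtain ⟨hanti, -⟩ := ih hG₀
    have hle := le_of_mem_support_step hG'
    refine ⟨fun a b hab => ?_, fun j hj => ?_⟩
    · by_cases hb : b ≤ k
      · simpa [hb, hab.trans hb] using hanti hab
      · by_cases ha : a ≤ k
        · simpa [ha, hb] using hle.trans (hanti ha)
        · simp [ha, hb]
    · simp [show ¬ j ≤ k by omega]

/-- Lets properties of trajectories that hold only on the support, such as monotonicity, be used
pointwise. -/
theorem toOuterMeasure_le_of_inter_support {α : Type*} (μ : PMF α) {s t : Set α}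
    (h : ∀ a ∈ μ.support, a ∈ s → a ∈ t) : μ.toOuterMeasure s ≤ μ.toOuterMeasure t :=
  PMF.toOuterMeasure_mono μ fun a ha => h a ha.2 ha.1

theorem tendsto_toOuterMeasure_one {α : ℕ → Type*} (μ : ∀ n, PMF (α n)) (s : ∀ n, Set (α n))
    (h : Tendsto (fun n => (μ n).toOuterMeasure (s n)ᶜ) atTop (𝓝 0)) :
    Tendsto (fun n => (μ n).toOuterMeasure (s n)) atTop (𝓝 1) := by
  have huniv : ∀ n, (μ n).toOuterMeasure Set.univ = 1 := fun n =>
    (PMF.toOuterMeasure_apply_eq_one_iff _ _).2 (Set.subset_univ _)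
  refine tendsto_of_tendsto_of_tendsto_of_le_of_le (g := fun n => 1 - (μ n).toOuterMeasure (s n)ᶜ)
    (h := fun _ => 1) ?_ tendsto_const_nhds ?_ ?_
  · have := ENNReal.Tendsto.sub (tendsto_const_nhds (x := (1 : ℝ≥0∞)) (f := atTop)) h
      (Or.inl ENNReal.one_ne_top)
    simpa using this
  · intro n
    rw [tsub_le_iff_right, ← huniv n, ← Set.union_compl_self (s n)]
    exact MeasureTheory.measure_union_le _ _
  · intro n
    rw [← huniv n]
    exact MeasureTheory.measure_mono (Set.subset_univ _)

section Counting

variable {W V : Type*} [Fintype W] [DecidableEq W]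

/-! ### Rooted copies, as maps of the whole label set -/

open Classical in
/-- The edges of `Γ` inside `X`. -/
noncomputable def edgesIn (Γ : SimpleGraph W) (X : Finset W) : Finset (Sym2 W) :=
  Finset.univ.filter fun s => s ∈ Γ.edgeSet ∧ ∀ x ∈ s, x ∈ X

open Classical in
/-- The edges of `Γ` inside `A` but not inside `R`. -/
noncomputable def edgesBetween (Γ : SimpleGraph W) (R A : Finset W) : Finset (Sym2 W) :=
  edgesIn Γ A \ edgesIn Γ R

/-- The weight `n ^ |X| p ^ e(X)`. -/
noncomputable def weight (Γ : SimpleGraph W) (n : ℕ) (p : ℝ) (X : Finset W) : ℝ :=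
  (n : ℝ) ^ X.card * p ^ (edgesIn Γ X).card

open Classical in
/-- The maps that agree with `g` off `A \ R`, are injective on `A` and map the edges of `Γ` inside
`A` but not inside `R` to edges of `G`. -/
noncomputable def rootedCopies [Fintype V] (Γ : SimpleGraph W) (R A : Finset W)
    (G : SimpleGraph V) (g : W → V) : Finset (W → V) :=
  Finset.univ.filter fun ψ => (∀ x, x ∉ A \ R → ψ x = g x) ∧ Set.InjOn ψ A ∧
    ∀ u ∈ A, ∀ v ∈ A, Γ.Adj u v → ¬ (u ∈ R ∧ v ∈ R) → G.Adj (ψ u) (ψ v)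

/-- The extension graph with vertices `A`, roots `R` and the edges of `Γ` inside `A` but not inside
`R`. -/
def extGraph (Γ : SimpleGraph W) (R A : Finset W) (h : R ⊆ A) : ExtensionGraph W where
  verts := A
  Adj u v := Γ.Adj u v ∧ u ∈ A ∧ v ∈ A ∧ ¬ (u ∈ R ∧ v ∈ R)
  adj_sub := fun h => h.1.ne
  edge_vert := fun h => h.2.1
  symm := ⟨fun _ _ h => ⟨h.1.symm, h.2.2.1, h.2.1, fun h' => h.2.2.2 h'.symm⟩⟩
  roots := R
  roots_subset := by exact_mod_cast h
  roots_indep := fun _ hu _ hv h => h.2.2.2 ⟨hu, hv⟩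

/-- Independence of the roots means that no edge of `H` is lost by discarding those inside `R`.
Subextensions can then be handled as vertex sets between `R` and `A`, and the finitely many triples
`(Γ, R, A)` index the union bound. -/
theorem exists_eq_extGraph (H : ExtensionGraph W) :
    ∃ (Γ : SimpleGraph W) (R A : Finset W) (h : R ⊆ A), H = extGraph Γ R A h := by
  classical
  refine ⟨H.toSubgraph.spanningCoe, (Set.toFinite H.roots).toFinset,
    (Set.toFinite H.verts).toFinset, ?_, ?_⟩
  · exact Set.Finite.toFinset_subset_toFinset.2 H.roots_subset
  · obtain ⟨⟨verts, Adj, h1, h2, h3⟩, roots, h4, h5⟩ := H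
    simp only [extGraph, ExtensionGraph.mk.injEq, SimpleGraph.Subgraph.mk.injEq,
      Set.Finite.coe_toFinset, true_and, and_true, Set.Finite.mem_toFinset]
    funext u v
    refine propext ⟨fun h => ⟨h, h2 h, h2 (h3.symm _ _ h), fun h' => h5 u h'.1 v h'.2 h⟩,
      fun h => h.1⟩

theorem mem_edgesIn {Γ : SimpleGraph W} {X : Finset W} {s : Sym2 W} :
    s ∈ edgesIn Γ X ↔ s ∈ Γ.edgeSet ∧ ∀ x ∈ s, x ∈ X := by
  simp [edgesIn]

theorem mem_edgesBetween {Γ : SimpleGraph W} {R A : Finset W} {u v : W} :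
    s(u, v) ∈ edgesBetween Γ R A ↔ Γ.Adj u v ∧ u ∈ A ∧ v ∈ A ∧ ¬ (u ∈ R ∧ v ∈ R) := by
  simp only [edgesBetween, Finset.mem_sdiff, mem_edgesIn, SimpleGraph.mem_edgeSet, Sym2.mem_iff,
    forall_eq_or_imp, forall_eq]
  tauto

theorem edgesIn_mono (Γ : SimpleGraph W) {X Y : Finset W} (h : X ⊆ Y) :
    edgesIn Γ X ⊆ edgesIn Γ Y := fun s hs => by
  rw [mem_edgesIn] at hs ⊢
  exact ⟨hs.1, fun x hx => h (hs.2 x hx)⟩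

theorem card_edgesBetween (Γ : SimpleGraph W) {R A : Finset W} (h : R ⊆ A) :
    (edgesBetween Γ R A).card = (edgesIn Γ A).card - (edgesIn Γ R).card := by
  classical
  rw [edgesBetween, Finset.card_sdiff_of_subset (edgesIn_mono Γ h)]

theorem card_edgesIn_mono (Γ : SimpleGraph W) {X Y : Finset W} (h : X ⊆ Y) :
    (edgesIn Γ X).card ≤ (edgesIn Γ Y).card :=
  Finset.card_le_card (edgesIn_mono Γ h)

theorem weight_pos (Γ : SimpleGraph W) {n : ℕ} {p : ℝ} (hn : 0 < n) (hp : 0 < p) (X : Finset W) :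
    0 < weight Γ n p X := by
  unfold weight
  positivity

theorem extGraph_numFree (Γ : SimpleGraph W) {R A : Finset W} (h : R ⊆ A) :
    (extGraph Γ R A h).numFree = A.card - R.card := by
  simp [ExtensionGraph.numFree, extGraph, Set.ncard_coe_finset]

theorem extGraph_edgeSet (Γ : SimpleGraph W) {R A : Finset W} (h : R ⊆ A) :
    (extGraph Γ R A h).toSubgraph.edgeSet = (edgesBetween Γ R A : Set (Sym2 W)) := by
  ext s
  induction s using Sym2.ind with
  | _ u v =>
    rw [SimpleGraph.Subgraph.mem_edgeSet, Finset.mem_coe, mem_edgesBetween]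
    rfl

theorem extGraph_numEdges (Γ : SimpleGraph W) {R A : Finset W} (h : R ⊆ A) :
    (extGraph Γ R A h).numEdges = (edgesBetween Γ R A).card := by
  rw [ExtensionGraph.numEdges, extGraph_edgeSet, Set.ncard_coe_finset]

/-- Writing scalings as quotients of weights makes them multiplicative along chains of vertex sets,
whatever edges `Γ` has inside the roots. -/
theorem weight_div_weight (Γ : SimpleGraph W) {n : ℕ} {p : ℝ} (hn : 0 < n) (hp : 0 < p)
    {R A : Finset W} (h : R ⊆ A) :
    weight Γ n p A / weight Γ n p R =
      (n : ℝ) ^ (A.card - R.card) * p ^ (edgesBetween Γ R A).card := by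
  have hn' : (n : ℝ) ≠ 0 := by positivity
  rw [card_edgesBetween Γ h, pow_sub₀ _ hn' (Finset.card_le_card h),
    pow_sub₀ _ hp.ne' (card_edgesIn_mono Γ h), weight, weight]
  field_simp

theorem extGraph_scaling (Γ : SimpleGraph W) {n : ℕ} {p : ℝ}
    {R A : Finset W} (h : R ⊆ A) :
    (extGraph Γ R A h).scaling n p =
      (n : ℝ) ^ (A.card - R.card) * p ^ (edgesBetween Γ R A).card := by
  rw [ExtensionGraph.scaling, extGraph_numFree, extGraph_numEdges]

theorem extGraph_scaling_eq_div (Γ : SimpleGraph W) {n : ℕ} {p : ℝ} (hn : 0 < n) (hp : 0 < p)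
    {R A : Finset W} (h : R ⊆ A) :
    (extGraph Γ R A h).scaling n p = weight Γ n p A / weight Γ n p R := by
  rw [extGraph_scaling, weight_div_weight Γ hn hp h]

variable [Fintype V]

theorem mem_rootedCopies {Γ : SimpleGraph W} {R A : Finset W} {G : SimpleGraph V} {g ψ : W → V} :
    ψ ∈ rootedCopies Γ R A G g ↔ (∀ x, x ∉ A \ R → ψ x = g x) ∧ Set.InjOn ψ A ∧
      ∀ u ∈ A, ∀ v ∈ A, Γ.Adj u v → ¬ (u ∈ R ∧ v ∈ R) → G.Adj (ψ u) (ψ v) := by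
  simp [rootedCopies]

/-- The number of rooted copies of an extension graph, counted as maps of the label set. -/
theorem copyCount_extGraph (Γ : SimpleGraph W) {R A : Finset W} (h : R ⊆ A) (G : SimpleGraph V)
    (φ : (extGraph Γ R A h).roots ↪ V) (g : W → V)
    (hg : ∀ x : (extGraph Γ R A h).roots, g x = φ x) :
    (extGraph Γ R A h).copyCount G φ = (rootedCopies Γ R A G g).card := by
  classical
  rw [ExtensionGraph.copyCount, ← Set.ncard_coe_finset]
  let F : ((extGraph Γ R A h).verts ↪ V) → W → V := fun ψ x =>
    if hx : x ∈ (extGraph Γ R A h).verts then ψ ⟨x, hx⟩ else g x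
  have hF : ∀ ψ x, (hx : x ∈ (extGraph Γ R A h).verts) → F ψ x = ψ ⟨x, hx⟩ :=
    fun ψ x hx => dif_pos hx
  have hinj : Function.Injective F := by
    intro ψ₁ ψ₂ h12
    ext ⟨x, hx⟩
    rw [← hF ψ₁ x hx, ← hF ψ₂ x hx, h12]
  rw [← Set.ncard_image_of_injective _ hinj]
  congr 1
  ext ψ
  rw [Finset.mem_coe, mem_rootedCopies]
  constructor
  · rintro ⟨ψ, ⟨hψ1, hψ2⟩, rfl⟩
    refine ⟨fun x hx => ?_, fun x hx y hy hxy => ?_, fun u hu v hv huv huv' => ?_⟩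
    · by_cases hxA : x ∈ A
      · have hxR : x ∈ R := by
          by_contra hxR
          exact hx (Finset.mem_sdiff.2 ⟨hxA, hxR⟩)
        rw [hF ψ x hxA, hψ1 ⟨x, hxR⟩, ← hg ⟨x, hxR⟩]
      · exact dif_neg hxA
    · rw [hF ψ x hx, hF ψ y hy] at hxy
      exact congrArg Subtype.val (ψ.injective hxy)
    · rw [hF ψ u hu, hF ψ v hv]
      exact hψ2 ⟨u, hu⟩ ⟨v, hv⟩ ⟨huv, hu, hv, huv'⟩
  · rintro ⟨h1, h2, h3⟩
    refine ⟨⟨fun x => ψ x, fun x y hxy => Subtype.ext (h2 x.2 y.2 hxy)⟩, ⟨fun x => ?_, ?_⟩, ?_⟩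
    · rw [← hg x]
      exact h1 _ fun hx => (Finset.mem_sdiff.1 hx).2 x.2
    · rintro ⟨u, hu⟩ ⟨v, hv⟩ ⟨huv, hu, hv, huv'⟩
      exact h3 u hu v hv huv huv'
    · funext x
      by_cases hx : x ∈ A
      · exact hF _ x hx
      · rw [h1 x fun hx' => hx (Finset.mem_sdiff.1 hx').1]
        exact dif_neg hx

/-- Copies of `A` over `R` are counted by first choosing a copy of `J` over `R`. -/
theorem card_rootedCopies_le_sum (Γ : SimpleGraph W) {R J A : Finset W} (hRJ : R ⊆ J) (hJA : J ⊆ A)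
    (G : SimpleGraph V) (g : W → V) :
    (rootedCopies Γ R A G g).card ≤
      ∑ χ ∈ rootedCopies Γ R J G g, (rootedCopies Γ J A G χ).card := by
  classical
  refine le_trans (Finset.card_le_card ?_) Finset.card_biUnion_le
  intro ψ hψ
  rw [mem_rootedCopies] at hψ
  obtain ⟨h1, h2, h3⟩ := hψ
  rw [Finset.mem_biUnion]
  -- The restriction of `ψ` to `J` is again a total map on the labels, so it can serve as the
  -- rooting of the second extension.
  refine ⟨fun x => if x ∈ J then ψ x else g x, ?_, ?_⟩
  · rw [mem_rootedCopies]
    refine ⟨fun x hx => ?_, fun x hx y hy hxy => ?_, fun u hu v hv huv huv' => ?_⟩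
    · by_cases hxJ : x ∈ J
      · simp only [hxJ, if_true]
        refine h1 x fun hx' => hx ?_
        simp only [Finset.mem_sdiff] at hx' ⊢
        exact ⟨hxJ, hx'.2⟩
      · simp [hxJ]
    · rw [Finset.mem_coe] at hx hy
      simp only [hx, hy, if_true] at hxy
      exact h2 (hJA hx) (hJA hy) hxy
    · simp only [hu, hv, if_true]
      exact h3 u (hJA hu) v (hJA hv) huv huv'
  · rw [mem_rootedCopies]
    refine ⟨fun x hx => ?_, h2, fun u hu v hv huv huv' => ?_⟩
    · by_cases hxJ : x ∈ J
      · simp [hxJ]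
      · simp only [hxJ, if_false]
        refine h1 x fun hx' => hx ?_
        simp only [Finset.mem_sdiff] at hx' ⊢
        exact ⟨hx'.1, hxJ⟩
    · exact h3 u hu v hv huv fun h => huv' ⟨hRJ h.1, hRJ h.2⟩

open Classical in
/-- The maps that agree with `g` off `X`. -/
noncomputable def mapsOff (X : Finset W) (g : W → V) : Finset (W → V) :=
  Fintype.piFinset fun x => if x ∈ X then Finset.univ else {g x}

theorem mem_mapsOff {X : Finset W} {g ψ : W → V} :
    ψ ∈ mapsOff X g ↔ ∀ x, x ∉ X → ψ x = g x := by
  classical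
  simp only [mapsOff, Fintype.mem_piFinset]
  refine forall_congr' fun x => ?_
  by_cases hx : x ∈ X <;> simp [hx]

theorem card_mapsOff (X : Finset W) (g : W → V) :
    (mapsOff X g).card = Fintype.card V ^ X.card := by
  classical
  rw [mapsOff, Fintype.card_piFinset]
  have : ∀ x, (if x ∈ X then (Finset.univ : Finset V) else {g x}).card =
      if x ∈ X then Fintype.card V else 1 := fun x => by split_ifs <;> simp
  simp [this]

theorem rootedCopies_subset_mapsOff (Γ : SimpleGraph W) (R A : Finset W) (G : SimpleGraph V)
    (g : W → V) : rootedCopies Γ R A G g ⊆ mapsOff (A \ R) g := fun ψ hψ => by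
  rw [mem_rootedCopies] at hψ
  exact mem_mapsOff.2 hψ.1

theorem card_rootedCopies_le (Γ : SimpleGraph W) {R A : Finset W} (h : R ⊆ A) (G : SimpleGraph V)
    (g : W → V) : (rootedCopies Γ R A G g).card ≤ Fintype.card V ^ (A.card - R.card) := by
  rw [← Finset.card_sdiff_of_subset h, ← card_mapsOff (A \ R) g]
  exact Finset.card_le_card (rootedCopies_subset_mapsOff Γ R A G g)

/-- Almost all maps are injective. -/
theorem card_rootedCopies_top_ge (Γ : SimpleGraph W) {R A : Finset W} (h : R ⊆ A)
    (g : W → V) (hg : Set.InjOn g R) :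
    (Fintype.card V : ℝ) ^ (A.card - R.card) ≤
      (rootedCopies Γ R A (⊤ : SimpleGraph V) g).card +
        (Fintype.card W : ℝ) ^ 2 * (Fintype.card V : ℝ) ^ (A.card - R.card - 1) := by
  classical
  let bad : W × W → Finset (W → V) := fun e =>
    (mapsOff (A \ R) g).filter fun ψ => e.1 ∈ A \ R ∧ e.1 ≠ e.2 ∧ ψ e.1 = ψ e.2
  have hbad : ∀ e, (bad e).card ≤ Fintype.card V ^ (A.card - R.card - 1) := by
    intro e
    by_cases he : e.1 ∈ A \ R
    · rw [← Finset.card_sdiff_of_subset h, ← Finset.card_erase_of_mem he, ← card_mapsOff _ g]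
      -- On `bad e` the value at `e.1` repeats the one at `e.2`, so overwriting it by `g e.1` loses
      -- no information and one free vertex disappears.
      refine Finset.card_le_card_of_injOn (fun ψ => Function.update ψ e.1 (g e.1)) ?_ ?_
      · intro ψ hψ
        simp only [bad, Finset.coe_filter, Set.mem_ofPred_eq, mem_mapsOff] at hψ
        rw [Finset.mem_coe, mem_mapsOff]
        intro x hx
        beta_reduce
        by_cases hxe : x = e.1
        · rw [hxe, Function.update_self]
        · rw [Function.update_of_ne hxe]
          exact hψ.1 x fun hx' => hx (Finset.mem_erase.2 ⟨hxe, hx'⟩)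
      · intro ψ hψ χ hχ hψχ
        simp only [bad, Finset.coe_filter, Set.mem_ofPred_eq, mem_mapsOff] at hψ hχ
        have key : ∀ x, x ≠ e.1 → ψ x = χ x := fun x hx => by
          have := congrFun hψχ x
          simpa [Function.update_of_ne hx] using this
        funext x
        by_cases hx : x = e.1
        · rw [hx, hψ.2.2.2, hχ.2.2.2]
          exact key _ hψ.2.2.1.symm
        · exact key x hx
    · have : bad e = ∅ := Finset.filter_eq_empty_iff.2 fun ψ _ hψ => he hψ.1
      rw [this]
      simp
  have hcover : mapsOff (A \ R) g ⊆
      rootedCopies Γ R A (⊤ : SimpleGraph V) g ∪ Finset.univ.biUnion bad := by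
    intro ψ hψ
    rw [Finset.mem_union]
    by_contra hcon
    push Not at hcon
    obtain ⟨h1, h2⟩ := hcon
    have h2' : ∀ u v, u ∈ A \ R → u ≠ v → ψ u ≠ ψ v := by
      intro u v hu huv h'
      refine h2 (Finset.mem_biUnion.2 ⟨(u, v), Finset.mem_univ _, ?_⟩)
      exact Finset.mem_filter.2 ⟨hψ, hu, huv, h'⟩
    have hinj : Set.InjOn ψ A := by
      intro x hx y hy hxy
      by_contra hne
      by_cases hxR : x ∈ R
      · by_cases hyR : y ∈ R
        · rw [mem_mapsOff] at hψ
          rw [hψ x (by simp [hxR]), hψ y (by simp [hyR])] at hxy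
          exact hne (hg hxR hyR hxy)
        · exact h2' y x (by simpa [hyR] using hy) (Ne.symm hne) hxy.symm
      · exact h2' x y (by simpa [hxR] using hx) hne hxy
    refine h1 (mem_rootedCopies.2 ⟨mem_mapsOff.1 hψ, hinj, fun u hu v hv huv _ => ?_⟩)
    rw [SimpleGraph.top_adj]
    exact fun h' => huv.ne (hinj hu hv h')
  have hcard := (Finset.card_le_card hcover).trans (Finset.card_union_le _ _)
  rw [card_mapsOff, Finset.card_sdiff_of_subset h] at hcard
  have hsum : (Finset.univ.biUnion bad).card ≤
      Fintype.card W ^ 2 * Fintype.card V ^ (A.card - R.card - 1) := by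
    refine Finset.card_biUnion_le.trans ((Finset.sum_le_sum fun e _ => hbad e).trans_eq ?_)
    simp [sq]
  exact_mod_cast hcard.trans (Nat.add_le_add_left hsum _)

end Counting

section Densities

variable {W : Type*} [Fintype W] [DecidableEq W]

/-! ### Balanced extension graphs in terms of vertex sets -/

theorem extGraph_isSubextension (Γ : SimpleGraph W) {R J A : Finset W} (hRJ : R ⊆ J)
    (hJA : J ⊆ A) :
    (extGraph Γ R J hRJ).IsSubextension (extGraph Γ R A (hRJ.trans hJA)) :=
  ⟨⟨by exact_mod_cast hJA, fun _ _ h => ⟨h.1, hJA h.2.1, hJA h.2.2.1, h.2.2.2⟩⟩, rfl⟩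

/-- Passing to all the edges inside the vertex set of `K` only adds edges, so vertex sets suffice to
test balancedness. The last clause covers a proper `K` that has all the vertices. -/
theorem ExtensionGraph.IsSubextension.exists_verts {Γ : SimpleGraph W} {R A : Finset W} {h : R ⊆ A}
    {K : ExtensionGraph W} (hK : K.IsSubextension (extGraph Γ R A h)) :
    ∃ J, R ⊆ J ∧ J ⊆ A ∧ K.numFree = J.card - R.card ∧
      K.numEdges ≤ (edgesBetween Γ R J).card ∧
      (K ≠ extGraph Γ R A h → J = A → K.numEdges < (edgesBetween Γ R A).card) := by
  obtain ⟨Γ', R', J, h', rfl⟩ := exists_eq_extGraph K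
  obtain ⟨⟨hJ, hadj⟩, hR⟩ := hK
  have hJA : J ⊆ A := by exact_mod_cast hJ
  have hR : R' = R := Finset.coe_injective hR
  subst hR
  have hsub : edgesBetween Γ' R' J ⊆ edgesBetween Γ R' J := by
    intro s
    induction s using Sym2.ind with
    | _ u v =>
      rw [mem_edgesBetween, mem_edgesBetween]
      intro hs
      exact ⟨(hadj hs).1, hs.2⟩
  refine ⟨J, h', hJA, extGraph_numFree _ _, ?_, fun hne hJA' => ?_⟩
  · rw [extGraph_numEdges]
    exact Finset.card_le_card hsub
  · subst hJA'
    rw [extGraph_numEdges]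
    refine lt_of_le_of_ne (Finset.card_le_card hsub) fun heq => hne ?_
    have heq' := Finset.eq_of_subset_of_card_le hsub heq.ge
    have hadj' : (extGraph Γ' R' J h').Adj = (extGraph Γ R' J h).Adj := by
      funext u v
      have : s(u, v) ∈ edgesBetween Γ' R' J ↔ s(u, v) ∈ edgesBetween Γ R' J := by rw [heq']
      rw [mem_edgesBetween, mem_edgesBetween] at this
      exact propext this
    simp only [extGraph, ExtensionGraph.mk.injEq, SimpleGraph.Subgraph.mk.injEq, true_and,
      and_true]
    exact hadj'

/-- The density of the extension of `R` to `J`. -/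
noncomputable def setDens (Γ : SimpleGraph W) (R J : Finset W) : ℝ :=
  ((edgesBetween Γ R J).card : ℝ) / ((J.card - R.card : ℕ) : ℝ)

theorem extGraph_dens (Γ : SimpleGraph W) {R A : Finset W} (h : R ⊆ A) :
    (extGraph Γ R A h).dens = setDens Γ R A := by
  rw [ExtensionGraph.dens, extGraph_numFree, extGraph_numEdges, setDens]

theorem card_lt_of_subset_of_ne {R J : Finset W} (h : R ⊆ J) (hne : R ≠ J) : R.card < J.card :=
  Finset.card_lt_card (h.ssubset_of_ne hne)

/-- An extension is strictly balanced if it is denser than those to smaller vertex sets. -/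
theorem strictlyBalanced_extGraph {Γ : SimpleGraph W} {R A : Finset W} (h : R ⊆ A) (hne : R ≠ A)
    (hpos : 0 < setDens Γ R A)
    (hlt : ∀ J, R ⊆ J → J ⊆ A → J ≠ R → J ≠ A → setDens Γ R J < setDens Γ R A) :
    (extGraph Γ R A h).StrictlyBalanced := by
  intro K hK hKne
  obtain ⟨J, hRJ, hJA, hf, he, hstrict⟩ := hK.exists_verts
  rw [extGraph_dens, ExtensionGraph.dens, hf]
  have hle : (K.numEdges : ℝ) / ((J.card - R.card : ℕ) : ℝ) ≤ setDens Γ R J := by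
    unfold setDens
    gcongr
  by_cases hJR : J = R
  · subst hJR
    simpa using hpos
  by_cases hJA' : J = A
  · subst hJA'
    have hcard : 0 < J.card - R.card := Nat.sub_pos_of_lt (card_lt_of_subset_of_ne h hne)
    unfold setDens
    have := hstrict hKne rfl
    gcongr
  · exact hle.trans_lt (hlt J hRJ hJA hJR hJA')

theorem ExtensionGraph.Balanced.card_mul_le {Γ : SimpleGraph W} {R A : Finset W} {h : R ⊆ A}
    (hb : (extGraph Γ R A h).Balanced) {J : Finset W} (hRJ : R ⊆ J) (hJA : J ⊆ A) (hne : J ≠ R) :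
    (edgesBetween Γ R J).card * (A.card - R.card) ≤
      (edgesBetween Γ R A).card * (J.card - R.card) := by
  have h1 := hb _ (extGraph_isSubextension Γ hRJ hJA)
  rw [extGraph_dens, extGraph_dens, setDens, setDens] at h1
  have hJ : 0 < J.card - R.card := Nat.sub_pos_of_lt (card_lt_of_subset_of_ne hRJ hne.symm)
  have hA : 0 < A.card - R.card := by
    have := Finset.card_le_card hJA
    omega
  rw [div_le_div_iff₀ (by exact_mod_cast hJ) (by exact_mod_cast hA)] at h1
  exact_mod_cast h1

theorem ExtensionGraph.StrictlyBalanced.card_mul_lt {Γ : SimpleGraph W} {R A : Finset W}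
    {h : R ⊆ A} (hb : (extGraph Γ R A h).StrictlyBalanced) {J : Finset W} (hRJ : R ⊆ J)
    (hJA : J ⊆ A) (hne : J ≠ R) (hneA : J ≠ A) :
    (edgesBetween Γ R J).card * (A.card - R.card) <
      (edgesBetween Γ R A).card * (J.card - R.card) := by
  have h1 := hb _ (extGraph_isSubextension Γ hRJ hJA) fun heq => hneA <| by
    have : ((extGraph Γ R J hRJ).verts : Set W) = (extGraph Γ R A h).verts := by rw [heq]
    exact Finset.coe_injective this
  rw [extGraph_dens, extGraph_dens, setDens, setDens] at h1
  have hJ : 0 < J.card - R.card := Nat.sub_pos_of_lt (card_lt_of_subset_of_ne hRJ hne.symm)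
  have hA : 0 < A.card - R.card := by
    have := Finset.card_le_card hJA
    omega
  rw [div_lt_div_iff₀ (by exact_mod_cast hJ) (by exact_mod_cast hA)] at h1
  exact_mod_cast h1

theorem ExtensionGraph.StrictlyBalanced.balanced {H : ExtensionGraph W} (h : H.StrictlyBalanced) :
    H.Balanced := fun K hK => by
  by_cases hKH : K = H
  · rw [hKH]
  · exact (h K hK hKH).le

theorem ExtensionGraph.StrictlyBalanced.edges_pos {Γ : SimpleGraph W} {R A : Finset W}
    {h : R ⊆ A} (hb : (extGraph Γ R A h).StrictlyBalanced) (hne : R ≠ A) :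
    0 < (edgesBetween Γ R A).card := by
  have h1 := hb _ (extGraph_isSubextension Γ subset_rfl h) fun heq => hne <| by
    have : ((extGraph Γ R R subset_rfl).verts : Set W) = (extGraph Γ R A h).verts := by rw [heq]
    exact Finset.coe_injective this
  rw [extGraph_dens, extGraph_dens] at h1
  by_contra hcon
  have : (edgesBetween Γ R A).card = 0 := by omega
  simp [setDens, this] at h1

/-- Among the vertex sets of maximal density, one of least size is strictly balanced, since a proper
subset just as dense would be smaller. Maximality stays in the conclusion because it controls what
is added on top of `J`. -/
theorem exists_strictlyBalanced_densest {Γ : SimpleGraph W} {R A : Finset W} (h : R ⊆ A)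
    (he : 0 < (edgesBetween Γ R A).card) :
    ∃ J, ∃ hRJ : R ⊆ J, J ⊆ A ∧ J ≠ R ∧ (extGraph Γ R J hRJ).StrictlyBalanced ∧
      ∀ J', R ⊆ J' → J' ⊆ A → setDens Γ R J' ≤ setDens Γ R J := by
  classical
  have hne : R ≠ A := by
    rintro rfl
    simp [edgesBetween] at he
  have hpos : 0 < setDens Γ R A := by
    have : 0 < A.card - R.card := Nat.sub_pos_of_lt (card_lt_of_subset_of_ne h hne)
    unfold setDens
    positivity
  obtain ⟨J₀, hJ₀, hmax⟩ := Finset.exists_max_image (Finset.Icc R A) (setDens Γ R)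
    ⟨A, Finset.mem_Icc.2 ⟨h, le_rfl⟩⟩
  obtain ⟨J, hJ, hmin⟩ := Finset.exists_min_image
    ((Finset.Icc R A).filter fun J => setDens Γ R J = setDens Γ R J₀) Finset.card
    ⟨J₀, Finset.mem_filter.2 ⟨hJ₀, rfl⟩⟩
  rw [Finset.mem_filter, Finset.mem_Icc] at hJ
  obtain ⟨⟨hRJ, hJA⟩, hdens⟩ := hJ
  have hJpos : 0 < setDens Γ R J := by
    rw [hdens]
    exact hpos.trans_le (hmax A (Finset.mem_Icc.2 ⟨h, le_rfl⟩))
  have hJR : J ≠ R := by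
    rintro rfl
    simp [setDens] at hJpos
  refine ⟨J, hRJ, hJA, hJR, strictlyBalanced_extGraph hRJ hJR.symm hJpos ?_, ?_⟩
  · intro J' hRJ' hJ'J _ hne'
    rw [hdens]
    refine lt_of_le_of_ne (hmax J' (Finset.mem_Icc.2 ⟨hRJ', hJ'J.trans hJA⟩)) fun heq => ?_
    have h1 := hmin J' (Finset.mem_filter.2
      ⟨Finset.mem_Icc.2 ⟨hRJ', hJ'J.trans hJA⟩, heq⟩)
    have h2 := card_lt_of_subset_of_ne hJ'J hne'
    omega
  · intro J' h1 h2
    rw [hdens]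
    exact hmax J' (Finset.mem_Icc.2 ⟨h1, h2⟩)

/-- A monomial with fewer edges per vertex than one of size at least 1 is itself at least 1: compare
the `a`-th power of the second with the `x`-th power of the first. -/
theorem one_le_of_pow_mul_pow {n p : ℝ} (hn : 0 < n) (hp : 0 < p) (hp1 : p ≤ 1) {a b x y : ℕ}
    (ha : a ≠ 0) (h : y * a ≤ b * x) (h1 : 1 ≤ n ^ a * p ^ b) : 1 ≤ n ^ x * p ^ y := by
  have h2 : 1 ≤ (n ^ x * p ^ y) ^ a := by
    calc (1 : ℝ) ≤ (n ^ a * p ^ b) ^ x := one_le_pow₀ h1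
      _ = n ^ (x * a) * p ^ (b * x) := by rw [mul_pow, ← pow_mul, ← pow_mul, mul_comm a x]
      _ ≤ n ^ (x * a) * p ^ (y * a) := by
          gcongr ?_ * ?_
          exact pow_le_pow_of_le_one hp.le hp1 h
      _ = (n ^ x * p ^ y) ^ a := by rw [mul_pow, ← pow_mul, ← pow_mul]
  by_contra hcon
  push Not at hcon
  exact absurd h2 (not_le.2 (pow_lt_one₀ (by positivity) hcon ha))

/-- The extension of the densest `J` to a larger set has scaling at least `1` if that of `R` to `J`
has. -/
theorem weight_le_weight_of_densest {Γ : SimpleGraph W} {n : ℕ} {p : ℝ} (hn : 0 < n) (hp : 0 < p)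
    (hp1 : p ≤ 1) {R J J' : Finset W} (hRJ : R ⊆ J) (hJJ' : J ⊆ J') (hne : J ≠ R)
    (hd : setDens Γ R J' ≤ setDens Γ R J) (h1 : weight Γ n p R ≤ weight Γ n p J) :
    weight Γ n p J ≤ weight Γ n p J' := by
  rw [← one_le_div (weight_pos Γ hn hp _), weight_div_weight Γ hn hp] at h1 ⊢ <;> try assumption
  have hJ : 0 < J.card - R.card := Nat.sub_pos_of_lt (card_lt_of_subset_of_ne hRJ hne.symm)
  have hc := Finset.card_le_card hJJ'
  refine one_le_of_pow_mul_pow (by positivity) hp hp1 hJ.ne' ?_ h1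
  unfold setDens at hd
  rw [div_le_div_iff₀ (by exact_mod_cast (by omega : 0 < J'.card - R.card))
    (by exact_mod_cast hJ)] at hd
  have hd' : (edgesBetween Γ R J').card * (J.card - R.card) ≤
    (edgesBetween Γ R J).card * (J'.card - R.card) := by exact_mod_cast hd
  -- Edges and vertices are additive along `R ⊆ J ⊆ J'`, so a `J'` no denser than `J` over `R` adds
  -- a part no denser than `J` itself.
  have e1 : (edgesBetween Γ R J').card = (edgesBetween Γ R J).card + (edgesBetween Γ J J').card := by
    rw [card_edgesBetween Γ hRJ, card_edgesBetween Γ hJJ', card_edgesBetween Γ (hRJ.trans hJJ')]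
    have := card_edgesIn_mono Γ hRJ
    have := card_edgesIn_mono Γ hJJ'
    omega
  have e2 : J'.card - R.card = (J.card - R.card) + (J'.card - J.card) := by omega
  rw [e1, e2] at hd'
  nlinarith

/-! ### Upper bounds for all extensions -/

/-- The exponent of the logarithm in the upper bound for an extension with `f` free vertices. -/
noncomputable def logExponent (f : ℕ) : ℝ :=
  24 / 5 * (Real.exp f - 1)

/-- Each strictly balanced layer with `a` free vertices costs `3 e^a` logarithms, and this keeps the
total over all layers below `logExponent`. The factor 24/5 suffices because `24/5 (e^a - 1) ≥ 3 e^a`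
once `e^a ≥ 2.7`. -/
theorem logExponent_add {a b : ℕ} (ha : a ≠ 0) :
    3 * Real.exp (a : ℝ) + logExponent b ≤ logExponent (a + b) := by
  unfold logExponent
  push_cast
  rw [Real.exp_add]
  have h1 : (2.7 : ℝ) ≤ Real.exp a := by
    have : Real.exp 1 ≤ Real.exp a :=
      Real.exp_le_exp.2 (by exact_mod_cast Nat.one_le_iff_ne_zero.2 ha)
    linarith [Real.exp_one_gt_d9]
  have h2 : (1 : ℝ) ≤ Real.exp b := Real.one_le_exp (by positivity)
  nlinarith

theorem logExponent_nonneg (f : ℕ) : 0 ≤ logExponent f := by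
  unfold logExponent
  have h2 : (1 : ℝ) ≤ Real.exp f := Real.one_le_exp (by positivity)
  linarith

theorem logExponent_mono {a b : ℕ} (h : a ≤ b) : logExponent a ≤ logExponent b := by
  unfold logExponent
  have : Real.exp (a : ℝ) ≤ Real.exp b := Real.exp_le_exp.2 (by exact_mod_cast h)
  linarith

/-- The loss in one step involves at most `f - 1` free vertices. Against the exponent `3 e^f` of the
error this leaves eight logarithms to pay for constants and the large deviation bound. -/
theorem logExponent_lt {f : ℕ} (hf : f ≠ 0) :
    logExponent (f - 1) + 8 ≤ 3 * Real.exp (f : ℝ) := by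
  obtain ⟨k, rfl⟩ := Nat.exists_eq_succ_of_ne_zero hf
  unfold logExponent
  simp only [Nat.succ_eq_add_one, Nat.add_sub_cancel]
  push_cast
  rw [Real.exp_add]
  have h1 : (1 : ℝ) ≤ Real.exp k := Real.one_le_exp (by positivity)
  have h2 := Real.exp_one_gt_d9
  nlinarith

/-- If the counts of strictly balanced extensions have the right order of magnitude up to
logarithms, then every extension of `R` to `A` has at most about `S_A / S_J` copies for some
intermediate `J`. -/
theorem exists_card_rootedCopies_le (Γ : SimpleGraph W) {n : ℕ} {p l : ℝ} (hn : 0 < n) (hp : 0 < p)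
    (hp1 : p ≤ 1) (hl : 1 ≤ l) (G : SimpleGraph (Fin n))
    (hK : ∀ K : ExtensionGraph W, K.StrictlyBalanced → K.numFree ≠ 0 → ∀ φ : K.roots ↪ Fin n,
      (K.copyCount G φ : ℝ) ≤ 2 * l ^ (3 * Real.exp (K.numFree : ℝ)) * max (K.scaling n p) 1)
    {R A : Finset W} (h : R ⊆ A) :
    ∃ J, R ⊆ J ∧ J ⊆ A ∧ ∀ g : W → Fin n, ((rootedCopies Γ R A G g).card : ℝ) ≤
      2 ^ (A.card - R.card) * l ^ logExponent (A.card - R.card) *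
        (weight Γ n p A / weight Γ n p J) := by
  induction hm : A.card - R.card using Nat.strong_induction_on generalizing R with
  | _ m ih =>
  subst hm
  have hl0 : 0 < l := by linarith
  by_cases he : (edgesBetween Γ R A).card = 0
  · refine ⟨R, subset_rfl, h, fun g => ?_⟩
    rw [weight_div_weight Γ hn hp h, he, pow_zero, mul_one]
    have h1 : ((rootedCopies Γ R A G g).card : ℝ) ≤ (n : ℝ) ^ (A.card - R.card) := by
      have := card_rootedCopies_le Γ h G g
      rw [Fintype.card_fin] at this
      exact_mod_cast this
    have h2 : (1 : ℝ) ≤ 2 ^ (A.card - R.card) * l ^ logExponent (A.card - R.card) :=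
      one_le_mul_of_one_le_of_one_le (one_le_pow₀ one_le_two)
        (Real.one_le_rpow hl (logExponent_nonneg _))
    exact h1.trans (le_mul_of_one_le_left (by positivity) h2)
  -- Peel off the densest part `J` over `R` and treat `A` over `J` by induction. The set `J'` does
  -- not depend on the rooting, so it serves all copies of `J` at once.
  obtain ⟨J, hRJ, hJA, hJR, hsb, hdens⟩ := exists_strictlyBalanced_densest h (Nat.pos_of_ne_zero he)
  have hJcard : R.card < J.card := card_lt_of_subset_of_ne hRJ hJR.symm
  have hAcard : J.card ≤ A.card := Finset.card_le_card hJA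
  obtain ⟨J', hJJ', hJ'A, hJ'⟩ := ih (A.card - J.card) (by omega) hJA rfl
  have hw := weight_pos Γ hn hp
  have hfirst : ∀ g : W → Fin n, ((rootedCopies Γ R J G g).card : ℝ) ≤
      2 * l ^ (3 * Real.exp ((J.card - R.card : ℕ) : ℝ)) *
        max (weight Γ n p J / weight Γ n p R) 1 := by
    intro g
    by_cases hg : Set.InjOn g R
    · have := hK _ hsb (by rw [extGraph_numFree]; omega)
        ⟨fun x : (extGraph Γ R J hRJ).roots => g x, fun x y hxy => Subtype.ext (hg x.2 y.2 hxy)⟩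
      rw [copyCount_extGraph Γ hRJ G _ g fun x => rfl, extGraph_numFree,
        extGraph_scaling_eq_div Γ hn hp] at this
      exact this
    · have : rootedCopies Γ R J G g = ∅ := by
        refine Finset.eq_empty_of_forall_notMem fun ψ hψ => hg ?_
        rw [mem_rootedCopies] at hψ
        intro x hx y hy hxy
        refine hψ.2.1 (hRJ hx) (hRJ hy) ?_
        rw [hψ.1 x (fun h' => (Finset.mem_sdiff.1 h').2 hx),
          hψ.1 y (fun h' => (Finset.mem_sdiff.1 h').2 hy), hxy]
      rw [this, Finset.card_empty, Nat.cast_zero]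
      positivity
  have hcard : ∀ g : W → Fin n, ((rootedCopies Γ R A G g).card : ℝ) ≤
      2 ^ (A.card - R.card) * l ^ logExponent (A.card - R.card) *
        (max (weight Γ n p J / weight Γ n p R) 1 * (weight Γ n p A / weight Γ n p J')) := by
    intro g
    have h1 : ((rootedCopies Γ R A G g).card : ℝ) ≤
        ∑ χ ∈ rootedCopies Γ R J G g, ((rootedCopies Γ J A G χ).card : ℝ) := by
      exact_mod_cast card_rootedCopies_le_sum Γ hRJ hJA G g
    have h2 := h1.trans (Finset.sum_le_sum fun χ _ => hJ' χ)
    rw [Finset.sum_const, nsmul_eq_mul] at h2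
    have hpos : 0 ≤ (2 : ℝ) ^ (A.card - J.card) * l ^ logExponent (A.card - J.card) *
        (weight Γ n p A / weight Γ n p J') := by
      have := hw A
      have := hw J'
      positivity
    refine (h2.trans (mul_le_mul_of_nonneg_right (hfirst g) hpos)).trans ?_
    have hr : 0 ≤ max (weight Γ n p J / weight Γ n p R) 1 * (weight Γ n p A / weight Γ n p J') := by
      have := hw A
      have := hw J'
      positivity
    have e : J.card - R.card + (A.card - J.card) = A.card - R.card := by omega
    have h3 : l ^ (3 * Real.exp ((J.card - R.card : ℕ) : ℝ)) * l ^ logExponent (A.card - J.card) ≤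
        l ^ logExponent (A.card - R.card) := by
      rw [← Real.rpow_add hl0]
      refine Real.rpow_le_rpow_of_exponent_le hl ?_
      rw [← e]
      exact logExponent_add (by omega)
    have h4 : (2 : ℝ) * 2 ^ (A.card - J.card) ≤ 2 ^ (A.card - R.card) := by
      rw [← pow_succ']
      exact pow_le_pow_right₀ one_le_two (by omega)
    calc _ = (2 * 2 ^ (A.card - J.card)) *
          (l ^ (3 * Real.exp ((J.card - R.card : ℕ) : ℝ)) * l ^ logExponent (A.card - J.card)) *
          (max (weight Γ n p J / weight Γ n p R) 1 *
            (weight Γ n p A / weight Γ n p J')) := by ring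
      _ ≤ _ := by gcongr
  -- If `J` over `R` has scaling at least 1, then `w(J) ≤ w(J')` merges the two factors into
  -- `w(A)/w(R)`. Otherwise the first factor is only polylogarithmic and `J'` is kept.
  by_cases hJ1 : weight Γ n p R ≤ weight Γ n p J
  · refine ⟨R, subset_rfl, h, fun g => (hcard g).trans ?_⟩
    have h5 := weight_le_weight_of_densest hn hp hp1 hRJ hJJ' hJR
      (hdens J' (hRJ.trans hJJ') hJ'A) hJ1
    rw [max_eq_left ((one_le_div (hw R)).2 hJ1)]
    gcongr
    have := hw A
    have := hw J
    have := hw J'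
    have := hw R
    rw [div_mul_div_comm, div_le_div_iff₀ (by positivity) (by positivity)]
    calc weight Γ n p J * weight Γ n p A * weight Γ n p R
        ≤ weight Γ n p J' * weight Γ n p A * weight Γ n p R := by gcongr
      _ = _ := by ring
  · refine ⟨J', hRJ.trans hJJ', hJ'A, fun g => (hcard g).trans_eq ?_⟩
    rw [max_eq_right ((div_le_one (hw R)).2 (not_le.1 hJ1).le), one_mul]

end Densities

section Killing

variable {W V : Type*} [Fintype W] [DecidableEq W] [Fintype V]

/-! ### The effect of removing a triangle on the number of copies -/

open Classical in
/-- The copies that lose an edge when the triangle `T` is removed. -/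
noncomputable def lostCopies (Γ : SimpleGraph W) (R A : Finset W) (G : SimpleGraph V) (g : W → V)
    (T : Finset V) : Finset (W → V) :=
  (rootedCopies Γ R A G g).filter fun ψ => ∃ e ∈ edgesBetween Γ R A, ∀ x ∈ e, ψ x ∈ T

theorem removeTriangle_adj {G : SimpleGraph V} {T : Finset V} {a b : V} :
    (removeTriangle G T).Adj a b ↔ G.Adj a b ∧ ¬ (a ∈ T ∧ b ∈ T) := by
  simp [removeTriangle, SimpleGraph.deleteEdges_adj]

theorem rootedCopies_removeTriangle (Γ : SimpleGraph W) (R A : Finset W) (G : SimpleGraph V)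
    (g : W → V) (T : Finset V) :
    ((rootedCopies Γ R A (removeTriangle G T) g).card : ℝ) =
      (rootedCopies Γ R A G g).card - (lostCopies Γ R A G g T).card := by
  classical
  have h : rootedCopies Γ R A (removeTriangle G T) g =
      (rootedCopies Γ R A G g).filter fun ψ => ¬ ∃ e ∈ edgesBetween Γ R A, ∀ x ∈ e, ψ x ∈ T := by
    ext ψ
    simp only [Finset.mem_filter, mem_rootedCopies, removeTriangle_adj, not_exists, not_and]
    constructor
    · rintro ⟨h1, h2, h3⟩
      refine ⟨⟨h1, h2, fun u hu v hv huv h' => (h3 u hu v hv huv h').1⟩, fun e he => ?_⟩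
      induction e using Sym2.ind with
      | _ u v =>
        obtain ⟨huv, hu, hv, h'⟩ := mem_edgesBetween.1 he
        intro hcon
        exact (h3 u hu v hv huv fun a b => h' ⟨a, b⟩).2 (hcon u (by simp)) (hcon v (by simp))
    · rintro ⟨⟨h1, h2, h3⟩, h4⟩
      refine ⟨h1, h2, fun u hu v hv huv h' => ⟨h3 u hu v hv huv h', fun a b => ?_⟩⟩
      refine h4 s(u, v) (mem_edgesBetween.2 ⟨huv, hu, hv, fun h'' => h' h''.1 h''.2⟩) fun x hx => ?_
      rcases Sym2.mem_iff.1 hx with rfl | rfl <;> assumption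
  rw [h, lostCopies, eq_sub_iff_add_eq, add_comm]
  exact_mod_cast Finset.card_filter_add_card_filter_not (s := rootedCopies Γ R A G g) _

/-- A lost copy has an edge `uv` with both ends placed in `T`. For each of at most `|W|²` choices of
`u, v` and nine ordered pairs in `T × T`, the copies are rooted at `R` together with `u` and `v`. -/
theorem card_lostCopies_le (Γ : SimpleGraph W) {R A : Finset W} (G : SimpleGraph V)
    (g : W → V) {T : Finset V} (hT : T.card = 3) {B : ℝ} (hB0 : 0 ≤ B)
    (hB : ∀ u v, s(u, v) ∈ edgesBetween Γ R A → ∀ g' : W → V,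
      ((rootedCopies Γ (insert u (insert v R)) A G g').card : ℝ) ≤ B) :
    ((lostCopies Γ R A G g T).card : ℝ) ≤ 9 * (Fintype.card W : ℝ) ^ 2 * B := by
  classical
  let I : Finset ((W × W) × (V × V)) :=
    (Finset.univ.filter fun e => s(e.1, e.2) ∈ edgesBetween Γ R A) ×ˢ (T ×ˢ T)
  let S : (W × W) × (V × V) → Finset (W → V) := fun q =>
    rootedCopies Γ (insert q.1.1 (insert q.1.2 R)) A G
      (Function.update (Function.update g q.1.2 q.2.2) q.1.1 q.2.1)
  have hcover : lostCopies Γ R A G g T ⊆ I.biUnion S := by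
    intro ψ hψ
    rw [lostCopies, Finset.mem_filter] at hψ
    obtain ⟨hψ, e, he, heT⟩ := hψ
    induction e using Sym2.ind with
    | _ u v =>
      rw [Finset.mem_biUnion]
      refine ⟨((u, v), (ψ u, ψ v)), ?_, ?_⟩
      · simp only [I, Finset.mem_product, Finset.mem_filter, Finset.mem_univ, true_and]
        exact ⟨he, heT u (by simp), heT v (by simp)⟩
      · rw [mem_rootedCopies] at hψ
        simp only [S]
        rw [mem_rootedCopies]
        refine ⟨fun x hx => ?_, hψ.2.1, fun a ha b hb hab h' => hψ.2.2 a ha b hb hab fun h'' => h' ?_⟩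
        · by_cases hxu : x = u
          · rw [hxu, Function.update_self]
          rw [Function.update_of_ne hxu]
          by_cases hxv : x = v
          · rw [hxv, Function.update_self]
          rw [Function.update_of_ne hxv]
          refine hψ.1 x fun hx' => hx ?_
          simp only [Finset.mem_sdiff, Finset.mem_insert] at hx' ⊢
          tauto
        · simp [h''.1, h''.2]
  have h1 : ((lostCopies Γ R A G g T).card : ℝ) ≤ ∑ q ∈ I, ((S q).card : ℝ) := by
    exact_mod_cast (Finset.card_le_card hcover).trans Finset.card_biUnion_le
  have h2 : ∑ q ∈ I, ((S q).card : ℝ) ≤ I.card * B := by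
    rw [← nsmul_eq_mul]
    refine Finset.sum_le_card_nsmul _ _ _ fun q hq => ?_
    simp only [I, Finset.mem_product, Finset.mem_filter, Finset.mem_univ, true_and] at hq
    exact hB _ _ hq.1 _
  have h3 : (I.card : ℝ) ≤ 9 * (Fintype.card W : ℝ) ^ 2 := by
    have : I.card ≤ Fintype.card W ^ 2 * 9 := by
      rw [Finset.card_product, Finset.card_product, hT]
      refine Nat.mul_le_mul_right _ ((Finset.card_filter_le _ _).trans_eq ?_)
      simp [sq]
    rw [mul_comm]
    exact_mod_cast this
  exact (h1.trans h2).trans (mul_le_mul_of_nonneg_right h3 hB0)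

/-- The number of triangles containing an edge is the co-degree of its ends. -/
theorem card_triangles_filter (G : SimpleGraph V) {a b : V} (hab : G.Adj a b)
    [DecidablePred fun T : Finset V => a ∈ T ∧ b ∈ T] :
    ((triangles G).filter fun T => a ∈ T ∧ b ∈ T).card = codeg G a b := by
  classical
  rw [codeg, ← Set.ncard_coe_finset]
  have himg : (((triangles G).filter fun T => a ∈ T ∧ b ∈ T : Finset (Finset V)) : Set (Finset V)) =
      (fun c => ({a, b, c} : Finset V)) '' G.commonNeighbors a b := by
    ext T
    simp only [Finset.coe_filter, Set.mem_ofPred_eq, triangles, SimpleGraph.mem_cliqueFinset_iff,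
      Set.mem_image, SimpleGraph.mem_commonNeighbors]
    constructor
    · rintro ⟨hT, ha, hb⟩
      have hc : ((T.erase a).erase b).card = 1 := by
        rw [Finset.card_erase_of_mem (Finset.mem_erase.2 ⟨hab.ne', hb⟩), Finset.card_erase_of_mem ha,
          hT.card_eq]
      obtain ⟨c, hc⟩ := Finset.card_eq_one.1 hc
      have hcm : c ∈ (T.erase a).erase b := by rw [hc]; simp
      simp only [Finset.mem_erase] at hcm
      refine ⟨c, ⟨hT.isClique ha hcm.2.2 (Ne.symm hcm.2.1), hT.isClique hb hcm.2.2 (Ne.symm hcm.1)⟩, ?_⟩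
      rw [← Finset.insert_erase ha, ← Finset.insert_erase (Finset.mem_erase.2 ⟨hab.ne', hb⟩), hc]
    · rintro ⟨c, ⟨hac, hbc⟩, rfl⟩
      refine ⟨?_, by simp, by simp⟩
      exact SimpleGraph.is3Clique_triple_iff.2 ⟨hab, hac, hbc⟩
  rw [himg, Set.InjOn.ncard_image]
  intro c hc d hd hcd
  rw [SimpleGraph.mem_commonNeighbors] at hc hd
  have : c ∈ ({a, b, d} : Finset V) := by
    rw [← show ({a, b, c} : Finset V) = {a, b, d} from hcd]
    simp
  simp only [Finset.mem_insert, Finset.mem_singleton] at this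
  rcases this with h | h | h
  · exact absurd h hc.1.ne'
  · exact absurd h hc.2.ne'
  · exact h

theorem card_of_mem_triangles {G : SimpleGraph V} {T : Finset V} (h : T ∈ triangles G) :
    T.card = 3 := by
  classical
  rw [triangles, SimpleGraph.mem_cliqueFinset_iff] at h
  exact h.card_eq

/-- Two distinct edges of a copy lie in at most one common triangle. -/
theorem card_triangles_two_edges (Γ : SimpleGraph W) {R A : Finset W} (G : SimpleGraph V)
    {g ψ : W → V} (hψ : ψ ∈ rootedCopies Γ R A G g) {e e' : Sym2 W}
    (he : e ∈ edgesBetween Γ R A) (he' : e' ∈ edgesBetween Γ R A) (hne : e ≠ e')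
    [DecidablePred fun T : Finset V => (∀ x ∈ e, ψ x ∈ T) ∧ ∀ x ∈ e', ψ x ∈ T] :
    ((triangles G).filter fun T => (∀ x ∈ e, ψ x ∈ T) ∧ ∀ x ∈ e', ψ x ∈ T).card ≤ 1 := by
  classical
  rw [mem_rootedCopies] at hψ
  have hAe : ∀ e ∈ edgesBetween Γ R A, e.toFinset ⊆ A ∧ e.toFinset.card = 2 := by
    intro e he
    induction e using Sym2.ind with
    | _ u v =>
      obtain ⟨huv, hu, hv, -⟩ := mem_edgesBetween.1 he
      refine ⟨fun x hx => ?_, Sym2.card_toFinset_of_not_isDiag _ (by simpa using huv.ne)⟩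
      rw [Sym2.mem_toFinset, Sym2.mem_iff] at hx
      rcases hx with rfl | rfl <;> assumption
  let U := (e.toFinset ∪ e'.toFinset).image ψ
  -- Two distinct edges have at least three ends, which `ψ` maps injectively; a triangle containing
  -- their images is determined.
  have hU : 3 ≤ U.card := by
    rw [Finset.card_image_of_injOn (hψ.2.1.mono (by
      exact_mod_cast Finset.union_subset (hAe e he).1 (hAe e' he').1))]
    by_contra hcon
    have h1 := Finset.eq_of_subset_of_card_le (Finset.subset_union_left (s₁ := e.toFinset)
      (s₂ := e'.toFinset)) (by rw [(hAe e he).2]; omega)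
    have h2 := Finset.eq_of_subset_of_card_le (Finset.subset_union_right (s₁ := e.toFinset)
      (s₂ := e'.toFinset)) (by rw [(hAe e' he').2]; omega)
    refine hne (Sym2.ext fun x => ?_)
    rw [← Sym2.mem_toFinset, ← Sym2.mem_toFinset, h1, ← h2]
  have hmem : ∀ T ∈ triangles G, ((∀ x ∈ e, ψ x ∈ T) ∧ ∀ x ∈ e', ψ x ∈ T) → T = U := by
    rintro T hT ⟨h1, h2⟩
    refine (Finset.eq_of_subset_of_card_le ?_ (by rw [card_of_mem_triangles hT]; exact hU)).symm
    intro y hy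
    obtain ⟨x, hx, rfl⟩ := Finset.mem_image.1 hy
    rcases Finset.mem_union.1 hx with hx | hx
    · exact h1 x (Sym2.mem_toFinset.1 hx)
    · exact h2 x (Sym2.mem_toFinset.1 hx)
  rw [Finset.card_le_one]
  intro T hT T' hT'
  rw [Finset.mem_filter] at hT hT'
  rw [hmem T hT.1 hT.2, hmem T' hT'.1 hT'.2]

open Classical in
/-- The number of triangles whose removal destroys the copy `ψ`. -/
noncomputable def killers (Γ : SimpleGraph W) (R A : Finset W) (G : SimpleGraph V) (ψ : W → V) :
    Finset (Finset V) :=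
  (triangles G).filter fun T => ∃ e ∈ edgesBetween Γ R A, ∀ x ∈ e, ψ x ∈ T

theorem sum_card_lostCopies (Γ : SimpleGraph W) (R A : Finset W) (G : SimpleGraph V) (g : W → V) :
    ∑ T ∈ triangles G, (lostCopies Γ R A G g T).card =
      ∑ ψ ∈ rootedCopies Γ R A G g, (killers Γ R A G ψ).card := by
  classical
  simp only [lostCopies, killers, Finset.card_filter]
  exact Finset.sum_comm

/-- The number of triangles that destroy a copy, when the co-degrees are known. -/
theorem card_killers_bounds (Γ : SimpleGraph W) {R A : Finset W} (G : SimpleGraph V)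
    {g ψ : W → V} (hψ : ψ ∈ rootedCopies Γ R A G g) {y ε : ℝ}
    (hY : ∀ a b, a ≠ b → |(codeg G a b : ℝ) - y| ≤ ε) :
    |((killers Γ R A G ψ).card : ℝ) - (edgesBetween Γ R A).card * y| ≤
      (edgesBetween Γ R A).card * ε + ((edgesBetween Γ R A).card : ℝ) ^ 2 := by
  classical
  set E := edgesBetween Γ R A with hE
  let hit : Finset V → Finset (Sym2 W) := fun T => E.filter fun e => ∀ x ∈ e, ψ x ∈ T
  have hψ' := mem_rootedCopies.1 hψ
  have hcod : ∀ e ∈ E, |(((triangles G).filter fun T => ∀ x ∈ e, ψ x ∈ T).card : ℝ) - y| ≤ ε := by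
    intro e he
    induction e using Sym2.ind with
    | _ u v =>
      obtain ⟨huv, hu, hv, h'⟩ := mem_edgesBetween.1 he
      have hadj := hψ'.2.2 u hu v hv huv h'
      have : ((triangles G).filter fun T => ∀ x ∈ s(u, v), ψ x ∈ T) =
          (triangles G).filter fun T => ψ u ∈ T ∧ ψ v ∈ T := by
        congr 1
        funext T
        simp
      rw [this, card_triangles_filter G hadj]
      exact hY _ _ hadj.ne
  have hsum : ∑ e ∈ E, ((triangles G).filter fun T => ∀ x ∈ e, ψ x ∈ T).card =
      ∑ T ∈ triangles G, (hit T).card := by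
    simp only [hit, Finset.card_filter]
    exact Finset.sum_comm
  have hsum2 : ∑ T ∈ triangles G, ((hit T).offDiag).card ≤ E.card ^ 2 := by
    have h1 : ∑ T ∈ triangles G, ((hit T).offDiag).card =
        ∑ q ∈ E.offDiag, ((triangles G).filter fun T =>
          (∀ x ∈ q.1, ψ x ∈ T) ∧ ∀ x ∈ q.2, ψ x ∈ T).card := by
      have : ∀ T, (hit T).offDiag = E.offDiag.filter fun q =>
          (∀ x ∈ q.1, ψ x ∈ T) ∧ ∀ x ∈ q.2, ψ x ∈ T := by
        intro T
        ext q
        simp only [hit, Finset.mem_offDiag, Finset.mem_filter]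
        tauto
      simp only [this, Finset.card_filter]
      exact Finset.sum_comm
    rw [h1]
    refine (Finset.sum_le_card_nsmul _ _ 1 fun q hq => ?_).trans ?_
    · rw [Finset.mem_offDiag] at hq
      exact card_triangles_two_edges Γ G hψ hq.1 hq.2.1 hq.2.2
    · rw [smul_eq_mul, mul_one, Finset.offDiag_card, sq]
      exact Nat.sub_le _ _
  have hk : (killers Γ R A G ψ).card = ∑ T ∈ triangles G, if (hit T).Nonempty then 1 else 0 := by
    rw [killers, Finset.card_filter]
    refine Finset.sum_congr rfl fun T _ => ?_
    congr 1
    simp only [hit, Finset.filter_nonempty_iff, hE]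
  have hle : (killers Γ R A G ψ).card ≤ ∑ T ∈ triangles G, (hit T).card := by
    rw [hk]
    refine Finset.sum_le_sum fun T _ => ?_
    split_ifs with h
    · exact h.card_pos
    · exact Nat.zero_le _
  -- A Bonferroni bound: a triangle that hits `k ≥ 1` edges is counted `k ≤ 1 + k (k - 1)` times,
  -- and the ordered pairs of distinct edges hit together number at most `E²` over all triangles.
  have hge : ∑ T ∈ triangles G, (hit T).card ≤ (killers Γ R A G ψ).card + E.card ^ 2 := by
    refine le_trans ?_ (Nat.add_le_add_left hsum2 _)
    rw [hk, ← Finset.sum_add_distrib]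
    refine Finset.sum_le_sum fun T _ => ?_
    rw [Finset.offDiag_card]
    split_ifs with h
    · have := h.card_pos
      obtain ⟨k, hk⟩ := Nat.exists_eq_succ_of_ne_zero this.ne'
      rw [hk, Nat.succ_eq_add_one, ← Nat.sub_one_mul, Nat.add_sub_cancel]
      nlinarith
    · rw [Finset.not_nonempty_iff_eq_empty.1 h]
      simp
  have habs : |((∑ T ∈ triangles G, (hit T).card : ℕ) : ℝ) - E.card * y| ≤ E.card * ε := by
    rw [← hsum, Nat.cast_sum, ← nsmul_eq_mul, ← Finset.sum_const, ← Finset.sum_sub_distrib]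
    refine (Finset.abs_sum_le_sum_abs _ _).trans ?_
    rw [← nsmul_eq_mul, ← Finset.sum_const]
    exact Finset.sum_le_sum hcod
  have hle' : ((killers Γ R A G ψ).card : ℝ) ≤ ((∑ T ∈ triangles G, (hit T).card : ℕ) : ℝ) := by
    exact_mod_cast hle
  have hge' : ((∑ T ∈ triangles G, (hit T).card : ℕ) : ℝ) ≤
      (killers Γ R A G ψ).card + (E.card : ℝ) ^ 2 := by
    exact_mod_cast hge
  have hsq : 0 ≤ (E.card : ℝ) ^ 2 := by positivity
  rw [abs_le] at habs ⊢
  constructor <;> linarith [habs.1, habs.2]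

end Killing

section OneStep

variable {W : Type*} [Fintype W] [DecidableEq W]

/-! ### One step of the process -/

/-- The exponential moment of a bounded nonnegative quantity under the uniform distribution. -/
theorem average_exp_le {α : Type*} (s : Finset α) (hs : s.Nonempty) (X : α → ℝ) {M c : ℝ}
    (h0 : ∀ a ∈ s, 0 ≤ X a) (hM : ∀ a ∈ s, X a ≤ M) (hc : |c| * M ≤ 1) :
    (s.card : ℝ)⁻¹ * ∑ a ∈ s, Real.exp (c * X a) ≤
      Real.exp (c * ((s.card : ℝ)⁻¹ * ∑ a ∈ s, X a) +
        c ^ 2 * M * ((s.card : ℝ)⁻¹ * ∑ a ∈ s, X a)) := by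
  have hcard : (0 : ℝ) < s.card := by exact_mod_cast hs.card_pos
  -- Use `exp y ≤ 1 + y + y²` for `|y| ≤ 1`; the square is made linear by `X ≤ M`, so that only the
  -- mean of `X` enters.
  have hpt : ∀ a ∈ s, Real.exp (c * X a) ≤ 1 + (c + c ^ 2 * M) * X a := by
    intro a ha
    have h1 : |c * X a| ≤ 1 := by
      rw [abs_mul, abs_of_nonneg (h0 a ha)]
      exact (mul_le_mul_of_nonneg_left (hM a ha) (abs_nonneg c)).trans hc
    have h2 := (abs_le.1 (Real.abs_exp_sub_one_sub_id_le h1)).2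
    have h3 : (c * X a) ^ 2 ≤ c ^ 2 * M * X a := by
      have := mul_le_mul_of_nonneg_left (hM a ha) (mul_nonneg (sq_nonneg c) (h0 a ha))
      nlinarith
    linarith
  calc (s.card : ℝ)⁻¹ * ∑ a ∈ s, Real.exp (c * X a)
      ≤ (s.card : ℝ)⁻¹ * ∑ a ∈ s, (1 + (c + c ^ 2 * M) * X a) := by
        gcongr with a ha
        exact hpt a ha
    _ = (c * ((s.card : ℝ)⁻¹ * ∑ a ∈ s, X a) +
        c ^ 2 * M * ((s.card : ℝ)⁻¹ * ∑ a ∈ s, X a)) + 1 := by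
        rw [Finset.sum_add_distrib, ← Finset.mul_sum, Finset.sum_const, nsmul_eq_mul, mul_one]
        field_simp
        ring
    _ ≤ _ := Real.add_one_le_exp _

/-- Bernoulli's inequality on one side, `1 - x ≤ exp (-x)` on the other. -/
theorem pow_one_sub_bounds {x : ℝ} {e : ℕ} (hx0 : 0 ≤ x) (hx1 : x ≤ 1) (hex : e * x ≤ 1) :
    |1 - (1 - x) ^ e - e * x| ≤ (e * x) ^ 2 := by
  have h1 := one_add_mul_le_pow (show (-2 : ℝ) ≤ -x by linarith) e
  have h2 : (1 - x) ^ e ≤ Real.exp (-(e * x)) := by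
    rw [show -((e : ℝ) * x) = e * -x by ring, Real.exp_nat_mul]
    exact pow_le_pow_left₀ (by linarith) (by linarith [Real.add_one_le_exp (-x)]) e
  have h3 := (abs_le.1 (Real.abs_exp_sub_one_sub_id_le (x := -(e * x)) (by
    rw [abs_neg, abs_of_nonneg (by positivity)]
    exact hex))).2
  rw [← sub_eq_add_neg] at h1
  rw [abs_le]
  constructor
  · nlinarith
  · nlinarith [sq_nonneg ((e : ℝ) * x)]

/-- The expected number of copies destroyed in one step. -/
theorem average_lostCopies (Γ : SimpleGraph W) {R A : Finset W} {n : ℕ} (hn : 0 < n) {p C : ℝ}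
    (hp : 0 < p) (hC : 0 < C) {G : SimpleGraph (Fin n)} (hG : Accurate C p G)
    (hz1 : zeta n p ≤ 1) (hCz : C * zeta n p ≤ 1 / 2) (hz0 : 0 ≤ zeta n p)
    (he : ((edgesBetween Γ R A).card : ℝ) ≤ n * p ^ 2 * zeta n p) (g : W → Fin n) :
    (triangles G).Nonempty ∧
    |((triangles G).card : ℝ)⁻¹ * ∑ T ∈ triangles G, ((lostCopies Γ R A G g T).card : ℝ) -
        (rootedCopies Γ R A G g).card * ((edgesBetween Γ R A).card * (6 / (n ^ 2 * p)))| ≤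
      (rootedCopies Γ R A G g).card * ((edgesBetween Γ R A).card * (6 / (n ^ 2 * p))) *
        ((4 * C + 2) * zeta n p) := by
  obtain ⟨-, hY, hQ⟩ := hG
  set z := zeta n p
  set E : ℝ := ((edgesBetween Γ R A).card : ℝ)
  set N : ℝ := ((rootedCopies Γ R A G g).card : ℝ)
  have hn' : (0 : ℝ) < n := by exact_mod_cast hn
  have hE : 0 ≤ E := Nat.cast_nonneg _
  have hN : 0 ≤ N := Nat.cast_nonneg _
  set q₀ : ℝ := 1 / 6 * (n : ℝ) ^ 3 * p ^ 3 with hq₀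
  have hq₀pos : 0 < q₀ := by positivity
  have hQ' : |((triangles G).card : ℝ) - q₀| ≤ q₀ * (C * z) := by
    have h1 : C * z ^ 2 ≤ C * z := by nlinarith [mul_nonneg hC.le hz0]
    have h2 := (hQ.le.trans h1)
    have h3 : ((triangles G).card : ℝ) - q₀ = q₀ * ((triangleCount G : ℝ) / q₀ - 1) := by
      rw [triangleCount]
      field_simp
    rw [h3, abs_mul, abs_of_pos hq₀pos]
    gcongr
  have hQge : q₀ / 2 ≤ (triangles G).card := by
    have := (abs_le.1 hQ').1
    nlinarith
  have hQpos : (0 : ℝ) < (triangles G).card := by linarith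
  have hne : (triangles G).Nonempty := Finset.card_pos.1 (by exact_mod_cast hQpos)
  refine ⟨hne, ?_⟩
  have hs : |∑ T ∈ triangles G, ((lostCopies Γ R A G g T).card : ℝ) - N * (E * (n * p ^ 2))| ≤
      N * (E * (n * p ^ 2)) * ((C + 1) * z) := by
    have h1 : ∑ T ∈ triangles G, ((lostCopies Γ R A G g T).card : ℝ) =
        ∑ ψ ∈ rootedCopies Γ R A G g, ((killers Γ R A G ψ).card : ℝ) := by
      exact_mod_cast sum_card_lostCopies Γ R A G g
    have h2 : ∀ a b : Fin n, a ≠ b → |(codeg G a b : ℝ) - n * p ^ 2| ≤ n * p ^ 2 * (C * z) := by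
      intro a b hab
      have h3 : (codeg G a b : ℝ) - n * p ^ 2 =
          n * p ^ 2 * ((codeg G a b : ℝ) / (n * p ^ 2) - 1) := by
        field_simp
      rw [h3, abs_mul, abs_of_pos (by positivity : (0 : ℝ) < n * p ^ 2)]
      gcongr
      exact (hY a b hab).le
    have h4 : N * (E * (n * p ^ 2)) = ∑ _ψ ∈ rootedCopies Γ R A G g, E * (n * p ^ 2) := by
      rw [Finset.sum_const, nsmul_eq_mul]
    rw [h1, h4, ← Finset.sum_sub_distrib, Finset.sum_mul]
    refine (Finset.abs_sum_le_sum_abs _ _).trans (Finset.sum_le_sum fun ψ hψ => ?_)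
    refine (card_killers_bounds Γ G hψ h2).trans ?_
    -- By `he` the overcount `E²` is at most `E n p² ζ`, which turns the constant `C` of the
    -- co-degrees into `C + 1`.
    nlinarith [mul_le_mul_of_nonneg_left he hE]
  have hx : n * p ^ 2 = 6 / (n ^ 2 * p) * q₀ := by
    rw [hq₀]
    field_simp
  set x : ℝ := 6 / (n ^ 2 * p)
  have hx0 : 0 ≤ x := by positivity
  have hNEx : 0 ≤ N * (E * x) := by positivity
  set Q : ℝ := ((triangles G).card : ℝ)
  set s : ℝ := ∑ T ∈ triangles G, ((lostCopies Γ R A G g T).card : ℝ)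
  rw [hx] at hs
  have hfin : |s - N * (E * x) * Q| ≤ N * (E * x) * q₀ * ((2 * C + 1) * z) := by
    have e1 : s - N * (E * x) * Q = (s - N * (E * (x * q₀))) - N * (E * x) * (Q - q₀) := by ring
    rw [e1]
    refine (abs_sub _ _).trans ?_
    rw [abs_mul (N * (E * x)), abs_of_nonneg hNEx]
    have := mul_le_mul_of_nonneg_left hQ' hNEx
    nlinarith
  have e2 : Q⁻¹ * s - N * (E * x) = Q⁻¹ * (s - N * (E * x) * Q) := by
    field_simp
  rw [e2, abs_mul, abs_of_pos (by positivity : 0 < Q⁻¹), inv_mul_le_iff₀ hQpos]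
  -- Dividing by `Q ≥ q₀ / 2` doubles the constant `2 C + 1`.
  refine hfin.trans ?_
  have : 0 ≤ N * (E * x) * ((4 * C + 2) * z) := by positivity
  nlinarith [mul_le_mul_of_nonneg_left hQge this]

/-- One step of the exponential supermartingale. -/
theorem average_exp_step (Γ : SimpleGraph W) {R A : Finset W} {n : ℕ} (hn : 0 < n)
    {p p' C xb Rb S S' c : ℝ} (hp : 0 < p) (hC : 0 < C) (hp' : p' = p - 6 / n ^ 2)
    {G : SimpleGraph (Fin n)} (hG : Accurate C p G)
    (hz0 : 0 ≤ zeta n p) (hCz : (4 * C + 2) * zeta n p ≤ 1)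
    (he : ((edgesBetween Γ R A).card : ℝ) ≤ n * p ^ 2 * zeta n p)
    (hex : ((edgesBetween Γ R A).card : ℝ) * (6 / (n ^ 2 * p)) ≤ zeta n p)
    (hx1 : 6 / (n ^ 2 * p) ≤ 1)
    (hS : S = (n : ℝ) ^ (A.card - R.card) * p ^ (edgesBetween Γ R A).card)
    (hS' : S' = (n : ℝ) ^ (A.card - R.card) * p' ^ (edgesBetween Γ R A).card)
    (g : W → Fin n) (hxb : ((rootedCopies Γ R A G g).card : ℝ) ≤ xb * S)
    (hRb : ∀ T ∈ triangles G, ((lostCopies Γ R A G g T).card : ℝ) ≤ Rb * S')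
    (hc : |c| * Rb ≤ 1) :
    (triangles G).Nonempty ∧
    ((triangles G).card : ℝ)⁻¹ * ∑ T ∈ triangles G,
      Real.exp (c * (((rootedCopies Γ R A (removeTriangle G T) g).card : ℝ) / S' -
        (rootedCopies Γ R A G g).card / S)) ≤
      Real.exp ((|c| * (2 * (4 * C + 3)) * xb * zeta n p + c ^ 2 * (4 * Rb * xb)) *
        ((edgesBetween Γ R A).card * (6 / (n ^ 2 * p)))) := by
  have hn' : (0 : ℝ) < n := by exact_mod_cast hn
  have hz1 : zeta n p ≤ 1 / 2 := by nlinarith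
  obtain ⟨hne, hloss⟩ := average_lostCopies Γ hn hp hC hG (by linarith)
    (by nlinarith) hz0 he g
  refine ⟨hne, ?_⟩
  simp only [rootedCopies_removeTriangle]
  set z := zeta n p
  set E : ℕ := (edgesBetween Γ R A).card
  set N : ℝ := ((rootedCopies Γ R A G g).card : ℝ)
  set x : ℝ := 6 / (n ^ 2 * p) with hx
  set Q : ℝ := ((triangles G).card : ℝ)
  set m : ℝ := Q⁻¹ * ∑ T ∈ triangles G, ((lostCopies Γ R A G g T).card : ℝ) with hm
  have hx0 : 0 ≤ x := by positivity
  have hN : 0 ≤ N := Nat.cast_nonneg _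
  have hSpos : 0 < S := by rw [hS]; positivity
  -- To first order this decay matches the expected relative loss `E x`, so `N / S` has no
  -- first-order drift.
  have hratio : S' = S * (1 - x) ^ E := by
    have hp1 : p' = p * (1 - x) := by
      have : p * x = 6 / n ^ 2 := by
        rw [hx, ← div_div, mul_div_cancel₀ _ hp.ne']
      rw [mul_sub, this, mul_one, hp']
    rw [hS, hS', hp1, mul_pow, mul_assoc]
  have hpow := pow_one_sub_bounds hx0 hx1 (hex.trans (by linarith) : (E : ℝ) * x ≤ 1)
  have hEx : 0 ≤ (E : ℝ) * x := by positivity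
  have hpow2 : 1 / 2 ≤ (1 - x) ^ E := by
    have h1 := one_add_mul_le_pow (show (-2 : ℝ) ≤ -x by linarith) E
    rw [← sub_eq_add_neg] at h1
    linarith
  have hS2 : S ≤ 2 * S' := by
    rw [hratio]
    nlinarith
  have hS'pos : 0 < S' := by linarith
  have hm0 : 0 ≤ m := mul_nonneg (inv_nonneg.2 (Nat.cast_nonneg _))
    (Finset.sum_nonneg fun _ _ => Nat.cast_nonneg _)
  clear_value x E
  have hNS' : N / S' ≤ 2 * xb := by
    have hxb0 : 0 ≤ xb := by
      by_contra hcon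
      nlinarith
    rw [div_le_iff₀ hS'pos]
    nlinarith
  have hNS0 : 0 ≤ N / S' := by positivity
  have hm2 : m / S' ≤ 4 * xb * (E * x) := by
    have h1 : m ≤ 2 * (N * (E * x)) := by
      have h2 := (abs_le.1 hloss).2
      have h3 : N * (E * x) * ((4 * C + 2) * z) ≤ N * (E * x) * 1 := by gcongr
      linarith
    calc m / S' ≤ 2 * (N * (E * x)) / S' := by gcongr
      _ = 2 * (N / S') * (E * x) := by ring
      _ ≤ 2 * (2 * xb) * (E * x) := by gcongr
      _ = _ := by ring
  have hdrift : |N / S' - N / S - m / S'| ≤ 2 * (4 * C + 3) * xb * z * (E * x) := by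
    have e1 : N / S' - N / S - m / S' =
        (N * (1 - (1 - x) ^ E - E * x) - (m - N * (E * x))) / S' := by
      have : N / S = N * (1 - x) ^ E / S' := by
        rw [hratio]
        exact (mul_div_mul_right N S (by linarith : (0 : ℝ) < (1 - x) ^ E).ne').symm
      rw [this]
      ring
    rw [e1, abs_div, abs_of_pos hS'pos]
    have h1 : |N * (1 - (1 - x) ^ E - E * x) - (m - N * (E * x))| ≤
        N * ((E * x) * z) + N * (E * x) * ((4 * C + 2) * z) := by
      refine (abs_sub _ _).trans (add_le_add ?_ hloss)
      rw [abs_mul, abs_of_nonneg hN]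
      refine mul_le_mul_of_nonneg_left (hpow.trans ?_) hN
      rw [sq]
      gcongr
    calc _ ≤ (N * ((E * x) * z) + N * (E * x) * ((4 * C + 2) * z)) / S' := by gcongr
      _ = (N / S') * ((4 * C + 3) * z * (E * x)) := by ring
      _ ≤ (2 * xb) * ((4 * C + 3) * z * (E * x)) := by gcongr
      _ = _ := by ring
  have hexp : ∀ T, Real.exp (c * ((N - ((lostCopies Γ R A G g T).card : ℝ)) / S' - N / S)) =
      Real.exp (c * (N / S' - N / S)) *
        Real.exp ((-(c / S')) * ((lostCopies Γ R A G g T).card : ℝ)) := by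
    intro T
    rw [← Real.exp_add]
    congr 1
    ring
  simp only [hexp, ← Finset.mul_sum]
  rw [mul_left_comm]
  have hcS : |-(c / S')| * (Rb * S') ≤ 1 := by
    rw [abs_neg, abs_div, abs_of_pos hS'pos]
    calc |c| / S' * (Rb * S') = |c| * Rb := by field_simp
      _ ≤ 1 := hc
  have havg := average_exp_le (triangles G) hne
    (fun T => ((lostCopies Γ R A G g T).card : ℝ)) (fun _ _ => Nat.cast_nonneg _) hRb hcS
  refine (mul_le_mul_of_nonneg_left havg (Real.exp_pos _).le).trans ?_
  rw [← Real.exp_add, Real.exp_le_exp]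
  have hRb0 : 0 ≤ Rb := by
    obtain ⟨T, hT⟩ := hne
    have h1 := (Nat.cast_nonneg (α := ℝ) (lostCopies Γ R A G g T).card).trans (hRb T hT)
    by_contra hcon
    nlinarith
  have t1 : c * (N / S' - N / S - m / S') ≤ |c| * (2 * (4 * C + 3) * xb * z * (E * x)) := by
    refine (le_abs_self _).trans ?_
    rw [abs_mul]
    gcongr
  have t2 : c ^ 2 * Rb * (m / S') ≤ c ^ 2 * Rb * (4 * xb * (E * x)) := by gcongr
  have t3 : (-(c / S')) ^ 2 * (Rb * S') * m = c ^ 2 * Rb * (m / S') := by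
    clear_value m
    field_simp
  rw [t3]
  calc _ = c * (N / S' - N / S - m / S') + c ^ 2 * Rb * (m / S') := by ring
    _ ≤ _ := by linarith

end OneStep

/-! ### Concentration -/

theorem density_succ (n j : ℕ) : density n (j + 1) = density n j - 6 / (n : ℝ) ^ 2 := by
  unfold density
  push_cast
  ring

theorem density_antitone (n : ℕ) : Antitone (density n) := by
  refine antitone_nat_of_succ_le fun j => ?_
  rw [density_succ]
  have : (0 : ℝ) ≤ 6 / (n : ℝ) ^ 2 := by positivity
  linarith

theorem density_zero (n : ℕ) : density n 0 = 1 := by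
  simp [density]

theorem density_le_one (n j : ℕ) : density n j ≤ 1 := by
  rw [← density_zero n]
  exact density_antitone n (Nat.zero_le j)

theorem zeta_nonneg {n : ℕ} {p : ℝ} (hp : 0 ≤ p) : 0 ≤ zeta n p := by
  unfold zeta
  have := Real.log_natCast_nonneg n
  positivity

theorem zeta_anti {n : ℕ} {p q : ℝ} (hp : 0 < p) (hpq : p ≤ q) : zeta n q ≤ zeta n p := by
  unfold zeta
  have := Real.log_natCast_nonneg n
  gcongr

/-- With `x = 6/(n²p)` one has `1/p' = 1/p + x/p'`, so `ζ` grows by at least `x ζ` in each step and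
the sum telescopes. Hence the drift accumulated over the whole run is of the order of the current
`ζ`. -/
theorem sum_step_mul_zeta_le {n i : ℕ} (hp : ∀ j ≤ i, 0 < density n j) :
    ∑ j ∈ Finset.range i, 6 / ((n : ℝ) ^ 2 * density n j) * zeta n (density n j) ≤
      zeta n (density n i) := by
  induction i with
  | zero => simpa using zeta_nonneg (hp 0 le_rfl).le
  | succ i ih =>
    rw [Finset.sum_range_succ]
    have h1 := hp i (by omega)
    have h2 := hp (i + 1) le_rfl
    have h3 := ih fun j hj => hp j (by omega)
    have h4 := density_antitone n (Nat.le_succ i)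
    have hl := Real.log_natCast_nonneg n
    have hinv : (density n i)⁻¹ + 6 / ((n : ℝ) ^ 2 * density n i) * (density n i)⁻¹ ≤
        (density n (i + 1))⁻¹ := by
      have e : (density n (i + 1))⁻¹ = (density n i)⁻¹ +
          6 / ((n : ℝ) ^ 2 * density n i) * (density n (i + 1))⁻¹ := by
        have h5 : 6 / ((n : ℝ) ^ 2 * density n i) =
            (density n i - density n (i + 1)) * (density n i)⁻¹ := by
          rw [density_succ, ← div_div]
          ring
        rw [h5]
        field_simp
        ring
      rw [e]
      gcongr
    have : zeta n (density n i) + 6 / ((n : ℝ) ^ 2 * density n i) * zeta n (density n i) ≤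
        zeta n (density n (i + 1)) := by
      calc _ = (n : ℝ) ^ (-(1 / 2) : ℝ) * ((density n i)⁻¹ +
            6 / ((n : ℝ) ^ 2 * density n i) * (density n i)⁻¹) * Real.log n := by
            unfold zeta
            ring
        _ ≤ _ := by
            unfold zeta
            gcongr
    linarith

/-- Telescoping `log (p'/p) ≤ p'/p - 1 = -6/(n²p)`. This limits the accumulated quadratic term to a
single logarithm. -/
theorem sum_step_le {n i : ℕ} (hp : ∀ j ≤ i, 0 < density n j) :
    ∑ j ∈ Finset.range i, 6 / ((n : ℝ) ^ 2 * density n j) ≤ -Real.log (density n i) := by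
  induction i with
  | zero => simp [density_zero]
  | succ i ih =>
    rw [Finset.sum_range_succ]
    have h1 := hp i (by omega)
    have h2 := hp (i + 1) le_rfl
    have h3 := ih fun j hj => hp j (by omega)
    have h4 := Real.log_le_sub_one_of_pos (div_pos h2 h1)
    rw [Real.log_div h2.ne' h1.ne', density_succ, sub_div, div_self h1.ne', div_div] at h4
    rw [density_succ]
    linarith

section Concentration

variable {W : Type*} [Fintype W] [DecidableEq W]

/-- The exponential of `c (X/S - 1)`, compensated by the accumulated rates, is a supermartingale as
long as the history is good. Both signs of `c` are allowed, for the two tails. The exponent collects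
the initial error, the threshold, the drift and the quadratic term. -/
theorem concentration (Γ : SimpleGraph W) {R A : Finset W} (h : R ⊆ A) (hf : A.card - R.card ≠ 0)
    {n i : ℕ} (hn : 0 < n) (hi : i ≤ n ^ 2) (g : W → Fin n) (hg : Set.InjOn g R)
    {C xb Rb err c : ℝ} (hC : 0 < C) (hp : ∀ j ≤ i, 0 < density n j)
    (hnum : ∀ j < i, (4 * C + 2) * zeta n (density n j) ≤ 1 ∧
      ((edgesBetween Γ R A).card : ℝ) ≤ n * density n j ^ 2 * zeta n (density n j) ∧
      ((edgesBetween Γ R A).card : ℝ) * (6 / (n ^ 2 * density n j)) ≤ zeta n (density n j) ∧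
      6 / ((n : ℝ) ^ 2 * density n j) ≤ 1)
    (hxb : 0 ≤ xb) (hRb : 0 ≤ Rb) (hc : |c| * Rb ≤ 1) :
    (removalProcess n).toOuterMeasure {G : ℕ → SimpleGraph (Fin n) |
      (∀ j < i, Accurate C (density n j) (G j) ∧
        ((rootedCopies Γ R A (G j) g).card : ℝ) ≤
          xb * (extGraph Γ R A h).scaling n (density n j) ∧
        ∀ T ∈ triangles (G j), ((lostCopies Γ R A (G j) g T).card : ℝ) ≤
          Rb * (extGraph Γ R A h).scaling n (density n (j + 1))) ∧
      |c| * err < c * (((rootedCopies Γ R A (G i) g).card : ℝ) /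
        (extGraph Γ R A h).scaling n (density n i) - 1)} ≤
      ENNReal.ofReal (Real.exp (|c| * ((Fintype.card W : ℝ) ^ 2 / n) - |c| * err +
        |c| * (2 * (4 * C + 3)) * xb * ((edgesBetween Γ R A).card * zeta n (density n i)) +
        c ^ 2 * (4 * Rb * xb) *
          ((edgesBetween Γ R A).card * -Real.log (density n i)))) := by
  have hn' : (0 : ℝ) < n := by exact_mod_cast hn
  set E : ℕ := (edgesBetween Γ R A).card with hE
  let S : ℕ → ℝ := fun j => (extGraph Γ R A h).scaling n (density n j)
  have hS : ∀ j, S j = (n : ℝ) ^ (A.card - R.card) * density n j ^ E := fun j =>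
    extGraph_scaling Γ h
  let d : ℕ → ℝ := fun j =>
    (|c| * (2 * (4 * C + 3)) * xb * zeta n (density n j) + c ^ 2 * (4 * Rb * xb)) *
      (E * (6 / (n ^ 2 * density n j)))
  let D : ℕ → ℝ := fun j => ∑ l ∈ Finset.range j, d l
  let F : ℕ → SimpleGraph (Fin n) → ENNReal := fun j G => ENNReal.ofReal (Real.exp
    (c * (((rootedCopies Γ R A G g).card : ℝ) / S j - 1) - D j - (|c| * err - D i)))
  refine (removalProcess_le_of_supermartingale (i := i) hi F
    (fun j G => Accurate C (density n j) G ∧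
        ((rootedCopies Γ R A G g).card : ℝ) ≤ xb * S j ∧
        ∀ T ∈ triangles G, ((lostCopies Γ R A G g T).card : ℝ) ≤ Rb * S (j + 1))
    (fun G => |c| * err < c * (((rootedCopies Γ R A G g).card : ℝ) / S i - 1)) ?_ ?_).trans ?_
  · rintro j hj G ⟨hacc, hx, hR⟩
    obtain ⟨h1, h2, h3, h4⟩ := hnum j hj
    obtain ⟨hne, hstep⟩ := average_exp_step Γ hn (hp j hj.le) hC (density_succ n j) hacc
      (zeta_nonneg (hp j hj.le).le) h1 h2 h3 h4 (hS j) (hS (j + 1)) g hx hR hc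
    rw [pmfExp_step G hne]
    simp only [F]
    have hsplit : ∀ T, Real.exp (c * (((rootedCopies Γ R A (removeTriangle G T) g).card : ℝ) /
          S (j + 1) - 1) - D (j + 1) - (|c| * err - D i)) =
        Real.exp (c * (((rootedCopies Γ R A (removeTriangle G T) g).card : ℝ) / S (j + 1) -
          (rootedCopies Γ R A G g).card / S j)) *
        Real.exp (c * (((rootedCopies Γ R A G g).card : ℝ) / S j - 1) - D (j + 1) -
          (|c| * err - D i)) := by
      intro T
      rw [← Real.exp_add]
      congr 1
      ring
    have hcard : (0 : ℝ) < (triangles G).card := by exact_mod_cast hne.card_pos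
    rw [← ENNReal.ofReal_sum_of_nonneg fun _ _ => (Real.exp_pos _).le,
      ← ENNReal.ofReal_natCast, ← ENNReal.ofReal_inv_of_pos hcard,
      ← ENNReal.ofReal_mul (inv_nonneg.2 hcard.le)]
    refine ENNReal.ofReal_le_ofReal ?_
    simp only [hsplit]
    rw [← Finset.sum_mul, ← mul_assoc]
    refine (mul_le_mul_of_nonneg_right hstep (Real.exp_pos _).le).trans_eq ?_
    rw [← Real.exp_add]
    congr 1
    have : D (j + 1) = D j + d j := Finset.sum_range_succ _ _
    rw [this]
    simp only [d]
    ring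
  · intro G hG
    simp only [F]
    rw [← ENNReal.ofReal_one]
    refine ENNReal.ofReal_le_ofReal (Real.one_le_exp ?_)
    linarith
  · simp only [F]
    refine ENNReal.ofReal_le_ofReal (Real.exp_le_exp.2 ?_)
    have hD0 : D 0 = 0 := Finset.sum_range_zero _
    have hDi : D i ≤ |c| * (2 * (4 * C + 3)) * xb * (E * zeta n (density n i)) +
        c ^ 2 * (4 * Rb * xb) * (E * -Real.log (density n i)) := by
      have e : D i = |c| * (2 * (4 * C + 3)) * xb * (E *
          ∑ j ∈ Finset.range i, 6 / ((n : ℝ) ^ 2 * density n j) * zeta n (density n j)) +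
          c ^ 2 * (4 * Rb * xb) * (E *
            ∑ j ∈ Finset.range i, 6 / ((n : ℝ) ^ 2 * density n j)) := by
        simp only [D, d, Finset.mul_sum, ← Finset.sum_add_distrib]
        refine Finset.sum_congr rfl fun j _ => ?_
        ring
      rw [e]
      have := sum_step_mul_zeta_le hp
      have := sum_step_le hp
      gcongr
    -- In the complete graph every injective map is a copy, so the initial error is only the share
    -- of non-injective maps.
    have hX : |((rootedCopies Γ R A (⊤ : SimpleGraph (Fin n)) g).card : ℝ) / S 0 - 1| ≤
        (Fintype.card W : ℝ) ^ 2 / n := by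
      have hS0 : S 0 = (n : ℝ) ^ (A.card - R.card) := by
        rw [hS, density_zero, one_pow, mul_one]
      have h1 := card_rootedCopies_top_ge Γ h g hg
      have h2 : ((rootedCopies Γ R A (⊤ : SimpleGraph (Fin n)) g).card : ℝ) ≤
          (n : ℝ) ^ (A.card - R.card) := by
        have := card_rootedCopies_le Γ h (⊤ : SimpleGraph (Fin n)) g
        rw [Fintype.card_fin] at this
        exact_mod_cast this
      rw [Fintype.card_fin] at h1
      rw [hS0]
      obtain ⟨k, hk⟩ := Nat.exists_eq_succ_of_ne_zero hf
      rw [hk, Nat.succ_eq_add_one, Nat.add_sub_cancel] at h1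
      rw [hk, Nat.succ_eq_add_one] at h2 ⊢
      have e : (Fintype.card W : ℝ) ^ 2 / n = (Fintype.card W : ℝ) ^ 2 * n ^ k / n ^ (k + 1) := by
        field_simp
        ring
      have hnk : (0 : ℝ) < n ^ (k + 1) := by positivity
      rw [e, div_sub_one hnk.ne', abs_div, abs_of_pos hnk]
      gcongr
      have : 0 ≤ (Fintype.card W : ℝ) ^ 2 * n ^ k := by positivity
      rw [abs_le]
      constructor <;> linarith
    have hcX : c * (((rootedCopies Γ R A (⊤ : SimpleGraph (Fin n)) g).card : ℝ) / S 0 - 1) ≤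
        |c| * ((Fintype.card W : ℝ) ^ 2 / n) := by
      refine (le_abs_self _).trans ?_
      rw [abs_mul]
      gcongr
    linarith

end Concentration

/-! ### The range of times where the densities are not too small -/

/-- The step `i` is early enough that `p > 0` and `ζ ^ δ` is smaller than `1 / (K (log n) ^ a)`. -/
structure Early (δ K a : ℝ) (n i : ℕ) : Prop where
  density_pos : 0 < density n i
  le_log : K ≤ Real.log n
  zeta_small : zeta n (density n i) ^ δ * (K * Real.log n ^ a) ≤ 1

section Early

variable {δ K a : ℝ} {n i : ℕ}

theorem Early.pos (h : Early δ K a n i) (hK : 1 ≤ K) : 0 < n := by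
  rcases Nat.eq_zero_or_pos n with rfl | hn
  · have := h.le_log
    simp at this
    linarith
  · exact hn

theorem Early.one_le_log (h : Early δ K a n i) (hK : 1 ≤ K) : 1 ≤ Real.log n :=
  hK.trans h.le_log

theorem Early.le_n (h : Early δ K a n i) : K ≤ n :=
  h.le_log.trans (Real.log_le_self (Nat.cast_nonneg n))

theorem Early.density_pos_of_le (h : Early δ K a n i) {j : ℕ} (hj : j ≤ i) : 0 < density n j :=
  h.density_pos.trans_le (density_antitone n hj)

theorem zeta_pos_of_one_le_log {p : ℝ} (hl : 1 ≤ Real.log n) (hp : 0 < p) (hn : 0 < n) :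
    0 < zeta n p := by
  have : 0 < Real.log n := by linarith
  unfold zeta
  positivity

theorem zeta_sq {p : ℝ} (hn : 0 < n) (hp : 0 < p) :
    n * p ^ 2 * zeta n p ^ 2 = Real.log n ^ 2 := by
  have hn' : (0 : ℝ) < n := by exact_mod_cast hn
  have h : ((n : ℝ) ^ (-(1 / 2) : ℝ)) ^ 2 = (n : ℝ)⁻¹ := by
    rw [← Real.rpow_natCast, ← Real.rpow_mul hn'.le, ← Real.rpow_neg_one]
    norm_num
  unfold zeta
  rw [mul_pow, mul_pow, h]
  field_simp

theorem Early.zeta_pos (h : Early δ K a n i) (hK : 1 ≤ K) {j : ℕ} (hj : j ≤ i) :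
    0 < zeta n (density n j) :=
  zeta_pos_of_one_le_log (h.one_le_log hK) (h.density_pos_of_le hj) (h.pos hK)

theorem Early.zeta_le (h : Early δ K a n i) {j : ℕ} (hj : j ≤ i) :
    zeta n (density n j) ≤ zeta n (density n i) :=
  zeta_anti h.density_pos (density_antitone n hj)

theorem Early.mul_zeta_rpow_le_one (h : Early δ K a n i) (hK : 1 ≤ K) (ha : 0 ≤ a) :
    K * zeta n (density n i) ^ δ ≤ 1 := by
  refine le_trans ?_ h.zeta_small
  have h1 := Real.one_le_rpow (h.one_le_log hK) ha
  have h2 : 0 ≤ K * zeta n (density n i) ^ δ :=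
    mul_nonneg (by linarith) (Real.rpow_nonneg (h.zeta_pos hK le_rfl).le _)
  calc _ ≤ K * zeta n (density n i) ^ δ * Real.log n ^ a := le_mul_of_one_le_right h2 h1
    _ = _ := by ring

theorem Early.zeta_le_one (h : Early δ K a n i) (hK : 1 ≤ K) (ha : 0 ≤ a) (hδ : 0 < δ) :
    zeta n (density n i) ≤ 1 := by
  have h1 := h.mul_zeta_rpow_le_one hK ha
  have h2 := h.zeta_pos hK le_rfl
  by_contra hcon
  have h3 := Real.one_lt_rpow (not_le.1 hcon) hδ
  nlinarith

theorem Early.mul_zeta_le_one (h : Early δ K a n i) (hK : 1 ≤ K) (ha : 0 ≤ a) (hδ : 0 < δ)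
    (hδ1 : δ ≤ 1) : K * zeta n (density n i) ≤ 1 := by
  refine le_trans ?_ (h.mul_zeta_rpow_le_one hK ha)
  gcongr
  exact Real.self_le_rpow_of_le_one (h.zeta_pos hK le_rfl).le (h.zeta_le_one hK ha hδ) hδ1

theorem one_div_le_zeta_sq {p : ℝ} (hn : 0 < n) (hl : 1 ≤ Real.log n) (hp : 0 < p) (hp1 : p ≤ 1) :
    1 ≤ n * zeta n p ^ 2 := by
  have h1 := zeta_sq hn hp
  have h2 : p ^ 2 ≤ 1 := pow_le_one₀ hp.le hp1
  have h3 : 0 ≤ n * zeta n p ^ 2 := by positivity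
  nlinarith

theorem Early.six_div_le (h : Early δ K a n i) (hK : 1 ≤ K) {j : ℕ} (hj : j ≤ i) {E : ℝ}
    (hEK : 6 * E ≤ K) :
    E * (6 / ((n : ℝ) ^ 2 * density n j)) ≤ zeta n (density n j) := by
  have hn : (0 : ℝ) < n := by exact_mod_cast h.pos hK
  have hp := h.density_pos_of_le hj
  have hl := h.one_le_log hK
  have hn1 : (1 : ℝ) ≤ n := by exact_mod_cast h.pos hK
  have h1 : (n : ℝ)⁻¹ ≤ (n : ℝ) ^ (-(1 / 2) : ℝ) := by
    rw [← Real.rpow_neg_one]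
    exact Real.rpow_le_rpow_of_exponent_le hn1 (by norm_num)
  have h2 : 6 * E ≤ n := hEK.trans h.le_n
  calc E * (6 / ((n : ℝ) ^ 2 * density n j)) = (6 * E) * (n : ℝ)⁻¹ * (n : ℝ)⁻¹ *
        (density n j)⁻¹ := by
        field_simp
    _ ≤ n * (n : ℝ)⁻¹ * (n : ℝ)⁻¹ * (density n j)⁻¹ := by gcongr
    _ = (n : ℝ)⁻¹ * (density n j)⁻¹ * 1 := by
        field_simp
    _ ≤ (n : ℝ) ^ (-(1 / 2) : ℝ) * (density n j)⁻¹ * Real.log n := by gcongr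

/-- Here `n p² ζ = (log n)² / ζ`, and `K ζ ≤ 1`. -/
theorem Early.le_mul_zeta (h : Early δ K a n i) (hK : 1 ≤ K) (ha : 0 ≤ a) (hδ : 0 < δ)
    (hδ1 : δ ≤ 1) {j : ℕ} (hj : j ≤ i) {E : ℝ} (hEK : E ≤ K) :
    E ≤ n * density n j ^ 2 * zeta n (density n j) := by
  have h1 := zeta_sq (h.pos hK) (h.density_pos_of_le hj)
  have h2 := h.zeta_pos hK hj
  have h3 := h.zeta_le hj
  have h4 := h.mul_zeta_le_one hK ha hδ hδ1
  have h5 := h.one_le_log hK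
  by_contra hcon
  push Not at hcon
  have h6 : n * density n j ^ 2 * zeta n (density n j) ^ 2 < 1 := by
    calc _ = (n * density n j ^ 2 * zeta n (density n j)) * zeta n (density n j) := by ring
      _ < E * zeta n (density n j) := by gcongr
      _ ≤ K * zeta n (density n i) := by gcongr
      _ ≤ 1 := h4
  nlinarith

theorem Early.inv_le_density (h : Early δ K a n i) (hK : 1 ≤ K) (ha : 0 ≤ a) (hδ : 0 < δ) :
    (n : ℝ) ^ (-(1 / 2) : ℝ) ≤ density n i := by
  have h1 := h.zeta_le_one hK ha hδ
  have hp := h.density_pos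
  have hl := h.one_le_log hK
  unfold zeta at h1
  have h2 : (n : ℝ) ^ (-(1 / 2) : ℝ) * Real.log n ≤ density n i := by
    have := mul_le_mul_of_nonneg_left h1 hp.le
    rw [mul_one] at this
    refine le_trans (le_of_eq ?_) this
    field_simp
  refine le_trans (le_mul_of_one_le_right (by positivity) hl) h2

theorem Early.neg_log_density_le (h : Early δ K a n i) (hK : 1 ≤ K) (ha : 0 ≤ a) (hδ : 0 < δ) :
    -Real.log (density n i) ≤ Real.log n := by
  have h1 := h.inv_le_density hK ha hδ
  have hn : (0 : ℝ) < n := by exact_mod_cast h.pos hK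
  have h2 := Real.log_le_log (by positivity) h1
  rw [Real.log_rpow hn] at h2
  have := h.one_le_log hK
  linarith

theorem Early.lt_sq (h : Early δ K a n i) (hK : 1 ≤ K) : i ≤ n ^ 2 := by
  have h1 := h.density_pos
  have hn : (0 : ℝ) < n := by exact_mod_cast h.pos hK
  unfold density at h1
  have h2 : (i : ℝ) / (n : ℝ) ^ 2 < 1 := by
    have : 0 ≤ (i : ℝ) / (n : ℝ) ^ 2 := by positivity
    linarith
  rw [div_lt_one (by positivity)] at h2
  exact_mod_cast h2.le

/-- From `ζ ≤ 1` follows `p ≥ n^(-1/2)`, far above the decrement `6/n²` of one step. For `i = 0` the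
natural subtraction gives step 0 again. -/
theorem Early.density_pred_le (h : Early δ K a n i) (hK : 6 ≤ K) (ha : 0 ≤ a) (hδ : 0 < δ) :
    density n (i - 1) ≤ 2 * density n i := by
  have hK1 : 1 ≤ K := by linarith
  have hn : (0 : ℝ) < n := by exact_mod_cast h.pos hK1
  have hn1 : (1 : ℝ) ≤ n := by exact_mod_cast h.pos hK1
  rcases Nat.eq_zero_or_pos i with rfl | hi
  · have := h.density_pos
    simp only [Nat.zero_sub]
    linarith
  obtain ⟨k, rfl⟩ := Nat.exists_eq_succ_of_ne_zero hi.ne'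
  have h1 := h.inv_le_density hK1 ha hδ
  simp only [Nat.succ_eq_add_one, Nat.add_sub_cancel] at h1 ⊢
  have h2 : (n : ℝ)⁻¹ ≤ (n : ℝ) ^ (-(1 / 2) : ℝ) := by
    rw [← Real.rpow_neg_one]
    exact Real.rpow_le_rpow_of_exponent_le hn1 (by norm_num)
  have h3 : 6 / (n : ℝ) ^ 2 ≤ (n : ℝ)⁻¹ := by
    rw [div_le_iff₀ (by positivity)]
    have : (n : ℝ)⁻¹ * (n : ℝ) ^ 2 = n := by field_simp
    rw [this]
    exact hK.trans h.le_n
  have h4 := density_succ n k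
  linarith

/-- The bound on `ζ` may fail at `τ⋆` itself, so only step `i - 1` is assumed to satisfy it; one
step at most halves the density. From `w n ≥ M` follows `ζ ≤ (log n)^(-M)`, and `M = (2 + a)/δ`
leaves two logarithms to absorb `2 ^ δ` and `K`. -/
theorem eventually_early {w : ℕ → ℝ} (hw : Tendsto w atTop atTop) (δ K a : ℝ) (hδ : 0 < δ)
    (hK : 6 ≤ K) (ha : 0 ≤ a) :
    ∀ᶠ n : ℕ in atTop, ∀ i : ℕ, ZetaSmall w n (density n (i - 1)) → Early δ K a n i := by
  have hlog : Tendsto (fun n : ℕ => Real.log n) atTop atTop :=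
    Real.tendsto_log_atTop.comp tendsto_natCast_atTop_atTop
  have hK0 : 0 < K := by linarith
  filter_upwards [hlog.eventually_ge_atTop (K + 2 ^ δ), hw.eventually_ge_atTop ((2 + a) / δ),
    hw.eventually_ge_atTop 1] with n hn hwn hwn1 i hz
  obtain ⟨hp, hz⟩ := hz
  have h2δ : (0 : ℝ) < 2 ^ δ := by positivity
  have hl : K ≤ Real.log n := by linarith
  have hl6 : 6 ≤ Real.log n := by linarith
  have hn0 : 0 < n := by
    rcases Nat.eq_zero_or_pos n with rfl | h
    · simp at hl6
      linarith
    · exact h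
  have hn' : (0 : ℝ) < n := by exact_mod_cast hn0
  have hn1 : (1 : ℝ) ≤ n := by exact_mod_cast hn0
  have hn6 : (6 : ℝ) ≤ n := hl6.trans (Real.log_le_self hn'.le)
  have hll : 0 < Real.log (Real.log n) := Real.log_pos (by linarith)
  have hl0 : 0 < Real.log n := by linarith
  set z := zeta n (density n (i - 1)) with hzdef
  have hz0 : 0 < z := zeta_pos_of_one_le_log (by linarith) hp hn0
  have hzM : ∀ M : ℝ, M ≤ w n → z ≤ Real.log n ^ (-M) := by
    intro M hM
    have h1 := (le_div_iff₀ hll).1 (hM.trans hz)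
    rw [one_div, Real.log_inv] at h1
    rw [← Real.log_le_log_iff hz0 (by positivity), Real.log_rpow hl0]
    linarith
  have hz1 : z ≤ 1 := by
    refine (hzM 1 hwn1).trans ?_
    exact Real.rpow_le_one_of_one_le_of_nonpos (by linarith) (by norm_num)
  have hpk : (n : ℝ)⁻¹ * Real.log n ≤ density n (i - 1) := by
    have h2 : (n : ℝ)⁻¹ ≤ (n : ℝ) ^ (-(1 / 2) : ℝ) := by
      rw [← Real.rpow_neg_one]
      exact Real.rpow_le_rpow_of_exponent_le hn1 (by norm_num)
    have h3 : (n : ℝ) ^ (-(1 / 2) : ℝ) * Real.log n = z * density n (i - 1) := by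
      rw [hzdef]
      unfold zeta
      field_simp
    calc (n : ℝ)⁻¹ * Real.log n ≤ (n : ℝ) ^ (-(1 / 2) : ℝ) * Real.log n := by gcongr
      _ = z * density n (i - 1) := h3
      _ ≤ 1 * density n (i - 1) := by gcongr
      _ = _ := one_mul _
  have hhalf : density n (i - 1) / 2 ≤ density n i := by
    rcases Nat.eq_zero_or_pos i with rfl | hi
    · simp only [Nat.zero_sub] at hp ⊢
      linarith
    obtain ⟨k, rfl⟩ := Nat.exists_eq_succ_of_ne_zero hi.ne'
    simp only [Nat.succ_eq_add_one, Nat.add_sub_cancel] at hpk ⊢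
    rw [density_succ]
    have h3 : 6 / (n : ℝ) ^ 2 ≤ (n : ℝ)⁻¹ := by
      rw [div_le_iff₀ (by positivity)]
      have : (n : ℝ)⁻¹ * (n : ℝ) ^ 2 = n := by field_simp
      rw [this]
      exact hn6
    have h4 : (n : ℝ)⁻¹ * 6 ≤ (n : ℝ)⁻¹ * Real.log n := by gcongr
    have h5 : 0 < (n : ℝ)⁻¹ := by positivity
    linarith
  have hpi : 0 < density n i := by linarith
  refine ⟨hpi, hl, ?_⟩
  have hzi : zeta n (density n i) ≤ 2 * z := by
    calc zeta n (density n i) ≤ zeta n (density n (i - 1) / 2) := zeta_anti (by linarith) hhalf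
      _ = 2 * z := by
        rw [hzdef]
        unfold zeta
        rw [inv_div]
        ring
  have hzi0 : 0 ≤ zeta n (density n i) := zeta_nonneg hpi.le
  calc zeta n (density n i) ^ δ * (K * Real.log n ^ a)
      ≤ (2 * z) ^ δ * (K * Real.log n ^ a) := by gcongr
    _ = 2 ^ δ * z ^ δ * (K * Real.log n ^ a) := by rw [Real.mul_rpow (by norm_num) hz0.le]
    _ ≤ Real.log n * (Real.log n ^ (-((2 + a) / δ))) ^ δ * (Real.log n * Real.log n ^ a) := by
        have := hzM _ hwn
        have h6 : (2 : ℝ) ^ δ ≤ Real.log n := by linarith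
        gcongr
    _ = 1 := by
        rw [← Real.rpow_mul hl0.le, show -((2 + a) / δ) * δ = -(2 + a) by field_simp]
        rw [show Real.log n * Real.log n ^ (-(2 + a)) * (Real.log n * Real.log n ^ a) =
          Real.log n ^ (2 : ℕ) * (Real.log n ^ (-(2 + a)) * Real.log n ^ a) by ring]
        rw [← Real.rpow_natCast, ← Real.rpow_add hl0, ← Real.rpow_add hl0]
        norm_num

end Early

/-! ### Consequences of the estimates at earlier times -/

theorem le_firstStep_iff {P : ℕ → Prop} {i : ℕ} :
    (i : ℕ∞) ≤ firstStep P ↔ ∀ j, P j → i ≤ j := by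
  rw [firstStep, le_iInf_iff]
  constructor
  · intro h j hj
    exact_mod_cast h ⟨j, hj⟩
  · rintro h ⟨j, hj⟩
    exact_mod_cast h j hj

theorem firstStep_le_iff {P : ℕ → Prop} {i : ℕ} :
    firstStep P ≤ (i : ℕ∞) ↔ ∃ j ≤ i, P j := by
  rw [← not_iff_not, not_le]
  have h : (i : ℕ∞) < firstStep P ↔ ((i + 1 : ℕ) : ℕ∞) ≤ firstStep P := by
    rw [Nat.cast_add, Nat.cast_one, ENat.add_one_le_iff (ENat.natCast_ne_top i)]
  rw [h, le_firstStep_iff]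
  push Not
  exact ⟨fun h j hj hP => absurd (h j hP) (by omega), fun h j hP => by
    by_contra hcon
    exact h j (by omega) hP⟩

/-- The estimates for the copies of `H` rooted at `φ`, after `i` steps. -/
def Controlled {W : Type*} (δ s : ℝ) (n i : ℕ) (G : SimpleGraph (Fin n)) (H : ExtensionGraph W)
    (φ : H.roots ↪ Fin n) : Prop :=
  (H.Balanced → (i : ℕ∞) ≤ H.tHMinus n s →
    |(H.copyCount G φ : ℝ) - H.scaling n (density n i)| ≤
      H.scaling n (density n i) * zeta n (density n i) ^ δ) ∧
  (H.StrictlyBalanced → H.tHMinus n s ≤ (i : ℕ∞) → (i : ℕ∞) ≤ H.tH n →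
    |(H.copyCount G φ : ℝ) - H.scaling n (density n i)| ≤
      H.scaling n (density n i) ^ (1 - s) * Real.log n ^ (3 * Real.exp (H.numFree : ℝ)))

section Upper

variable {W : Type*} [Fintype W] [DecidableEq W]

theorem ExtensionGraph.scaling_nonneg (H : ExtensionGraph W) {n : ℕ} {p : ℝ} (hp : 0 ≤ p) :
    0 ≤ H.scaling n p := by
  unfold scaling
  positivity

theorem ExtensionGraph.scaling_pos (H : ExtensionGraph W) {n : ℕ} {p : ℝ} (hn : 0 < n)
    (hp : 0 < p) : 0 < H.scaling n p := by
  unfold scaling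
  positivity

theorem ExtensionGraph.scaling_mono (H : ExtensionGraph W) {n : ℕ} {p q : ℝ} (hp : 0 ≤ p)
    (hpq : p ≤ q) : H.scaling n p ≤ H.scaling n q := by
  unfold scaling
  gcongr

theorem ExtensionGraph.copyCount_mono (H : ExtensionGraph W) {n : ℕ} {G G' : SimpleGraph (Fin n)}
    (hG : G ≤ G') (φ : H.roots ↪ Fin n) : H.copyCount G φ ≤ H.copyCount G' φ :=
  Set.ncard_le_ncard (fun _ hψ => ⟨hψ.1, fun u v h => hG (hψ.2 u v h)⟩) (Set.toFinite _)

theorem rpow_le_max_one {S s : ℝ} (hS : 0 ≤ S) (hs0 : 0 ≤ s) (hs1 : s ≤ 1) :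
    S ^ (1 - s) ≤ max S 1 := by
  rcases le_total S 1 with h | h
  · exact (Real.rpow_le_one hS h (by linarith)).trans (le_max_right _ _)
  · refine le_trans ?_ (le_max_left _ _)
    calc S ^ (1 - s) ≤ S ^ (1 : ℝ) := Real.rpow_le_rpow_of_exponent_le h (by linarith)
      _ = S := Real.rpow_one S

theorem Controlled.upper {δ s : ℝ} (hδ : 0 ≤ δ) (hs0 : 0 ≤ s) (hs1 : s ≤ 1) {n i : ℕ}
    {G : SimpleGraph (Fin n)} {H : ExtensionGraph W} {φ : H.roots ↪ Fin n}
    (h : Controlled δ s n i G H φ) (hl : 1 ≤ Real.log n) (hp : 0 ≤ density n i)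
    (hz : zeta n (density n i) ≤ 1) (hH : H.StrictlyBalanced) (hi : (i : ℕ∞) ≤ H.tH n) :
    (H.copyCount G φ : ℝ) ≤
      2 * Real.log n ^ (3 * Real.exp (H.numFree : ℝ)) * max (H.scaling n (density n i)) 1 := by
  have hS := H.scaling_nonneg (n := n) hp
  set S := H.scaling n (density n i)
  have hl1 : 1 ≤ Real.log n ^ (3 * Real.exp (H.numFree : ℝ)) :=
    Real.one_le_rpow hl (by positivity)
  have hmax0 : 0 ≤ max S 1 := hS.trans (le_max_left _ _)
  have hSm : S ≤ max S 1 := le_max_left _ _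
  rcases le_total (i : ℕ∞) (H.tHMinus n s) with hm | hm
  · have h1 := (abs_le.1 (h.1 hH.balanced hm)).2
    have h2 : zeta n (density n i) ^ δ ≤ 1 := Real.rpow_le_one (zeta_nonneg hp) hz hδ
    have h3 : S * zeta n (density n i) ^ δ ≤ S * 1 := by gcongr
    nlinarith
  · have h1 := (abs_le.1 (h.2 hH hm hi)).2
    have h2 := rpow_le_max_one hS hs0 hs1
    have h3 := mul_le_mul_of_nonneg_right h2 (by linarith : (0 : ℝ) ≤
      Real.log n ^ (3 * Real.exp (H.numFree : ℝ)))
    nlinarith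

/-- Upper bounds for strictly balanced extensions; beyond `t_H` by monotonicity. -/
theorem copyCount_le_of_controlled {δ s : ℝ} (hδ : 0 ≤ δ) (hs0 : 0 ≤ s) (hs1 : s ≤ 1) {n i : ℕ}
    {G : ℕ → SimpleGraph (Fin n)} (hG : Antitone G) {H : ExtensionGraph W} {φ : H.roots ↪ Fin n}
    (h : ∀ j ≤ i, Controlled δ s n j (G j) H φ) (hl : 1 ≤ Real.log n) (hp : 0 < density n i)
    (hz : zeta n (density n i) ≤ 1) (hH : H.StrictlyBalanced) :
    (H.copyCount (G i) φ : ℝ) ≤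
      2 * Real.log n ^ (3 * Real.exp (H.numFree : ℝ)) * max (H.scaling n (density n i)) 1 := by
  by_cases hi : (i : ℕ∞) ≤ H.tH n
  · exact (h i le_rfl).upper hδ hs0 hs1 hl hp.le hz hH hi
  -- Beyond `t_H`, compare with the first step at which the scaling is at most 1: copies are only
  -- lost afterwards, and there the maximum is 1.
  · have hex : ∃ j, H.scaling n (density n j) ≤ 1 := by
      obtain ⟨j, -, hj⟩ := firstStep_le_iff.1 (not_le.1 hi).le
      exact ⟨j, hj⟩
    classical
    have hj0 : ((Nat.find hex : ℕ) : ℕ∞) ≤ H.tH n :=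
      le_firstStep_iff.2 fun j hj => Nat.find_min' hex hj
    have hj0i : Nat.find hex ≤ i := by
      have := hj0.trans (not_le.1 hi).le
      exact_mod_cast this
    have hpj := hp.trans_le (density_antitone n hj0i)
    have h1 := (h _ hj0i).upper hδ hs0 hs1 hl hpj.le
      ((zeta_anti hp (density_antitone n hj0i)).trans hz) hH hj0
    rw [max_eq_right (Nat.find_spec hex)] at h1
    have h2 : (H.copyCount (G i) φ : ℝ) ≤ H.copyCount (G (Nat.find hex)) φ := by
      exact_mod_cast H.copyCount_mono (hG hj0i) φ
    refine (h2.trans h1).trans ?_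
    gcongr
    exact le_max_right _ _

/-- The edge that is hit does not lie inside `R`, so fixing its ends uses up a free vertex and every
intermediate `J` differs from `R`. The loss relative to `S_A` is then a polylogarithm times `1 /
S_J`, which `r` bounds. -/
theorem card_lostCopies_le_of_ratio (Γ : SimpleGraph W) {n : ℕ} {p l r : ℝ} (hn : 0 < n)
    (hp : 0 < p) (hp1 : p ≤ 1) (hl : 1 ≤ l) (G : SimpleGraph (Fin n))
    (hK : ∀ K : ExtensionGraph W, K.StrictlyBalanced → K.numFree ≠ 0 → ∀ φ : K.roots ↪ Fin n,
      (K.copyCount G φ : ℝ) ≤ 2 * l ^ (3 * Real.exp (K.numFree : ℝ)) * max (K.scaling n p) 1)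
    {R A : Finset W} (h : R ⊆ A)
    (hr : ∀ J, ∀ hRJ : R ⊆ J, J ⊆ A → J ≠ R → 1 / (extGraph Γ R J hRJ).scaling n p ≤ r)
    (hr0 : 0 ≤ r) (g : W → Fin n) {T : Finset (Fin n)} (hT : T ∈ triangles G) :
    ((lostCopies Γ R A G g T).card : ℝ) ≤
      9 * (Fintype.card W : ℝ) ^ 2 * 2 ^ Fintype.card W *
        l ^ logExponent (A.card - R.card - 1) * r * (extGraph Γ R A h).scaling n p := by
  have hl0 : 0 < l := by linarith
  have hS := (extGraph Γ R A h).scaling_pos hn hp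
  have hw := weight_pos Γ hn hp
  have hB := card_lostCopies_le Γ (R := R) (A := A) G g (card_of_mem_triangles hT)
    (B := 2 ^ Fintype.card W * l ^ logExponent (A.card - R.card - 1) *
      (r * (extGraph Γ R A h).scaling n p)) (by positivity) ?_
  · refine hB.trans_eq ?_
    ring
  · intro u v huv g'
    obtain ⟨-, hu, hv, huv'⟩ := mem_edgesBetween.1 huv
    have hR2A : insert u (insert v R) ⊆ A := by
      intro x hx
      simp only [Finset.mem_insert] at hx
      rcases hx with rfl | rfl | hx
      exacts [hu, hv, h hx]
    have hRR2 : R ⊆ insert u (insert v R) := fun x hx => by simp [hx]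
    have hne : R ≠ insert u (insert v R) := fun heq => huv' (by
      rw [heq]
      simp)
    have hcard := card_lt_of_subset_of_ne hRR2 hne
    have hcardA := Finset.card_le_card hR2A
    obtain ⟨J, hJ1, hJ2, hJ⟩ := exists_card_rootedCopies_le Γ hn hp hp1 hl G hK hR2A
    refine (hJ g').trans ?_
    have hJR : J ≠ R := fun heq => hne (Finset.Subset.antisymm hRR2 (heq ▸ hJ1))
    have hRJ := hRR2.trans hJ1
    have h1 := hr J hRJ hJ2 hJR
    rw [extGraph_scaling_eq_div Γ hn hp] at h1
    have h2 : weight Γ n p A / weight Γ n p J ≤ r * (extGraph Γ R A h).scaling n p := by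
      rw [extGraph_scaling_eq_div Γ hn hp]
      have := hw A
      have hR := hw R
      have := hw J
      calc weight Γ n p A / weight Γ n p J =
          1 / (weight Γ n p J / weight Γ n p R) * (weight Γ n p A / weight Γ n p R) := by
            field_simp
        _ ≤ _ := by gcongr
    have h3 : A.card - (insert u (insert v R)).card ≤ Fintype.card W :=
      (Nat.sub_le _ _).trans (Finset.card_le_univ A)
    have h4 : logExponent (A.card - (insert u (insert v R)).card) ≤
        logExponent (A.card - R.card - 1) := logExponent_mono (by omega)
    have h5 : 0 ≤ weight Γ n p A / weight Γ n p J := (div_pos (hw A) (hw J)).le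
    gcongr
    norm_num

theorem ExtensionGraph.Balanced.scaling_pow_le {Γ : SimpleGraph W} {R A : Finset W} {h : R ⊆ A}
    (hb : (extGraph Γ R A h).Balanced) {J : Finset W} (hRJ : R ⊆ J) (hJA : J ⊆ A) (hne : J ≠ R)
    {n : ℕ} {p : ℝ} (hp : 0 < p) (hp1 : p ≤ 1) :
    (extGraph Γ R A h).scaling n p ^ (J.card - R.card) ≤
      (extGraph Γ R J hRJ).scaling n p ^ (A.card - R.card) := by
  have h1 := hb.card_mul_le hRJ hJA hne
  rw [extGraph_scaling, extGraph_scaling, mul_pow, mul_pow, ← pow_mul, ← pow_mul, ← pow_mul,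
    ← pow_mul, mul_comm (A.card - R.card)]
  gcongr ?_ * ?_
  exact pow_le_pow_of_le_one hp.le hp1 h1

/-- Strictness of an inequality between integers leaves at least one spare factor `p`. -/
theorem ExtensionGraph.StrictlyBalanced.scaling_pow_le {Γ : SimpleGraph W} {R A : Finset W}
    {h : R ⊆ A} (hb : (extGraph Γ R A h).StrictlyBalanced) {J : Finset W} (hRJ : R ⊆ J)
    (hJA : J ⊆ A) (hne : J ≠ R) (hneA : J ≠ A) {n : ℕ} {p : ℝ} (hp : 0 < p) (hp1 : p ≤ 1) :
    (extGraph Γ R A h).scaling n p ^ (J.card - R.card) ≤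
      p * (extGraph Γ R J hRJ).scaling n p ^ (A.card - R.card) := by
  have h1 := hb.card_mul_lt hRJ hJA hne hneA
  rw [extGraph_scaling, extGraph_scaling, mul_pow, mul_pow, ← pow_mul, ← pow_mul, ← pow_mul,
    ← pow_mul, mul_comm (A.card - R.card), mul_left_comm, ← pow_succ']
  gcongr ?_ * ?_
  exact pow_le_pow_of_le_one hp.le hp1 h1

/-- Take `f`-th roots; the exponent `s / (L + 1)` lies below `s / f` and does not depend on the
extension. -/
theorem one_div_le_rpow_of_pow {x z s : ℝ} {f L : ℕ} (hx : 0 < x) (hz : 0 < z) (hz1 : z ≤ 1)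
    (hs : 0 ≤ s) (hf : f ≠ 0) (hfL : f ≤ L) (h : 1 ≤ z ^ s * x ^ f) :
    1 / x ≤ z ^ (s / (L + 1)) := by
  have hf0 : (0 : ℝ) < f := by exact_mod_cast Nat.pos_of_ne_zero hf
  have h1 : (1 / x) ^ f ≤ z ^ s := by
    rw [div_pow, one_pow, div_le_iff₀ (by positivity)]
    exact h
  calc 1 / x = ((1 / x) ^ f) ^ ((f : ℝ)⁻¹) := (Real.pow_rpow_inv_natCast (by positivity) hf).symm
    _ ≤ (z ^ s) ^ ((f : ℝ)⁻¹) := by gcongr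
    _ = z ^ (s / f) := by rw [← Real.rpow_mul hz.le, div_eq_mul_inv]
    _ ≤ z ^ (s / (L + 1)) := by
      refine Real.rpow_le_rpow_of_exponent_ge hz hz1 ?_
      have : (f : ℝ) ≤ L := by exact_mod_cast hfL
      gcongr
      linarith

/-- The scaling divided by that of the threshold is decreasing in time. -/
theorem scaling_le_of_tHMinus_le {H : ExtensionGraph W} {n i : ℕ} {s : ℝ}
    (hs1 : s ≤ 1) (hE : H.numEdges ≠ 0) (hn : 0 < n) (hl : 1 ≤ Real.log n) (hp : 0 < density n i)
    (h : H.tHMinus n s ≤ (i : ℕ∞)) :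
    H.scaling n (density n i) ≤ 1 / zeta n (density n i) ^ s := by
  obtain ⟨j, hj, hS⟩ := firstStep_le_iff.1 h
  have hpq := density_antitone n hj
  set p := density n i
  set q := density n j
  have hq : 0 < q := hp.trans_le hpq
  have hzp := zeta_pos_of_one_le_log hl hp hn
  have hzq := zeta_pos_of_one_le_log hl hq hn
  have hn' : (0 : ℝ) < n := by exact_mod_cast hn
  have hl0 : 0 < Real.log n := by linarith
  have hzz : zeta n p = (q / p) * zeta n q := by
    unfold zeta
    field_simp
  have hqp : 1 ≤ q / p := (one_le_div hp).2 hpq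
  have h1 : (q / p) ^ s ≤ q / p := by
    calc (q / p) ^ s ≤ (q / p) ^ (1 : ℝ) := Real.rpow_le_rpow_of_exponent_le hqp hs1
      _ = q / p := Real.rpow_one _
  -- With at least one edge `S` falls at least as fast as `p`, while `ζ ^ s` grows at most like `1 /
  -- p`.
  have h2 : H.scaling n p * (q / p) ≤ H.scaling n q := by
    unfold ExtensionGraph.scaling
    obtain ⟨k, hk⟩ := Nat.exists_eq_succ_of_ne_zero hE
    rw [hk, Nat.succ_eq_add_one, pow_succ, pow_succ]
    calc (n : ℝ) ^ H.numFree * (p ^ k * p) * (q / p) = (n : ℝ) ^ H.numFree * (p ^ k * q) := by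
          field_simp
      _ ≤ _ := by gcongr
  rw [le_div_iff₀ (by positivity)] at hS ⊢
  rw [hzz, Real.mul_rpow (by positivity) hzq.le]
  have hSp := H.scaling_nonneg (n := n) hp.le
  calc H.scaling n p * ((q / p) ^ s * zeta n q ^ s)
      ≤ H.scaling n p * ((q / p) * zeta n q ^ s) := by gcongr
    _ = (H.scaling n p * (q / p)) * zeta n q ^ s := by ring
    _ ≤ H.scaling n q * zeta n q ^ s := by gcongr
    _ ≤ 1 := hS

end Upper

/-! ### Failure probabilities -/

section Failure

variable {W : Type*} [Fintype W] [DecidableEq W]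

/-- The constant that bounds the number of copies lost in one step. -/
noncomputable def lossConst (m : ℕ) : ℝ :=
  18 * (m : ℝ) ^ 2 * 2 ^ m

/-- A constant that dominates all those that appear in the estimates. -/
noncomputable def bigConst (m : ℕ) (C : ℝ) : ℝ :=
  512 * (lossConst m + 1) * ((4 * C + 3) * ((m : ℝ) + 1) ^ 2)

theorem lossConst_nonneg (m : ℕ) : 0 ≤ lossConst m := by
  unfold lossConst
  positivity

theorem bigConst_bounds (m : ℕ) {C : ℝ} (hC : 0 < C) :
    6 ≤ bigConst m C ∧ 12 * ((m : ℝ) + 1) ^ 2 ≤ bigConst m C ∧ 4 * C + 2 ≤ bigConst m C ∧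
      64 * ((4 * C + 3) * ((m : ℝ) + 1) ^ 2) ≤ bigConst m C ∧
      512 * (lossConst m * ((m : ℝ) + 1) ^ 2) ≤ bigConst m C ∧
      512 * lossConst m ≤ bigConst m C ∧ 4 * (m : ℝ) ^ 2 ≤ bigConst m C := by
  have h1 := lossConst_nonneg m
  have hb : 1 ≤ ((m : ℝ) + 1) ^ 2 := one_le_pow₀ (by linarith [Nat.cast_nonneg (α := ℝ) m])
  have hm : (m : ℝ) ^ 2 ≤ ((m : ℝ) + 1) ^ 2 := by
    gcongr
    linarith
  unfold bigConst
  set b := ((m : ℝ) + 1) ^ 2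
  set q := lossConst m
  have hab : 3 * b ≤ (4 * C + 3) * b := by gcongr; linarith
  have hab' : 4 * C + 3 ≤ (4 * C + 3) * b := le_mul_of_one_le_right (by linarith) hb
  have hqab : q * b ≤ q * ((4 * C + 3) * b) := by
    gcongr
    linarith
  have hqb : q ≤ q * b := le_mul_of_one_le_right h1 hb
  refine ⟨?_, ?_, ?_, ?_, ?_, ?_, ?_⟩ <;> nlinarith

theorem card_edgesBetween_le (Γ : SimpleGraph W) (R A : Finset W) :
    ((edgesBetween Γ R A).card : ℝ) ≤ ((Fintype.card W : ℝ) + 1) ^ 2 := by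
  have h1 : (edgesBetween Γ R A).card ≤ (Fintype.card W + 1) ^ 2 := by
    refine (Finset.card_le_univ _).trans ?_
    rw [Sym2.card]
    exact Nat.choose_le_pow _ _
  exact_mod_cast h1

variable {Γ : SimpleGraph W} {R A : Finset W} {h : R ⊆ A} {n i : ℕ} {C δ a : ℝ}

/-- Reduces `concentration` to four inequalities: `h1` for the drift, `h2` for the admissible range
of `c`, `h3` for the quadratic term and `h4` for the initial error. -/
theorem deviation_le (h : R ⊆ A) (hf : A.card - R.card ≠ 0)
    (hearly : Early δ (bigConst (Fintype.card W) C) a n i) (hδ : 0 < δ) (hδ1 : δ ≤ 1)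
    (ha : 0 ≤ a) (hC : 0 < C) (g : W → Fin n) (hg : Set.InjOn g R) {xb Rb err : ℝ}
    (hxb : 0 ≤ xb) (hRb : 0 ≤ Rb) (herr : 0 < err)
    (h1 : 2 * (4 * C + 3) * xb * (((Fintype.card W : ℝ) + 1) ^ 2 * zeta n (density n i)) ≤ err / 4)
    (h2 : 4 * Real.log n ^ 2 * Rb ≤ err)
    (h3 : 16 * Real.log n ^ 4 * (4 * Rb * xb) * (((Fintype.card W : ℝ) + 1) ^ 2 * Real.log n) ≤
      err ^ 2)
    (h4 : 4 * Real.log n ^ 2 * (Fintype.card W : ℝ) ^ 2 ≤ n * err) :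
    (removalProcess n).toOuterMeasure {G : ℕ → SimpleGraph (Fin n) |
      (∀ j < i, Accurate C (density n j) (G j) ∧
        ((rootedCopies Γ R A (G j) g).card : ℝ) ≤
          xb * (extGraph Γ R A h).scaling n (density n j) ∧
        ∀ T ∈ triangles (G j), ((lostCopies Γ R A (G j) g T).card : ℝ) ≤
          Rb * (extGraph Γ R A h).scaling n (density n (j + 1))) ∧
      err < |((rootedCopies Γ R A (G i) g).card : ℝ) /
        (extGraph Γ R A h).scaling n (density n i) - 1|} ≤
      ENNReal.ofReal (2 * Real.exp (-Real.log n ^ 2)) := by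
  obtain ⟨k1, k2, k3, -, -, -, -⟩ := bigConst_bounds (Fintype.card W) hC
  set K := bigConst (Fintype.card W) C
  have hK : 1 ≤ K := by linarith
  have hn := hearly.pos hK
  have hn' : (0 : ℝ) < n := by exact_mod_cast hn
  have hl := hearly.one_le_log hK
  have hz := hearly.zeta_pos hK le_rfl
  have hE := card_edgesBetween_le Γ R A
  have hnum : ∀ j < i, (4 * C + 2) * zeta n (density n j) ≤ 1 ∧
      ((edgesBetween Γ R A).card : ℝ) ≤ n * density n j ^ 2 * zeta n (density n j) ∧
      ((edgesBetween Γ R A).card : ℝ) * (6 / (n ^ 2 * density n j)) ≤ zeta n (density n j) ∧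
      6 / ((n : ℝ) ^ 2 * density n j) ≤ 1 := by
    intro j hj
    refine ⟨?_, ?_, ?_, ?_⟩
    · refine le_trans ?_ (hearly.mul_zeta_le_one hK ha hδ hδ1)
      have := hearly.zeta_le hj.le
      have := hearly.zeta_pos hK hj.le
      gcongr
    · exact hearly.le_mul_zeta hK ha hδ hδ1 hj.le (by nlinarith)
    · exact hearly.six_div_le hK hj.le (by nlinarith)
    · have := hearly.six_div_le hK hj.le (E := 1) (by linarith)
      rw [one_mul] at this
      exact this.trans ((hearly.zeta_le hj.le).trans (hearly.zeta_le_one hK ha hδ))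
  set l := Real.log n
  have hl0 : 0 < l := by linarith
  -- Then `c err = 4 l²`. The drift takes at most `l²` of it and the initial and quadratic terms at
  -- most 1 each, so at least `l²` is left.
  set c : ℝ := 4 * l ^ 2 / err with hc
  have hc0 : 0 < c := by positivity
  have hmain : ∀ c' : ℝ, |c'| = c →
      (removalProcess n).toOuterMeasure {G : ℕ → SimpleGraph (Fin n) |
      (∀ j < i, Accurate C (density n j) (G j) ∧
        ((rootedCopies Γ R A (G j) g).card : ℝ) ≤
          xb * (extGraph Γ R A h).scaling n (density n j) ∧
        ∀ T ∈ triangles (G j), ((lostCopies Γ R A (G j) g T).card : ℝ) ≤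
          Rb * (extGraph Γ R A h).scaling n (density n (j + 1))) ∧
      |c'| * err < c' * (((rootedCopies Γ R A (G i) g).card : ℝ) /
        (extGraph Γ R A h).scaling n (density n i) - 1)} ≤
      ENNReal.ofReal (Real.exp (-l ^ 2)) := by
    intro c' hc'
    have hcR : c * Rb ≤ 1 := by
      rw [hc, div_mul_eq_mul_div, div_le_one herr]
      exact h2
    refine (concentration Γ h hf hn (hearly.lt_sq hK) g hg hC
      (fun j hj => hearly.density_pos_of_le hj) hnum hxb hRb (by rw [hc']; exact hcR)).trans ?_
    refine ENNReal.ofReal_le_ofReal (Real.exp_le_exp.2 ?_)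
    rw [← sq_abs c', hc']
    have t1 : c * ((Fintype.card W : ℝ) ^ 2 / n) ≤ 1 := by
      rw [hc, div_mul_div_comm, div_le_one (by positivity)]
      linarith
    have t2 : c * err = 4 * l ^ 2 := by
      rw [hc]
      field_simp
    have t3 : c * (2 * (4 * C + 3)) * xb *
        ((edgesBetween Γ R A).card * zeta n (density n i)) ≤ l ^ 2 := by
      calc _ = c * (2 * (4 * C + 3) * xb *
            ((edgesBetween Γ R A).card * zeta n (density n i))) := by ring
        _ ≤ c * (2 * (4 * C + 3) * xb *
            (((Fintype.card W : ℝ) + 1) ^ 2 * zeta n (density n i))) := by gcongr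
        _ ≤ c * (err / 4) := by gcongr
        _ = l ^ 2 := by linarith
    have t4 : c ^ 2 * (4 * Rb * xb) *
        ((edgesBetween Γ R A).card * -Real.log (density n i)) ≤ 1 := by
      have hlp := hearly.neg_log_density_le hK ha hδ
      calc c ^ 2 * (4 * Rb * xb) * ((edgesBetween Γ R A).card * -Real.log (density n i))
          ≤ c ^ 2 * (4 * Rb * xb) * ((edgesBetween Γ R A).card * l) := by gcongr
        _ ≤ c ^ 2 * (4 * Rb * xb) * (((Fintype.card W : ℝ) + 1) ^ 2 * l) := by gcongr
        _ = (16 * l ^ 4 * (4 * Rb * xb) * (((Fintype.card W : ℝ) + 1) ^ 2 * l)) / err ^ 2 := by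
          rw [hc]
          field_simp
          ring
        _ ≤ 1 := by
          rw [div_le_one (by positivity)]
          exact h3
    nlinarith
  have hcover : {G : ℕ → SimpleGraph (Fin n) |
      (∀ j < i, Accurate C (density n j) (G j) ∧
        ((rootedCopies Γ R A (G j) g).card : ℝ) ≤
          xb * (extGraph Γ R A h).scaling n (density n j) ∧
        ∀ T ∈ triangles (G j), ((lostCopies Γ R A (G j) g T).card : ℝ) ≤
          Rb * (extGraph Γ R A h).scaling n (density n (j + 1))) ∧
      err < |((rootedCopies Γ R A (G i) g).card : ℝ) /
        (extGraph Γ R A h).scaling n (density n i) - 1|} ⊆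
      {G : ℕ → SimpleGraph (Fin n) |
      (∀ j < i, Accurate C (density n j) (G j) ∧
        ((rootedCopies Γ R A (G j) g).card : ℝ) ≤
          xb * (extGraph Γ R A h).scaling n (density n j) ∧
        ∀ T ∈ triangles (G j), ((lostCopies Γ R A (G j) g T).card : ℝ) ≤
          Rb * (extGraph Γ R A h).scaling n (density n (j + 1))) ∧
      |c| * err < c * (((rootedCopies Γ R A (G i) g).card : ℝ) /
        (extGraph Γ R A h).scaling n (density n i) - 1)} ∪
      {G : ℕ → SimpleGraph (Fin n) |
      (∀ j < i, Accurate C (density n j) (G j) ∧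
        ((rootedCopies Γ R A (G j) g).card : ℝ) ≤
          xb * (extGraph Γ R A h).scaling n (density n j) ∧
        ∀ T ∈ triangles (G j), ((lostCopies Γ R A (G j) g T).card : ℝ) ≤
          Rb * (extGraph Γ R A h).scaling n (density n (j + 1))) ∧
      |-c| * err < -c * (((rootedCopies Γ R A (G i) g).card : ℝ) /
        (extGraph Γ R A h).scaling n (density n i) - 1)} := by
    rintro G ⟨hG, hdev⟩
    rcases lt_abs.1 hdev with hd | hd
    · left
      refine ⟨hG, ?_⟩
      rw [abs_of_pos hc0]
      gcongr
    · right
      refine ⟨hG, ?_⟩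
      rw [abs_neg, abs_of_pos hc0, neg_mul, ← mul_neg]
      gcongr
  refine (MeasureTheory.measure_mono hcover).trans ((MeasureTheory.measure_union_le _ _).trans ?_)
  rw [two_mul, ENNReal.ofReal_add (Real.exp_pos _).le (Real.exp_pos _).le]
  exact add_le_add (hmain c (abs_of_pos hc0)) (hmain (-c) (by rw [abs_neg, abs_of_pos hc0]))

/-- All estimates hold before step `i`. -/
def GoodHistory (W : Type*) (C δ s : ℝ) (n i : ℕ) (G : ℕ → SimpleGraph (Fin n)) : Prop :=
  Antitone G ∧ ∀ j < i, Accurate C (density n j) (G j) ∧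
    ∀ (H : ExtensionGraph W) (φ : H.roots ↪ Fin n), Controlled δ s n j (G j) H φ

/-- Losses at step `j` are measured against the scaling at step `j + 1`, and a threshold may be
overshot by one step; both cost only this factor 2. -/
theorem scaling_le_two_mul (h : R ⊆ A)
    (hearly : Early δ (bigConst (Fintype.card W) C) a n i) (hδ : 0 < δ)
    (ha : 0 ≤ a) (hC : 0 < C) {j : ℕ} (hj : j < i) :
    (extGraph Γ R A h).scaling n (density n j) ≤
      2 * (extGraph Γ R A h).scaling n (density n (j + 1)) := by
  obtain ⟨k1, k2, -⟩ := bigConst_bounds (Fintype.card W) hC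
  have hE := card_edgesBetween_le Γ R A
  set K := bigConst (Fintype.card W) C
  have hK : 1 ≤ K := by linarith
  have hn' : (0 : ℝ) < n := by exact_mod_cast hearly.pos hK
  have hz1 := (hearly.zeta_le hj.le).trans (hearly.zeta_le_one hK ha hδ)
  have hp := hearly.density_pos_of_le hj.le
  have e1 := hearly.six_div_le hK hj.le (E := 2 * (edgesBetween Γ R A).card) (by linarith)
  have e2 := hearly.six_div_le hK hj.le (E := 1) (by linarith)
  rw [extGraph_scaling, extGraph_scaling, density_succ]
  set x := 6 / ((n : ℝ) ^ 2 * density n j) with hx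
  have e3 : density n j - 6 / (n : ℝ) ^ 2 = density n j * (1 - x) := by
    rw [mul_sub, mul_one, hx, ← div_div, mul_div_cancel₀ _ hp.ne']
  have e4 := one_add_mul_le_pow (show (-2 : ℝ) ≤ -x by linarith) (edgesBetween Γ R A).card
  rw [← sub_eq_add_neg] at e4
  rw [e3, mul_pow]
  have e5 : 1 ≤ 2 * (1 - x) ^ (edgesBetween Γ R A).card := by nlinarith
  calc _ ≤ (n : ℝ) ^ (A.card - R.card) * density n j ^ (edgesBetween Γ R A).card *
        (2 * (1 - x) ^ (edgesBetween Γ R A).card) := le_mul_of_one_le_right (by positivity) e5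
    _ = _ := by ring

/-- The largest loss in one step, in terms of the scalings of the subextensions. -/
theorem GoodHistory.lost_le {s r : ℝ} {G : ℕ → SimpleGraph (Fin n)}
    (hG : GoodHistory W C δ s n i G) (h : R ⊆ A)
    (hearly : Early δ (bigConst (Fintype.card W) C) a n i) (hδ : 0 < δ) (hs0 : 0 ≤ s)
    (hs1 : s ≤ 1) (ha : 0 ≤ a) (hC : 0 < C) (hr0 : 0 ≤ r) {j : ℕ} (hj : j < i)
    (hr : ∀ J, ∀ hRJ : R ⊆ J, J ⊆ A → J ≠ R →
      1 / (extGraph Γ R J hRJ).scaling n (density n j) ≤ r)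
    (g : W → Fin n) {T : Finset (Fin n)} (hT : T ∈ triangles (G j)) :
    ((lostCopies Γ R A (G j) g T).card : ℝ) ≤
      lossConst (Fintype.card W) * Real.log n ^ logExponent (A.card - R.card - 1) * r *
        (extGraph Γ R A h).scaling n (density n (j + 1)) := by
  obtain ⟨k1, -⟩ := bigConst_bounds (Fintype.card W) hC
  have hK : 1 ≤ bigConst (Fintype.card W) C := by linarith
  have hl := hearly.one_le_log hK
  have hp := hearly.density_pos_of_le hj.le
  have hz1 := (hearly.zeta_le hj.le).trans (hearly.zeta_le_one hK ha hδ)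
  have h1 := card_lostCopies_le_of_ratio Γ (hearly.pos hK) hp (density_le_one n j) hl (G j)
    (fun K hK' _ φ => copyCount_le_of_controlled hδ.le hs0 hs1 hG.1
      (fun j' hj' => (hG.2 j' (by omega)).2 K φ) hl hp hz1 hK') h hr hr0 g hT
  have h2 := scaling_le_two_mul (Γ := Γ) h hearly hδ ha hC hj
  refine h1.trans ?_
  unfold lossConst
  calc _ ≤ 9 * (Fintype.card W : ℝ) ^ 2 * 2 ^ Fintype.card W *
        Real.log n ^ logExponent (A.card - R.card - 1) * r *
          (2 * (extGraph Γ R A h).scaling n (density n (j + 1))) := by gcongr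
    _ = _ := by ring

theorem abs_div_sub_one {x S e : ℝ} (hS : 0 < S) (h : S * e < |x - S|) : e < |x / S - 1| := by
  rw [div_sub_one hS.ne', abs_div, abs_of_pos hS, lt_div_iff₀ hS]
  linarith

end Failure

/-! ### The choice of `√δ`, and balanced extensions before `t_H^-`. -/

section Regions

variable {W : Type*} [Fintype W] [DecidableEq W]

/-- The value of `√δ`. -/
noncomputable def sqrtDelta (m : ℕ) : ℝ :=
  1 / (4 * ((m : ℝ) + 1) ^ 3)

/-- The power of the logarithm that `ζ ^ (-δ)` dominates. -/
noncomputable def logPower (m : ℕ) : ℝ :=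
  5 + logExponent m

theorem logPower_nonneg (m : ℕ) : 0 ≤ logPower m := by
  unfold logPower
  linarith [logExponent_nonneg m]

theorem sqrtDelta_pos (m : ℕ) : 0 < sqrtDelta m := by
  unfold sqrtDelta
  positivity

theorem sqrtDelta_mul (m : ℕ) : 4 * (((m : ℝ) + 1) * sqrtDelta m) ≤ 1 := by
  have hm : (1 : ℝ) ≤ (m : ℝ) + 1 := by linarith [Nat.cast_nonneg (α := ℝ) m]
  unfold sqrtDelta
  rw [mul_one_div, mul_div_assoc', div_le_one (by positivity)]
  have := le_self_pow₀ hm (show 3 ≠ 0 by norm_num)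
  linarith

theorem sqrtDelta_le (m : ℕ) : sqrtDelta m ≤ 1 / 4 := by
  have h1 := sqrtDelta_mul m
  have h2 := sqrtDelta_pos m
  have hm : (0 : ℝ) ≤ m := Nat.cast_nonneg m
  nlinarith

/-- Makes the bound `ζ ^ (√δ / (m + 1))` on `1 / S_J` at most the fourth power of the error `ζ ^ δ`.
The quadratic term needs two of these powers; the surplus pays for logarithms and constants. -/
theorem sqrtDelta_sq_le (m : ℕ) : 4 * sqrtDelta m ^ 2 ≤ sqrtDelta m / (m + 1) := by
  have hm : (0 : ℝ) < (m : ℝ) + 1 := by positivity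
  rw [le_div_iff₀ hm]
  have h1 := sqrtDelta_mul m
  have h2 := sqrtDelta_pos m
  nlinarith

/-- An extension has at most `(m + 1)²` edges, so `p ^ e ≤ ζ` yields `p ≤ ζ ^ (√δ + δ)`; the extra
`ζ ^ δ` absorbs a factor 2 in `density_le_of_scaling_le`. -/
theorem sqrtDelta_add_le (m : ℕ) : sqrtDelta m + sqrtDelta m ^ 2 ≤ 1 / ((m : ℝ) + 1) ^ 2 := by
  have hm : (1 : ℝ) ≤ (m : ℝ) + 1 := by linarith [Nat.cast_nonneg (α := ℝ) m]
  have h1 := sqrtDelta_le m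
  have h2 := sqrtDelta_pos m
  have h3 : 2 * sqrtDelta m ≤ 1 / ((m : ℝ) + 1) ^ 2 := by
    unfold sqrtDelta
    rw [mul_one_div, div_le_div_iff₀ (by positivity) (by positivity)]
    have : ((m : ℝ) + 1) ^ 2 ≤ ((m : ℝ) + 1) ^ 3 := pow_le_pow_right₀ hm (by norm_num)
    linarith [pow_pos (zero_lt_one.trans_le hm) 3]
  nlinarith

/-- The embedding of the roots given by a map of all labels. -/
def rootEmbedding {Γ : SimpleGraph W} {R A : Finset W} (h : R ⊆ A) {n : ℕ} (g : W → Fin n)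
    (hg : Set.InjOn g R) : (extGraph Γ R A h).roots ↪ Fin n :=
  ⟨fun x => g x, fun x y hxy => Subtype.ext (hg x.2 y.2 hxy)⟩

theorem copyCount_rootEmbedding {Γ : SimpleGraph W} {R A : Finset W} (h : R ⊆ A) {n : ℕ}
    (G : SimpleGraph (Fin n)) (g : W → Fin n) (hg : Set.InjOn g R) :
    (extGraph Γ R A h).copyCount G (rootEmbedding h g hg) = (rootedCopies Γ R A G g).card :=
  copyCount_extGraph Γ h G _ g fun _ => rfl

variable {Γ : SimpleGraph W} {R A : Finset W} {h : R ⊆ A} {n i : ℕ} {C : ℝ}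

theorem Early.powers {m : ℕ} (hearly : Early (sqrtDelta m ^ 2) (bigConst m C) (logPower m) n i)
    (hC : 0 < C) :
    zeta n (density n i) ≤ (zeta n (density n i) ^ (sqrtDelta m ^ 2)) ^ 4 ∧
      zeta n (density n i) ^ (sqrtDelta m / (m + 1)) ≤
        (zeta n (density n i) ^ (sqrtDelta m ^ 2)) ^ 4 ∧
      0 < zeta n (density n i) ^ (sqrtDelta m ^ 2) ∧
      bigConst m C * zeta n (density n i) ^ (sqrtDelta m ^ 2) ≤ 1 := by
  have hK : 1 ≤ bigConst m C := by linarith [(bigConst_bounds m hC).1]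
  have hs := sqrtDelta_pos m
  have hδ : 0 < sqrtDelta m ^ 2 := by positivity
  have hz := hearly.zeta_pos hK le_rfl
  have hz1 := hearly.zeta_le_one hK (logPower_nonneg m) hδ
  have h4 : (zeta n (density n i) ^ (sqrtDelta m ^ 2)) ^ 4 =
      zeta n (density n i) ^ (4 * sqrtDelta m ^ 2) := by
    rw [← Real.rpow_natCast, ← Real.rpow_mul hz.le]
    congr 1
    push_cast
    ring
  have h5 : 4 * sqrtDelta m ^ 2 ≤ 1 := by
    have := sqrtDelta_le m
    nlinarith
  refine ⟨?_, ?_, Real.rpow_pos_of_pos hz _,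
    hearly.mul_zeta_rpow_le_one hK (logPower_nonneg m)⟩
  · rw [h4]
    exact Real.self_le_rpow_of_le_one hz.le hz1 h5
  · rw [h4]
    exact Real.rpow_le_rpow_of_exponent_ge hz hz1 (sqrtDelta_sq_le m)

/-- The inequalities between the parameters before `t_H^-`. -/
theorem balanced_numerics {C b q l lc Λ K y z κ N x : ℝ} (hl : 1 ≤ l) (hC : 0 < C) (hb0 : 0 ≤ b)
    (hq : 0 ≤ q) (hlc0 : 0 < lc) (hlc : 1 ≤ lc) (hL5 : l ^ 5 * lc ≤ Λ) (y0 : 0 < y)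
    (p1 : z ≤ y ^ 4) (p2 : κ ≤ y ^ 4) (hz : 0 < z) (hzn : 1 ≤ x * z ^ 2)
    (hsmall : y * (K * Λ) ≤ 1) (p4 : K * y ≤ 1) (k4 : 64 * ((4 * C + 3) * b) ≤ K)
    (k5 : 512 * (q * b) ≤ K) (k6 : 512 * q ≤ K) (k7 : 4 * N ≤ K) (hN : 0 ≤ N)
    (hx : 0 ≤ x) (hκ : 0 ≤ κ) (hy1 : y ≤ 1) :
    2 * (4 * C + 3) * 2 * (b * z) ≤ y / 4 ∧ 4 * l ^ 2 * (q * lc * κ) ≤ y ∧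
      16 * l ^ 4 * (4 * (q * lc * κ) * 2) * (b * l) ≤ y ^ 2 ∧ 4 * l ^ 2 * N ≤ x * y := by
  -- Here `y` is the error `ζ ^ δ`, `κ` the bound on `1 / S_J`, `q lc κ` the relative loss in one
  -- step, `lc` and `Λ` powers of the logarithm `l`, `x` the number `n` and `N` the square of the
  -- number of labels. Each use of `hsmall` spends one factor `y` on constants and logarithms.
  have hl0 : 0 < l := by linarith
  have hl25 : l ^ 2 ≤ l ^ 5 := pow_le_pow_right₀ hl (by norm_num)
  have hlΛ : l ^ 2 ≤ Λ := by nlinarith [pow_pos hl0 5]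
  have hΛ : 0 < Λ := by nlinarith
  have hΛ1 : 1 ≤ Λ := by nlinarith
  have hy2 : y ^ 4 ≤ y ^ 3 := pow_le_pow_of_le_one y0.le hy1 (by norm_num)
  have hy3 : y ^ 4 ≤ y ^ 2 := pow_le_pow_of_le_one y0.le hy1 (by norm_num)
  refine ⟨?_, ?_, ?_, ?_⟩
  · have e1 : (64 * ((4 * C + 3) * b)) * y ≤ 1 := le_trans (by gcongr) p4
    calc 2 * (4 * C + 3) * 2 * (b * z) ≤ 2 * (4 * C + 3) * 2 * (b * y ^ 2) := by
          gcongr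
          exact p1.trans hy3
      _ = (64 * ((4 * C + 3) * b)) * y * (y / 16) := by ring
      _ ≤ 1 * (y / 16) := by gcongr
      _ ≤ y / 4 := by linarith
  · have e1 : y * ((512 * q) * Λ) ≤ 1 := le_trans (by gcongr) hsmall
    calc 4 * l ^ 2 * (q * lc * κ) ≤ 4 * l ^ 5 * (q * lc * y ^ 2) := by
          gcongr
          exact p2.trans hy3
      _ = 4 * q * (l ^ 5 * lc) * y ^ 2 := by ring
      _ ≤ 4 * q * Λ * y ^ 2 := by gcongr
      _ = y * (512 * q * Λ) * (y / 128) := by ring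
      _ ≤ 1 * (y / 128) := by gcongr
      _ ≤ y := by linarith
  · have e1 : y * ((512 * (q * b)) * Λ) ≤ 1 := le_trans (by gcongr) hsmall
    calc 16 * l ^ 4 * (4 * (q * lc * κ) * 2) * (b * l)
        ≤ 16 * l ^ 4 * (4 * (q * lc * y ^ 3) * 2) * (b * l) := by
          gcongr
          exact p2.trans hy2
      _ = 128 * (q * b) * (l ^ 5 * lc) * y ^ 3 := by ring
      _ ≤ 128 * (q * b) * Λ * y ^ 3 := by gcongr
      _ = y * (512 * (q * b) * Λ) * (y ^ 2 / 4) := by ring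
      _ ≤ 1 * (y ^ 2 / 4) := by gcongr
      _ ≤ y ^ 2 := by nlinarith [sq_nonneg y]
  · have e1 : y * ((4 * N) * Λ) ≤ 1 := le_trans (by gcongr) hsmall
    have hzy : z ≤ y := p1.trans (hy3.trans (by nlinarith))
    calc 4 * l ^ 2 * N ≤ 4 * Λ * N * (x * z ^ 2) := by
          have : 4 * l ^ 2 * N ≤ 4 * Λ * N := by gcongr
          exact this.trans (le_mul_of_one_le_right (by positivity) hzn)
      _ ≤ 4 * Λ * N * (x * y ^ 2) := by gcongr
      _ = y * (4 * N * Λ) * (x * y) := by ring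
      _ ≤ 1 * (x * y) := by gcongr
      _ = x * y := one_mul _

/-- The probability that a balanced extension is the first to go astray before `t_H^-`. -/
theorem balanced_failure_le (h : R ⊆ A) (hf : A.card - R.card ≠ 0) (hC : 0 < C)
    (hearly : Early (sqrtDelta (Fintype.card W) ^ 2) (bigConst (Fintype.card W) C)
      (logPower (Fintype.card W)) n i)
    (g : W → Fin n) (hg : Set.InjOn g R) (hb : (extGraph Γ R A h).Balanced)
    (hi : (i : ℕ∞) ≤ (extGraph Γ R A h).tHMinus n (sqrtDelta (Fintype.card W))) :
    (removalProcess n).toOuterMeasure {G : ℕ → SimpleGraph (Fin n) |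
      GoodHistory W C (sqrtDelta (Fintype.card W) ^ 2) (sqrtDelta (Fintype.card W)) n i G ∧
      (extGraph Γ R A h).scaling n (density n i) *
          zeta n (density n i) ^ (sqrtDelta (Fintype.card W) ^ 2) <
        |((rootedCopies Γ R A (G i) g).card : ℝ) - (extGraph Γ R A h).scaling n (density n i)|} ≤
      ENNReal.ofReal (2 * Real.exp (-Real.log n ^ 2)) := by
  obtain ⟨k1, k2, k3, k4, k5, k6, k7⟩ := bigConst_bounds (Fintype.card W) hC
  obtain ⟨p1, p2, y0, p4⟩ := hearly.powers hC
  have hK : 1 ≤ bigConst (Fintype.card W) C := by linarith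
  have hs := sqrtDelta_pos (Fintype.card W)
  have hs4 := sqrtDelta_le (Fintype.card W)
  have hδ : 0 < sqrtDelta (Fintype.card W) ^ 2 := by positivity
  have hδ1 : sqrtDelta (Fintype.card W) ^ 2 ≤ 1 := pow_le_one₀ hs.le (by linarith)
  have ha := logPower_nonneg (Fintype.card W)
  have hz := hearly.zeta_pos hK le_rfl
  have hz1 := hearly.zeta_le_one hK ha hδ
  have hl := hearly.one_le_log hK
  have hn := hearly.pos hK
  have hsmall := hearly.zeta_small
  have hzn := one_div_le_zeta_sq hn hl hearly.density_pos (density_le_one n i)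
  have hq := lossConst_nonneg (Fintype.card W)
  have hfm : A.card - R.card ≤ Fintype.card W := (Nat.sub_le _ _).trans (Finset.card_le_univ A)
  have hl0 : 0 < Real.log n := by linarith
  have hL5 : Real.log n ^ 5 * Real.log n ^ logExponent (A.card - R.card - 1) ≤
      Real.log n ^ logPower (Fintype.card W) := by
    rw [← Real.rpow_natCast, ← Real.rpow_add hl0]
    refine Real.rpow_le_rpow_of_exponent_le hl ?_
    unfold logPower
    push_cast
    linarith [logExponent_mono (a := A.card - R.card - 1) (b := Fintype.card W) (by omega)]
  have hLc : 0 < Real.log n ^ logExponent (A.card - R.card - 1) := by positivity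
  have hRb : 0 ≤ lossConst (Fintype.card W) *
      Real.log n ^ logExponent (A.card - R.card - 1) *
      zeta n (density n i) ^ (sqrtDelta (Fintype.card W) / (Fintype.card W + 1)) := by positivity
  obtain ⟨e1, e2, e3, e4⟩ := balanced_numerics hl hC (by positivity) hq hLc
    (Real.one_le_rpow hl (logExponent_nonneg _)) hL5 y0 p1 p2 hz hzn hsmall p4 k4 k5 k6 k7
    (by positivity) (by positivity)
    (Real.rpow_nonneg hz.le _) ((le_mul_of_one_le_left y0.le hK).trans p4)
  refine le_trans (MeasureTheory.measure_mono ?_) (deviation_le (Γ := Γ) h hf hearly hδ hδ1 ha hC g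
    hg (xb := 2) (Rb := lossConst (Fintype.card W) *
      Real.log n ^ logExponent (A.card - R.card - 1) *
      zeta n (density n i) ^ (sqrtDelta (Fintype.card W) / (Fintype.card W + 1)))
    (err := zeta n (density n i) ^ (sqrtDelta (Fintype.card W) ^ 2))
    (by norm_num) hRb y0 ?_ ?_ ?_ ?_)
  · rintro G ⟨hG, hdev⟩
    refine ⟨fun j hj => ⟨(hG.2 j hj).1, ?_, fun T hT => ?_⟩,
      abs_div_sub_one ((extGraph Γ R A h).scaling_pos hn hearly.density_pos) hdev⟩
    · have h1 := ((hG.2 j hj).2 (extGraph Γ R A h) (rootEmbedding h g hg)).1 hb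
        (le_trans (by exact_mod_cast hj.le) hi)
      rw [copyCount_rootEmbedding] at h1
      have h2 := (abs_le.1 h1).2
      have hpj := hearly.density_pos_of_le hj.le
      have h3 : zeta n (density n j) ^ (sqrtDelta (Fintype.card W) ^ 2) ≤ 1 :=
        Real.rpow_le_one (zeta_nonneg hpj.le) ((hearly.zeta_le hj.le).trans hz1) hδ.le
      have h4 := mul_le_of_le_one_right ((extGraph Γ R A h).scaling_nonneg (n := n) hpj.le) h3
      linarith
    · refine hG.lost_le h hearly hδ hs.le (by linarith) ha hC (by positivity) hj ?_ g hT
      intro J hRJ hJA hJR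
      have hpj := hearly.density_pos_of_le hj.le
      have hSJ := (extGraph Γ R J hRJ).scaling_pos hn hpj
      have hJ0 : J.card - R.card ≠ 0 := by
        have := card_lt_of_subset_of_ne hRJ hJR.symm
        omega
      -- No step before `i` has met the threshold that defines `t_H^-`.
      have h1 : 1 / zeta n (density n j) ^ sqrtDelta (Fintype.card W) <
          (extGraph Γ R A h).scaling n (density n j) := by
        by_contra hcon
        have := le_firstStep_iff.1 hi j (not_lt.1 hcon)
        omega
      have hzj := hearly.zeta_pos hK hj.le
      have hzj1 := (hearly.zeta_le hj.le).trans hz1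
      have h2 : 1 ≤ zeta n (density n i) ^ sqrtDelta (Fintype.card W) *
          (extGraph Γ R A h).scaling n (density n j) := by
        rw [div_lt_iff₀ (by positivity)] at h1
        have h3 : zeta n (density n j) ^ sqrtDelta (Fintype.card W) ≤
            zeta n (density n i) ^ sqrtDelta (Fintype.card W) := by
          have := hearly.zeta_le hj.le
          gcongr
        have h4 := (extGraph Γ R A h).scaling_nonneg (n := n) hpj.le
        rw [mul_comm] at h1
        exact h1.le.trans (mul_le_mul_of_nonneg_right h3 h4)
      have h3 : 1 ≤ (extGraph Γ R A h).scaling n (density n j) := by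
        have h4 : zeta n (density n i) ^ sqrtDelta (Fintype.card W) ≤ 1 :=
          Real.rpow_le_one hz.le hz1 hs.le
        have h5 := (extGraph Γ R A h).scaling_nonneg (n := n) hpj.le
        exact h2.trans (mul_le_of_le_one_left h5 h4)
      -- As `S_A ≥ 1`, balancedness gives `S_A ≤ S_A ^ |J \ R| ≤ S_J ^ |A \ R|`, so `S_J` is at
      -- least a fixed power of `1 / ζ`.
      refine one_div_le_rpow_of_pow hSJ hz hz1 hs.le hf hfm (h2.trans ?_)
      gcongr
      exact (le_self_pow₀ h3 hJ0).trans (hb.scaling_pow_le hRJ hJA hJR hpj (density_le_one n j))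
  · exact e1
  · exact e2
  · exact e3
  · exact e4

end Regions

/-! ### Strictly balanced extensions between `t_H^-` and `t_H`. -/

section StrictRegion

variable {W : Type*} [Fintype W] [DecidableEq W]

/-- The inequalities between the parameters after `t_H^-`. -/
theorem strict_numerics {C b q l lc lr K y z κ N x v u : ℝ} (hl : 1 ≤ l)
    (hb0 : 0 ≤ b) (hq : 0 ≤ q) (hlc0 : 0 < lc) (hlr : l ^ 8 * lc ≤ lr) (hlr1 : 1 ≤ lr)
    (y0 : 0 < y) (hy1 : y ≤ 1) (p2 : κ ≤ y ^ 4) (hκ : 0 ≤ κ) (hu : 0 ≤ u) (hyv : y ≤ v)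
    (huv : u ≤ 2 * v ^ 2) (hv : v ≤ 2) (hKl : K ≤ l) (k5 : 512 * (q * b) ≤ K) (k6 : 512 * q ≤ K)
    (e1 : 2 * (4 * C + 3) * 2 * (b * z) ≤ y / 4) (e4 : 4 * l ^ 2 * N ≤ x * y) (hx : 0 ≤ x) :
    2 * (4 * C + 3) * (2 * lr) * (b * z) ≤ v * lr / 4 ∧
      4 * l ^ 2 * (q * lc * (κ + u)) ≤ v * lr ∧
      16 * l ^ 4 * (4 * (q * lc * (κ + u)) * (2 * lr)) * (b * l) ≤ (v * lr) ^ 2 ∧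
      4 * l ^ 2 * N ≤ x * (v * lr) := by
  -- Here `u` is `1 / S_A`, the contribution of `J = A` to the loss, `v` is `S_A ^ (-√δ)`, and the
  -- error is `v lr`. One logarithm absorbs the constants through `K ≤ l`, and `lr` absorbs the
  -- logarithms.
  have hl0 : 0 < l := by linarith
  have hv0 : 0 < v := by linarith
  have hlr0 : 0 < lr := by linarith
  have hr : κ + u ≤ 3 * v ^ 2 := by
    have h1 : y ^ 4 ≤ y ^ 2 := pow_le_pow_of_le_one y0.le hy1 (by norm_num)
    have h2 : y ^ 2 ≤ v ^ 2 := by gcongr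
    linarith
  have hr0 : 0 ≤ κ + u := by linarith
  have hl3 : l ^ 3 * lc ≤ lr := le_trans (by gcongr; norm_num) hlr
  have hl6 : l ^ 6 * lc ≤ lr := le_trans (by gcongr; norm_num) hlr
  refine ⟨?_, ?_, ?_, ?_⟩
  · calc 2 * (4 * C + 3) * (2 * lr) * (b * z) = (2 * (4 * C + 3) * 2 * (b * z)) * lr := by ring
      _ ≤ (y / 4) * lr := by gcongr
      _ ≤ (v / 4) * lr := by gcongr
      _ = v * lr / 4 := by ring
  · calc 4 * l ^ 2 * (q * lc * (κ + u)) ≤ 4 * l ^ 2 * (q * lc * (3 * v ^ 2)) := by gcongr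
      _ = (512 * q) * (l ^ 2 * lc) * (3 / 128 * v * v) := by ring
      _ ≤ l * (l ^ 2 * lc) * (3 / 128 * v * 2) := by
          gcongr
          exact k6.trans hKl
      _ = l ^ 3 * lc * (3 / 64 * v) := by ring
      _ ≤ lr * (3 / 64 * v) := by gcongr
      _ ≤ v * lr := by nlinarith [mul_pos hv0 hlr0]
  · calc 16 * l ^ 4 * (4 * (q * lc * (κ + u)) * (2 * lr)) * (b * l)
        ≤ 16 * l ^ 4 * (4 * (q * lc * (3 * v ^ 2)) * (2 * lr)) * (b * l) := by gcongr
      _ = (512 * (q * b)) * (l ^ 5 * lc) * (3 / 4 * v ^ 2 * lr) := by ring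
      _ ≤ l * (l ^ 5 * lc) * (3 / 4 * v ^ 2 * lr) := by
          gcongr
          exact k5.trans hKl
      _ = l ^ 6 * lc * (3 / 4 * v ^ 2 * lr) := by ring
      _ ≤ lr * (3 / 4 * v ^ 2 * lr) := by gcongr
      _ ≤ (v * lr) ^ 2 := by nlinarith [mul_pos hv0 hlr0, sq_nonneg (v * lr)]
  · refine e4.trans ?_
    gcongr
    exact hyv.trans (le_mul_of_one_le_right hv0.le hlr1)

/-- The error `S ^ (-s)` is at least `ζ ^ δ` with `δ = s²`, and its square outweighs `1 / S` because
`2 s ≤ 1`. The factors 2 allow for `S` slightly below 1. -/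
theorem rpow_bounds_of_scaling {S z s : ℝ} (hs0 : 0 < s) (hs1 : s ≤ 1 / 4) (hS : 1 / 2 ≤ S)
    (hz : 0 < z) (hSz : S ≤ 1 / z ^ s) :
    z ^ s ^ 2 ≤ S ^ (-s) ∧ 1 / S ≤ 2 * (S ^ (-s)) ^ 2 ∧ S ^ (-s) ≤ 2 := by
  have hS0 : 0 < S := by linarith
  have hhalf : ∀ r : ℝ, 0 ≤ r → r ≤ 1 → S ^ (-r) ≤ 2 := by
    intro r hr0 hr1
    calc S ^ (-r) ≤ (1 / 2 : ℝ) ^ (-r) :=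
          Real.rpow_le_rpow_of_nonpos (by norm_num) hS (by linarith)
      _ = 2 ^ r := by rw [one_div, Real.inv_rpow (by norm_num), Real.rpow_neg (by norm_num), inv_inv]
      _ ≤ 2 ^ (1 : ℝ) := Real.rpow_le_rpow_of_exponent_le (by norm_num) hr1
      _ = 2 := Real.rpow_one 2
  refine ⟨?_, ?_, hhalf s hs0.le (by linarith)⟩
  · calc z ^ s ^ 2 = (1 / z ^ s) ^ (-s) := by
          rw [one_div, Real.inv_rpow (by positivity), Real.rpow_neg (by positivity), inv_inv,
            ← Real.rpow_mul hz.le, sq]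
      _ ≤ S ^ (-s) := Real.rpow_le_rpow_of_nonpos hS0 hSz (by linarith)
  · calc 1 / S = S ^ (-(1 - 2 * s)) * (S ^ (-s)) ^ 2 := by
          rw [← Real.rpow_natCast, ← Real.rpow_mul hS0.le, ← Real.rpow_add hS0, one_div,
            ← Real.rpow_neg_one]
          congr 1
          push_cast
          ring
      _ ≤ 2 * (S ^ (-s)) ^ 2 := by
          gcongr
          exact hhalf _ (by linarith) (by linarith)

variable {Γ : SimpleGraph W} {R A : Finset W} {h : R ⊆ A} {n i : ℕ} {C : ℝ}

/-- The scaling exceeds 1 at every step before `t_H`, and the last step at most halves it. -/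
theorem half_le_scaling (h : R ⊆ A) (hC : 0 < C)
    (hearly : Early (sqrtDelta (Fintype.card W) ^ 2) (bigConst (Fintype.card W) C)
      (logPower (Fintype.card W)) n i)
    (hi : (i : ℕ∞) ≤ (extGraph Γ R A h).tH n) :
    1 / 2 ≤ (extGraph Γ R A h).scaling n (density n i) := by
  have hK : 1 ≤ bigConst (Fintype.card W) C := by
    linarith [(bigConst_bounds (Fintype.card W) hC).1]
  have hn : (1 : ℝ) ≤ n := by exact_mod_cast hearly.pos hK
  have hδ : 0 < sqrtDelta (Fintype.card W) ^ 2 := pow_pos (sqrtDelta_pos _) 2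
  rcases Nat.eq_zero_or_pos i with rfl | hi0
  · rw [extGraph_scaling, density_zero, one_pow, mul_one]
    linarith [one_le_pow₀ hn (n := A.card - R.card)]
  · obtain ⟨k, rfl⟩ := Nat.exists_eq_succ_of_ne_zero hi0.ne'
    have h1 := scaling_le_two_mul (Γ := Γ) h hearly hδ (logPower_nonneg _) hC (Nat.lt_succ_self k)
    have h2 : 1 < (extGraph Γ R A h).scaling n (density n k) := by
      by_contra hcon
      have := le_firstStep_iff.1 hi k (not_lt.1 hcon)
      omega
    simp only [Nat.succ_eq_add_one] at h1 ⊢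
    linarith

/-- Once the scaling of a strictly balanced extension is small, so is the density. -/
theorem density_le_of_scaling_le (hf : A.card - R.card ≠ 0) (hC : 0 < C)
    (hE0 : (edgesBetween Γ R A).card ≠ 0)
    (hearly : Early (sqrtDelta (Fintype.card W) ^ 2) (bigConst (Fintype.card W) C)
      (logPower (Fintype.card W)) n i)
    (hS : (extGraph Γ R A h).scaling n (density n i) ≤
      1 / zeta n (density n i) ^ sqrtDelta (Fintype.card W)) :
    density n (i - 1) ≤ zeta n (density n i) ^ sqrtDelta (Fintype.card W) := by
  have hK6 := (bigConst_bounds (Fintype.card W) hC).1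
  have hK : 1 ≤ bigConst (Fintype.card W) C := by linarith
  have hs := sqrtDelta_pos (Fintype.card W)
  have hs4 := sqrtDelta_le (Fintype.card W)
  have hδ : 0 < sqrtDelta (Fintype.card W) ^ 2 := pow_pos hs 2
  have hz := hearly.zeta_pos hK le_rfl
  have hz1 := hearly.zeta_le_one hK (logPower_nonneg _) hδ
  have hn := hearly.pos hK
  have hn1 : (1 : ℝ) ≤ n := by exact_mod_cast hn
  have hp := hearly.density_pos
  have hzn := one_div_le_zeta_sq hn (hearly.one_le_log hK) hp (density_le_one n i)
  have hpow := (hearly.powers hC).2.2.2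
  have hEb := card_edgesBetween_le Γ R A
  have hadd := sqrtDelta_add_le (Fintype.card W)
  refine (hearly.density_pred_le hK6 (logPower_nonneg _) hδ).trans ?_
  rw [extGraph_scaling] at hS
  set s := sqrtDelta (Fintype.card W)
  set z := zeta n (density n i)
  set p := density n i
  set E := (edgesBetween Γ R A).card
  have hzs : 0 < z ^ s := by positivity
  -- There is a free vertex, so `n p ^ E ≤ S ≤ ζ^(-s)`; combine this with `n ζ² ≥ 1`.
  have h1 : p ^ E ≤ z := by
    rw [le_div_iff₀ hzs] at hS
    have h2 : (n : ℝ) ≤ (n : ℝ) ^ (A.card - R.card) := le_self_pow₀ hn1 hf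
    have h3 : n * p ^ E * z ^ s ≤ 1 := le_trans (by gcongr) hS
    have h4 : z ≤ z ^ s := Real.self_le_rpow_of_le_one hz.le hz1 (by linarith)
    have h5 : n * p ^ E * z ≤ 1 := le_trans (by gcongr) h3
    have h6 : (n * z) * p ^ E ≤ (n * z) * z := by
      calc (n * z) * p ^ E = n * p ^ E * z := by ring
        _ ≤ 1 := h5
        _ ≤ n * z ^ 2 := hzn
        _ = (n * z) * z := by ring
    exact le_of_mul_le_mul_left h6 (by positivity)
  have hEpos : (0 : ℝ) < E := by exact_mod_cast Nat.pos_of_ne_zero hE0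
  have h2 : p ≤ z ^ (s + s ^ 2) := by
    calc p = (p ^ E) ^ ((E : ℝ)⁻¹) := (Real.pow_rpow_inv_natCast hp.le hE0).symm
      _ ≤ z ^ ((E : ℝ)⁻¹) := by gcongr
      _ ≤ z ^ (s + s ^ 2) := by
        refine Real.rpow_le_rpow_of_exponent_ge hz hz1 (hadd.trans ?_)
        rw [inv_eq_one_div]
        gcongr
  rw [Real.rpow_add hz] at h2
  have h3 : 2 * z ^ s ^ 2 ≤ 1 := by
    refine le_trans ?_ hpow
    gcongr
    linarith
  calc 2 * p ≤ 2 * (z ^ s * z ^ s ^ 2) := by gcongr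
    _ = z ^ s * (2 * z ^ s ^ 2) := by ring
    _ ≤ z ^ s * 1 := by gcongr
    _ = z ^ s := mul_one _

/-- The probability that a strictly balanced extension is the first to go astray after `t_H^-`. -/
theorem strictlyBalanced_failure_le (h : R ⊆ A) (hf : A.card - R.card ≠ 0) (hC : 0 < C)
    (hearly : Early (sqrtDelta (Fintype.card W) ^ 2) (bigConst (Fintype.card W) C)
      (logPower (Fintype.card W)) n i)
    (g : W → Fin n) (hg : Set.InjOn g R) (hb : (extGraph Γ R A h).StrictlyBalanced)
    (him : (extGraph Γ R A h).tHMinus n (sqrtDelta (Fintype.card W)) ≤ (i : ℕ∞))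
    (hi : (i : ℕ∞) ≤ (extGraph Γ R A h).tH n) :
    (removalProcess n).toOuterMeasure {G : ℕ → SimpleGraph (Fin n) |
      GoodHistory W C (sqrtDelta (Fintype.card W) ^ 2) (sqrtDelta (Fintype.card W)) n i G ∧
      (extGraph Γ R A h).scaling n (density n i) ^ (1 - sqrtDelta (Fintype.card W)) *
          Real.log n ^ (3 * Real.exp ((extGraph Γ R A h).numFree : ℝ)) <
        |((rootedCopies Γ R A (G i) g).card : ℝ) - (extGraph Γ R A h).scaling n (density n i)|} ≤
      ENNReal.ofReal (2 * Real.exp (-Real.log n ^ 2)) := by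
  obtain ⟨k1, k2, k3, k4, k5, k6, k7⟩ := bigConst_bounds (Fintype.card W) hC
  obtain ⟨p1, p2, y0, p4⟩ := hearly.powers hC
  have hK : 1 ≤ bigConst (Fintype.card W) C := by linarith
  have hs := sqrtDelta_pos (Fintype.card W)
  have hs4 := sqrtDelta_le (Fintype.card W)
  have hδ : 0 < sqrtDelta (Fintype.card W) ^ 2 := by positivity
  have hδ1 : sqrtDelta (Fintype.card W) ^ 2 ≤ 1 := pow_le_one₀ hs.le (by linarith)
  have ha := logPower_nonneg (Fintype.card W)
  have hz := hearly.zeta_pos hK le_rfl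
  have hz1 := hearly.zeta_le_one hK ha hδ
  have hl := hearly.one_le_log hK
  have hn := hearly.pos hK
  have hsmall := hearly.zeta_small
  have hzn := one_div_le_zeta_sq hn hl hearly.density_pos (density_le_one n i)
  have hq := lossConst_nonneg (Fintype.card W)
  have hfm : A.card - R.card ≤ Fintype.card W := (Nat.sub_le _ _).trans (Finset.card_le_univ A)
  have hl0 : 0 < Real.log n := by linarith
  have hRA : R ≠ A := by
    rintro rfl
    exact hf (Nat.sub_self _)
  have hE0 : (edgesBetween Γ R A).card ≠ 0 := (hb.edges_pos hRA).ne'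
  have hSi := scaling_le_of_tHMinus_le (by linarith) (by rwa [extGraph_numEdges]) hn hl
    hearly.density_pos him
  have hSi2 := half_le_scaling h hC hearly hi
  have hSpos := (extGraph Γ R A h).scaling_pos hn hearly.density_pos
  have hpz := density_le_of_scaling_le hf hC hE0 hearly hSi
  obtain ⟨v1, v2, v3⟩ := rpow_bounds_of_scaling hs hs4 hSi2 hz hSi
  rw [extGraph_numFree]
  have hL5 : Real.log n ^ 5 * Real.log n ^ logExponent (A.card - R.card - 1) ≤
      Real.log n ^ logPower (Fintype.card W) := by
    rw [← Real.rpow_natCast, ← Real.rpow_add hl0]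
    refine Real.rpow_le_rpow_of_exponent_le hl ?_
    unfold logPower
    push_cast
    linarith [logExponent_mono (a := A.card - R.card - 1) (b := Fintype.card W) (by omega)]
  have hL8 : Real.log n ^ 8 * Real.log n ^ logExponent (A.card - R.card - 1) ≤
      Real.log n ^ (3 * Real.exp ((A.card - R.card : ℕ) : ℝ)) := by
    rw [← Real.rpow_natCast, ← Real.rpow_add hl0]
    refine Real.rpow_le_rpow_of_exponent_le hl ?_
    push_cast [-Nat.cast_sub]
    linarith [logExponent_lt hf]
  have hLr : 1 ≤ Real.log n ^ (3 * Real.exp ((A.card - R.card : ℕ) : ℝ)) :=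
    Real.one_le_rpow hl (by positivity)
  have hLc : 0 < Real.log n ^ logExponent (A.card - R.card - 1) := by positivity
  have hκ := Real.rpow_nonneg hz.le (sqrtDelta (Fintype.card W) / (Fintype.card W + 1))
  have hu : 0 ≤ 1 / (extGraph Γ R A h).scaling n (density n i) := by positivity
  have hy1 := (le_mul_of_one_le_left y0.le hK).trans p4
  obtain ⟨b1, -, -, b4⟩ := balanced_numerics hl hC (by positivity) hq hLc
    (Real.one_le_rpow hl (logExponent_nonneg _)) hL5 y0 p1 p2 hz hzn hsmall p4 k4 k5 k6 k7
    (by positivity) (Nat.cast_nonneg n) hκ hy1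
  obtain ⟨e1, e2, e3, e4⟩ := strict_numerics hl (by positivity) hq hLc hL8 hLr y0 hy1 p2 hκ hu v1 v2
    v3 hearly.le_log k5 k6 b1 b4 (Nat.cast_nonneg n)
  have hLr0 := zero_lt_one.trans_le hLr
  refine le_trans (MeasureTheory.measure_mono ?_) (deviation_le (Γ := Γ) h hf hearly hδ hδ1 ha hC g
    hg (by positivity) (by positivity) (by positivity) e1 e2 e3 e4)
  rintro G ⟨hG, hdev⟩
  refine ⟨fun j hj => ⟨(hG.2 j hj).1, ?_, fun T hT => ?_⟩, abs_div_sub_one hSpos ?_⟩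
  · have hpj := hearly.density_pos_of_le hj.le
    have h1 := copyCount_le_of_controlled hδ.le hs.le (by linarith) hG.1
      (fun j' hj' => (hG.2 j' (by omega)).2 (extGraph Γ R A h) (rootEmbedding h g hg)) hl hpj
      ((hearly.zeta_le hj.le).trans hz1) hb
    have h2 : 1 ≤ (extGraph Γ R A h).scaling n (density n j) := by
      by_contra hcon
      have := le_firstStep_iff.1 hi j (not_le.1 hcon).le
      omega
    rw [copyCount_rootEmbedding, max_eq_left h2, extGraph_numFree] at h1
    exact h1
  · refine hG.lost_le h hearly hδ hs.le (by linarith) ha hC (by positivity) hj ?_ g hT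
    intro J hRJ hJA hJR
    have hji : j ≤ i - 1 := by omega
    have hpj := hearly.density_pos_of_le hj.le
    have hpk := hearly.density_pos_of_le (Nat.sub_le i 1)
    have hJ0 : J.card - R.card ≠ 0 := by
      have := card_lt_of_subset_of_ne hRJ hJR.symm
      omega
    -- `J = A` contributes `1 / S_A`; for every other `J`, strict balance gains a factor `p ≤ ζ ^
    -- √δ`. That comparison is made at step `i - 1`, where `S_A` is still at least 1; at step `i` it
    -- may not be.
    by_cases hJA' : J = A
    · subst hJA'
      have h1 := (extGraph Γ R J h).scaling_mono (n := n) hearly.density_pos.le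
        (density_antitone n hj.le)
      have h2 := one_div_le_one_div_of_le hSpos h1
      linarith
    · have hSk := (extGraph Γ R J hRJ).scaling_pos hn hpk
      have h1 := (extGraph Γ R J hRJ).scaling_mono (n := n) hpk.le (density_antitone n hji)
      have h2 := one_div_le_one_div_of_le hSk h1
      have h3 : 1 ≤ (extGraph Γ R A h).scaling n (density n (i - 1)) := by
        by_contra hcon
        have := le_firstStep_iff.1 hi (i - 1) (not_le.1 hcon).le
        omega
      have h4 := hb.scaling_pow_le hRJ hJA hJR hJA' (n := n) hpk (density_le_one n (i - 1))
      have h5 := one_div_le_rpow_of_pow hSk hz hz1 hs.le hf hfm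
        (((one_le_pow₀ h3).trans h4).trans (by gcongr))
      linarith
  · refine lt_of_eq_of_lt ?_ hdev
    rw [sub_eq_add_neg, Real.rpow_add hSpos, Real.rpow_one]
    ring

end StrictRegion

/-! ### The first steps, and the union bound -/

theorem mem_triangles {V : Type*} [Fintype V] {G : SimpleGraph V} {T : Finset V} :
    T ∈ triangles G ↔ G.IsNClique 3 T := by
  classical
  rw [triangles, SimpleGraph.mem_cliqueFinset_iff]

/-- Accuracy at step 0 has to be checked, since `τ⋆` looks at positive times only. In the complete
graph all relative errors are below `3/n`, which is less than `C ζ` and `C ζ²` once `C log n > 3`.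
-/
theorem accurate_top {n : ℕ} {C : ℝ} (hn : 2 ≤ n) (hC : 0 < C) (hl : 1 ≤ Real.log n)
    (hCl : 3 < C * Real.log n) : Accurate C 1 (⊤ : SimpleGraph (Fin n)) := by
  classical
  have hn0 : 0 < n := by omega
  have hn' : (0 : ℝ) < n := by exact_mod_cast hn0
  have hn1 : (1 : ℝ) ≤ n := by exact_mod_cast hn0
  have hsq := zeta_sq (n := n) (p := 1) hn0 one_pos
  have hz : 3 / (n : ℝ) < C * zeta n 1 := by
    have h1 : (n : ℝ)⁻¹ ≤ (n : ℝ) ^ (-(1 / 2) : ℝ) := by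
      rw [← Real.rpow_neg_one]
      exact Real.rpow_le_rpow_of_exponent_le hn1 (by norm_num)
    calc 3 / (n : ℝ) = 3 * (n : ℝ)⁻¹ := div_eq_mul_inv _ _
      _ < (C * Real.log n) * (n : ℝ)⁻¹ := by gcongr
      _ ≤ (C * Real.log n) * (n : ℝ) ^ (-(1 / 2) : ℝ) := by gcongr
      _ = C * zeta n 1 := by
        unfold zeta
        rw [inv_one]
        ring
  refine ⟨fun u => ?_, fun u v huv => ?_, ?_⟩
  · have h1 : (deg (⊤ : SimpleGraph (Fin n)) u : ℝ) = n - 1 := by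
      rw [deg, SimpleGraph.neighborSet_top, Set.ncard_compl, Set.ncard_singleton, Nat.card_eq_fintype_card,
        Fintype.card_fin, Nat.cast_sub hn0, Nat.cast_one]
    have h2 : ((n : ℝ) - 1) / (n * 1) - 1 = -(1 / n) := by
      field_simp
      ring
    rw [h1, h2, abs_neg, abs_of_pos (by positivity)]
    refine lt_of_le_of_lt ?_ hz
    gcongr
    norm_num
  · have h1 : (codeg (⊤ : SimpleGraph (Fin n)) u v : ℝ) = n - 2 := by
      rw [codeg, SimpleGraph.commonNeighbors_top_eq, ← Set.compl_eq_univ_sdiff, Set.ncard_compl,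
        Set.ncard_pair huv, Nat.card_eq_fintype_card, Fintype.card_fin, Nat.cast_sub hn,
        Nat.cast_ofNat]
    have h2 : ((n : ℝ) - 2) / (n * 1 ^ 2) - 1 = -(2 / n) := by
      field_simp
      ring
    rw [h1, h2, abs_neg, abs_of_pos (by positivity)]
    refine lt_of_le_of_lt ?_ hz
    gcongr
    norm_num
  · have h1 : triangleCount (⊤ : SimpleGraph (Fin n)) = n.choose 3 := by
      have : triangles (⊤ : SimpleGraph (Fin n)) = Finset.powersetCard 3 Finset.univ := by
        ext T
        rw [mem_triangles, SimpleGraph.isNClique_iff, Finset.mem_powersetCard]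
        refine ⟨fun h => ⟨Finset.subset_univ _, h.2⟩, fun h => ⟨fun a _ b _ hab => ?_, h.2⟩⟩
        exact hab
      rw [triangleCount, this, Finset.card_powersetCard, Finset.card_univ, Fintype.card_fin]
    have h2 : ((n.choose 3 : ℕ) : ℝ) = n * (n - 1) * (n - 2) / 6 := by
      obtain ⟨k, rfl⟩ := Nat.exists_eq_add_of_le hn
      have h3 := Nat.choose_symm_add (a := 3) (b := k)
      have h4 := Nat.descFactorial_eq_factorial_mul_choose (2 + k) 3
      have h5 : (2 + k).descFactorial 3 = (2 + k) * ((1 + k) * k) := by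
        simp only [Nat.descFactorial]
        rw [show 2 + k - 2 = k by omega, show 2 + k - 1 = 1 + k by omega,
          show 2 + k - 0 = 2 + k by omega]
        ring
      rw [h5] at h4
      have h6 : ((2 + k : ℕ) : ℝ) * ((1 + k) * k) = 6 * ((2 + k).choose 3 : ℕ) := by
        exact_mod_cast h4
      push_cast at h6 ⊢
      linarith
    have h3 : (n : ℝ) * (n - 1) * (n - 2) / 6 / (1 / 6 * (n : ℝ) ^ 3 * 1 ^ 3) - 1 =
        -((3 - 2 / n) / n) := by
      field_simp
      ring
    have hn2 : (2 : ℝ) ≤ n := by exact_mod_cast hn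
    have h4 : 0 < 3 - 2 / (n : ℝ) := by
      have : 2 / (n : ℝ) ≤ 1 := by
        rw [div_le_one hn']
        exact hn2
      linarith
    rw [h1, h2, h3, abs_neg, abs_of_pos (by positivity)]
    have h5 : zeta n 1 ^ 2 = Real.log n ^ 2 / n := by
      rw [eq_div_iff hn'.ne']
      linarith
    rw [h5, mul_div_assoc']
    gcongr
    have : 0 < 2 / (n : ℝ) := by positivity
    nlinarith

/-- Supplies at time 0 the smallness of `ζ` that `τ⋆` does not: for `p = 1`, `log (1/ζ)` is `(log
n)/2 - log log n`. -/
theorem tendsto_log_inv_zeta_one :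
    Tendsto (fun n : ℕ => Real.log (1 / zeta n 1) / Real.log (Real.log n)) atTop atTop := by
  have hlog : Tendsto (fun n : ℕ => Real.log n) atTop atTop :=
    Real.tendsto_log_atTop.comp tendsto_natCast_atTop_atTop
  rw [tendsto_atTop]
  intro M
  have h1 := Real.isLittleO_log_id_atTop.bound (c := 1 / (2 * (|M| + 1))) (by positivity)
  filter_upwards [hlog.eventually h1, hlog.eventually_gt_atTop 1] with n hn hl
  have hl0 : 0 < Real.log n := by linarith
  have hll : 0 < Real.log (Real.log n) := Real.log_pos hl
  have hn0 : (n : ℝ) ≠ 0 := by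
    intro h
    rw [h, Real.log_zero] at hl0
    exact lt_irrefl _ hl0
  have hnpos : (0 : ℝ) < n := lt_of_le_of_ne (Nat.cast_nonneg n) (Ne.symm hn0)
  rw [Real.norm_of_nonneg hll.le, id, Real.norm_of_nonneg hl0.le, one_div_mul_eq_div,
    le_div_iff₀ (by positivity)] at hn
  rw [le_div_iff₀ hll]
  have h2 : Real.log (1 / zeta n 1) = 1 / 2 * Real.log n - Real.log (Real.log n) := by
    unfold zeta
    rw [inv_one, mul_one, one_div, Real.log_inv,
      Real.log_mul (Real.rpow_pos_of_pos hnpos _).ne' hl0.ne', Real.log_rpow hnpos]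
    ring
  rw [h2]
  have := le_abs_self M
  nlinarith

theorem apply_zero_of_mem_support {n k : ℕ} {G : ℕ → SimpleGraph (Fin n)}
    (h : G ∈ (processUpTo n k).support) : G 0 = ⊤ := by
  induction k generalizing G with
  | zero =>
    rw [processUpTo, PMF.support_pure] at h
    rw [Set.mem_singleton_iff.mp h]
  | succ k ih =>
    rw [processUpTo, PMF.mem_support_bind_iff] at h
    obtain ⟨G₀, hG₀, h⟩ := h
    rw [PMF.support_map] at h
    obtain ⟨G', -, rfl⟩ := h
    simpa using ih hG₀

/-! ### First failures. -/

section Union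

variable {W : Type*} [Fintype W] [DecidableEq W]

/-- With no free vertex the rooting is the only copy and the scaling is 1. This case is apart
because `concentration` assumes a free vertex. -/
theorem controlled_of_numFree_eq_zero {Γ : SimpleGraph W} {R A : Finset W} (h : R ⊆ A) {n i : ℕ}
    {δ s : ℝ} (hf : A.card - R.card = 0) (G : SimpleGraph (Fin n)) (g : W → Fin n)
    (hg : Set.InjOn g R) (hp : 0 ≤ density n i) :
    Controlled δ s n i G (extGraph Γ R A h) (rootEmbedding h g hg) := by
  obtain rfl : R = A := Finset.eq_of_subset_of_card_le h (by omega)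
  have hS : (extGraph Γ R R h).scaling n (density n i) = 1 := by
    rw [extGraph_scaling]
    simp [edgesBetween]
  have hcount : (rootedCopies Γ R R G g).card = 1 := by
    rw [Finset.card_eq_one]
    refine ⟨g, ?_⟩
    ext ψ
    rw [mem_rootedCopies, Finset.mem_singleton]
    constructor
    · rintro ⟨h1, -⟩
      funext x
      exact h1 x (by simp)
    · rintro rfl
      exact ⟨fun _ _ => rfl, hg, fun u hu v hv _ h' => absurd ⟨hu, hv⟩ h'⟩
  have hl := Real.log_natCast_nonneg n
  refine ⟨fun _ _ => ?_, fun _ _ _ => ?_⟩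
  · rw [copyCount_rootEmbedding, hS, hcount, Nat.cast_one, sub_self, abs_zero, one_mul]
    exact Real.rpow_nonneg (zeta_nonneg hp) _
  · rw [copyCount_rootEmbedding, hS, hcount, Nat.cast_one, sub_self, abs_zero]
    positivity

theorem failure_le {Γ : SimpleGraph W} {R A : Finset W} (h : R ⊆ A) {n i : ℕ} {C : ℝ} (hC : 0 < C)
    (hearly : Early (sqrtDelta (Fintype.card W) ^ 2) (bigConst (Fintype.card W) C)
      (logPower (Fintype.card W)) n i)
    (g : W → Fin n) (hg : Set.InjOn g R) :
    (removalProcess n).toOuterMeasure {G : ℕ → SimpleGraph (Fin n) |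
      GoodHistory W C (sqrtDelta (Fintype.card W) ^ 2) (sqrtDelta (Fintype.card W)) n i G ∧
      ¬ Controlled (sqrtDelta (Fintype.card W) ^ 2) (sqrtDelta (Fintype.card W)) n i (G i)
        (extGraph Γ R A h) (rootEmbedding h g hg)} ≤
      ENNReal.ofReal (4 * Real.exp (-Real.log n ^ 2)) := by
  by_cases hf : A.card - R.card = 0
  · refine le_trans (MeasureTheory.measure_mono (t := ∅) ?_) (by simp)
    rintro G ⟨-, hG⟩
    exact hG (controlled_of_numFree_eq_zero h hf _ g hg hearly.density_pos.le)
  set δ := sqrtDelta (Fintype.card W) ^ 2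
  set s := sqrtDelta (Fintype.card W)
  -- The deterministic conditions are made part of the events, so each event is either empty or
  -- covered by the bound for its range of times.
  let S₁ : Set (ℕ → SimpleGraph (Fin n)) := {G | (extGraph Γ R A h).Balanced ∧
    (i : ℕ∞) ≤ (extGraph Γ R A h).tHMinus n s ∧ GoodHistory W C δ s n i G ∧
    (extGraph Γ R A h).scaling n (density n i) * zeta n (density n i) ^ δ <
      |((rootedCopies Γ R A (G i) g).card : ℝ) - (extGraph Γ R A h).scaling n (density n i)|}
  let S₂ : Set (ℕ → SimpleGraph (Fin n)) := {G | (extGraph Γ R A h).StrictlyBalanced ∧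
    (extGraph Γ R A h).tHMinus n s ≤ (i : ℕ∞) ∧ (i : ℕ∞) ≤ (extGraph Γ R A h).tH n ∧
    GoodHistory W C δ s n i G ∧
    (extGraph Γ R A h).scaling n (density n i) ^ (1 - s) *
        Real.log n ^ (3 * Real.exp ((extGraph Γ R A h).numFree : ℝ)) <
      |((rootedCopies Γ R A (G i) g).card : ℝ) - (extGraph Γ R A h).scaling n (density n i)|}
  have hS₁ : (removalProcess n).toOuterMeasure S₁ ≤
      ENNReal.ofReal (2 * Real.exp (-Real.log n ^ 2)) := by
    by_cases hcond : (extGraph Γ R A h).Balanced ∧ (i : ℕ∞) ≤ (extGraph Γ R A h).tHMinus n s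
    · refine le_trans (MeasureTheory.measure_mono ?_)
        (balanced_failure_le h hf hC hearly g hg hcond.1 hcond.2)
      exact fun G hG => hG.2.2
    · refine le_trans (MeasureTheory.measure_mono (t := ∅) ?_) (by simp)
      exact fun G hG => hcond ⟨hG.1, hG.2.1⟩
  have hS₂ : (removalProcess n).toOuterMeasure S₂ ≤
      ENNReal.ofReal (2 * Real.exp (-Real.log n ^ 2)) := by
    by_cases hcond : (extGraph Γ R A h).StrictlyBalanced ∧
        (extGraph Γ R A h).tHMinus n s ≤ (i : ℕ∞) ∧ (i : ℕ∞) ≤ (extGraph Γ R A h).tH n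
    · refine le_trans (MeasureTheory.measure_mono ?_)
        (strictlyBalanced_failure_le h hf hC hearly g hg hcond.1 hcond.2.1 hcond.2.2)
      exact fun G hG => hG.2.2.2
    · refine le_trans (MeasureTheory.measure_mono (t := ∅) ?_) (by simp)
      exact fun G hG => hcond ⟨hG.1, hG.2.1, hG.2.2.1⟩
  have hcover : {G : ℕ → SimpleGraph (Fin n) | GoodHistory W C δ s n i G ∧
      ¬ Controlled δ s n i (G i) (extGraph Γ R A h) (rootEmbedding h g hg)} ⊆ S₁ ∪ S₂ := by
    rintro G ⟨hG, hc⟩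
    unfold Controlled at hc
    rw [copyCount_rootEmbedding, not_and_or] at hc
    push Not at hc
    rcases hc with ⟨h1, h2, h3⟩ | ⟨h1, h2, h3, h4⟩
    · exact Or.inl ⟨h1, h2, hG, h3⟩
    · exact Or.inr ⟨h1, h2, h3, hG, h4⟩
  refine (MeasureTheory.measure_mono hcover).trans ((MeasureTheory.measure_union_le _ _).trans ?_)
  refine (add_le_add hS₁ hS₂).trans_eq ?_
  rw [← ENNReal.ofReal_add (by positivity) (by positivity)]
  congr 1
  ring

/-- The first failure at step `i`, of the extension of `R` to `A` with roots placed by `g`. -/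
def firstFailure (C : ℝ) (n i : ℕ) (q : (SimpleGraph W × Finset W × Finset W) × (W → Fin n)) :
    Set (ℕ → SimpleGraph (Fin n)) :=
  {G | Early (sqrtDelta (Fintype.card W) ^ 2) (bigConst (Fintype.card W) C)
      (logPower (Fintype.card W)) n i ∧
    GoodHistory W C (sqrtDelta (Fintype.card W) ^ 2) (sqrtDelta (Fintype.card W)) n i G ∧
    ∃ h : q.1.2.1 ⊆ q.1.2.2, ∃ hg : Set.InjOn q.2 q.1.2.1,
      ¬ Controlled (sqrtDelta (Fintype.card W) ^ 2) (sqrtDelta (Fintype.card W)) n i (G i)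
        (extGraph q.1.1 q.1.2.1 q.1.2.2 h) (rootEmbedding h q.2 hg)}

theorem firstFailure_le {n i : ℕ} {C : ℝ} (hC : 0 < C)
    (q : (SimpleGraph W × Finset W × Finset W) × (W → Fin n)) :
    (removalProcess n).toOuterMeasure (firstFailure C n i q) ≤
      ENNReal.ofReal (4 * Real.exp (-Real.log n ^ 2)) := by
  by_cases hcond : Early (sqrtDelta (Fintype.card W) ^ 2) (bigConst (Fintype.card W) C)
      (logPower (Fintype.card W)) n i ∧ q.1.2.1 ⊆ q.1.2.2 ∧ Set.InjOn q.2 q.1.2.1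
  · refine le_trans (MeasureTheory.measure_mono ?_)
      (failure_le (Γ := q.1.1) hcond.2.1 hC hcond.1 q.2 hcond.2.2)
    rintro G ⟨_, hG, _, _, hc⟩
    exact ⟨hG, hc⟩
  · refine le_trans (MeasureTheory.measure_mono (t := ∅) ?_) (by simp)
    rintro G ⟨h1, -, h2, h3, -⟩
    exact hcond ⟨h1, h2, h3⟩

/-- Any failure comes with a first failure. -/
theorem exists_firstFailure {n : ℕ} (hn : 0 < n) {C : ℝ} (hC : 0 < C) {G : ℕ → SimpleGraph (Fin n)}
    (hG : Antitone G) {i : ℕ} {H : ExtensionGraph W} {φ : H.roots ↪ Fin n}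
    (hacc : ∀ j < i, Accurate C (density n j) (G j))
    (hearly : ∀ j ≤ i, Early (sqrtDelta (Fintype.card W) ^ 2) (bigConst (Fintype.card W) C)
      (logPower (Fintype.card W)) n j)
    (hfail : ¬ Controlled (sqrtDelta (Fintype.card W) ^ 2) (sqrtDelta (Fintype.card W)) n i (G i)
      H φ) :
    ∃ j ∈ Finset.range (n ^ 2 + 1), ∃ q, G ∈ firstFailure (W := W) C n j q := by
  classical
  -- The minimum is over steps at which any extension fails, so that before it all are controlled,
  -- as the bound on the loss requires.
  have hex : ∃ j, ∃ (H : ExtensionGraph W) (φ : H.roots ↪ Fin n),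
      ¬ Controlled (sqrtDelta (Fintype.card W) ^ 2) (sqrtDelta (Fintype.card W)) n j (G j) H φ :=
    ⟨i, H, φ, hfail⟩
  have hji : Nat.find hex ≤ i := Nat.find_min' hex ⟨H, φ, hfail⟩
  have hmin := fun j (hj : j < Nat.find hex) => Nat.find_min hex hj
  obtain ⟨H', φ', hfail'⟩ := Nat.find_spec hex
  set j := Nat.find hex
  have hK : 1 ≤ bigConst (Fintype.card W) C := by
    linarith [(bigConst_bounds (Fintype.card W) hC).1]
  refine ⟨j, Finset.mem_range.2 (Nat.lt_succ_of_le ((hearly j hji).lt_sq hK)), ?_⟩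
  obtain ⟨Γ, R, A, h, rfl⟩ := exists_eq_extGraph H'
  -- The value off `R` is arbitrary.
  let g : W → Fin n := fun x => if hx : x ∈ R then φ' ⟨x, hx⟩ else ⟨0, hn⟩
  have hgR : ∀ x, (hx : x ∈ R) → g x = φ' ⟨x, hx⟩ := fun x hx => dif_pos hx
  have hg : Set.InjOn g R := by
    intro x hx y hy hxy
    rw [hgR x hx, hgR y hy] at hxy
    exact congrArg Subtype.val (φ'.injective hxy)
  refine ⟨((Γ, R, A), g), hearly j hji, ⟨hG, fun l hl => ⟨hacc l (by omega), ?_⟩⟩, h, hg, ?_⟩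
  · intro K χ
    by_contra hcon
    exact hmin l hl ⟨K, χ, hcon⟩
  · have : rootEmbedding h g hg = φ' := by
      ext ⟨x, hx⟩
      exact congrArg Fin.val (hgR x hx)
    rw [this]
    exact hfail'

end Union

-- Once `log n ≥ L + 3`, `exp (-(log n)²)` is at most `n^(-L-3)`, which beats the order `n²` of
-- steps and `n^L` rootings by a factor `n`.
open scoped ENNReal in
theorem tendsto_union_bound (c L : ℕ) :
    Tendsto (fun n : ℕ => ((n ^ 2 + 1 : ℕ) : ℝ≥0∞) * (((c * n ^ L : ℕ) : ℝ≥0∞) *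
      ENNReal.ofReal (4 * Real.exp (-Real.log n ^ 2)))) atTop (𝓝 0) := by
  have hlog : Tendsto (fun n : ℕ => Real.log n) atTop atTop :=
    Real.tendsto_log_atTop.comp tendsto_natCast_atTop_atTop
  have hlim : Tendsto (fun n : ℕ => ENNReal.ofReal (8 * c / (n : ℝ))) atTop (𝓝 0) := by
    rw [← ENNReal.ofReal_zero]
    exact ENNReal.tendsto_ofReal (tendsto_const_div_atTop_nhds_zero_nat _)
  refine tendsto_of_tendsto_of_tendsto_of_le_of_le' tendsto_const_nhds hlim
    (Eventually.of_forall fun _ => zero_le) ?_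
  filter_upwards [hlog.eventually_ge_atTop (L + 3 : ℝ), eventually_ge_atTop 1] with n hn hn1
  have hn0 : (0 : ℝ) < n := by exact_mod_cast hn1
  have hn1' : (1 : ℝ) ≤ n := by exact_mod_cast hn1
  rw [← ENNReal.ofReal_natCast, ← ENNReal.ofReal_natCast, ← ENNReal.ofReal_mul (Nat.cast_nonneg _),
    ← ENNReal.ofReal_mul (Nat.cast_nonneg _)]
  refine ENNReal.ofReal_le_ofReal ?_
  push_cast
  have h1 : Real.exp (-Real.log n ^ 2) ≤ ((n : ℝ) ^ (L + 3))⁻¹ := by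
    have h2 : (n : ℝ) ^ (L + 3) = Real.exp (((L : ℝ) + 3) * Real.log n) := by
      rw [mul_comm, Real.exp_mul, Real.exp_log hn0, ← Real.rpow_natCast]
      push_cast
      rfl
    rw [h2, ← Real.exp_neg, Real.exp_le_exp]
    have : (0 : ℝ) ≤ L := Nat.cast_nonneg L
    nlinarith
  have h3 : (n : ℝ) ^ 2 + 1 ≤ 2 * n ^ 2 := by
    have : (1 : ℝ) ≤ n ^ 2 := one_le_pow₀ hn1'
    linarith
  calc ((n : ℝ) ^ 2 + 1) * (c * n ^ L * (4 * Real.exp (-Real.log n ^ 2)))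
      ≤ (2 * n ^ 2) * (c * n ^ L * (4 * ((n : ℝ) ^ (L + 3))⁻¹)) := by gcongr
    _ = 8 * (c : ℝ) / n := by
      rw [pow_add]
      field_simp
      ring

end TriangleRemoval

open TriangleRemoval
/-- Probabilities are masses of sets of trajectories under the law of the process. Every extension
graph on at most `L` vertices is, up to the names of its vertices, one labelled by `Fin L`. -/
theorem mainTheorem4 (L : ℕ) :
    ∃ δ : ℝ, 0 < δ ∧ δ < 1 ∧
      ∀ C : ℝ, 0 < C → ∀ w : ℕ → ℝ, Tendsto w atTop atTop →
        Tendsto (fun n : ℕ => (removalProcess n).toOuterMeasure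
          {G : ℕ → SimpleGraph (Fin n) |
            ∀ i : ℕ, (i : ℕ∞) ≤ tauStar C w G →
            ∀ (H : ExtensionGraph (Fin L)) (φ : H.roots ↪ Fin n),
              (H.Balanced → (i : ℕ∞) ≤ H.tHMinus n (Real.sqrt δ) →
                |(H.copyCount (G i) φ : ℝ) - H.scaling n (density n i)| ≤
                  H.scaling n (density n i) * zeta n (density n i) ^ δ) ∧
              (H.StrictlyBalanced → H.tHMinus n (Real.sqrt δ) ≤ (i : ℕ∞) → (i : ℕ∞) ≤ H.tH n →
                |(H.copyCount (G i) φ : ℝ) - H.scaling n (density n i)| ≤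
                  H.scaling n (density n i) ^ (1 - Real.sqrt δ) *
                    Real.log n ^ (3 * Real.exp (H.numFree : ℝ)))})
          atTop (𝓝 1) := by
  classical
  have hs := sqrtDelta_pos (Fintype.card (Fin L))
  have hs4 := sqrtDelta_le (Fintype.card (Fin L))
  refine ⟨sqrtDelta (Fintype.card (Fin L)) ^ 2, pow_pos hs 2,
    pow_lt_one₀ hs.le (by linarith) two_ne_zero, fun C hC w hw => ?_⟩
  rw [Real.sqrt_sq hs.le]
  refine tendsto_toOuterMeasure_one removalProcess _ ?_
  have hlog : Tendsto (fun n : ℕ => Real.log n) atTop atTop :=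
    Real.tendsto_log_atTop.comp tendsto_natCast_atTop_atTop
  -- The condition with rate `w` may fail at time 0, so `w` is replaced by its minimum with the rate
  -- that holds there.
  have hw' : Tendsto (fun n : ℕ => min (w n) (Real.log (1 / zeta n 1) / Real.log (Real.log n)))
      atTop atTop := by
    refine tendsto_atTop.2 fun b => ?_
    filter_upwards [hw.eventually_ge_atTop b, tendsto_log_inv_zeta_one.eventually_ge_atTop b]
      with n h1 h2
    exact le_min h1 h2
  have hbound := tendsto_union_bound
    (Fintype.card (SimpleGraph (Fin L) × Finset (Fin L) × Finset (Fin L))) L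
  refine tendsto_of_tendsto_of_tendsto_of_le_of_le' tendsto_const_nhds hbound
    (Eventually.of_forall fun _ => zero_le) ?_
  filter_upwards [eventually_early hw' (sqrtDelta (Fintype.card (Fin L)) ^ 2)
    (bigConst (Fintype.card (Fin L)) C) (logPower (Fintype.card (Fin L))) (pow_pos hs 2)
    (bigConst_bounds _ hC).1 (logPower_nonneg _), eventually_ge_atTop 2,
    hlog.eventually_ge_atTop (1 : ℝ), hlog.eventually_gt_atTop (3 / C)] with n hearly hn hl hCl
  have hCl' : 3 < C * Real.log n := by
    rw [div_lt_iff₀ hC] at hCl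
    linarith
  refine le_trans (toOuterMeasure_le_of_inter_support (t := ⋃ j ∈ Finset.range (n ^ 2 + 1),
    ⋃ q ∈ (Finset.univ : Finset ((SimpleGraph (Fin L) × Finset (Fin L) × Finset (Fin L)) ×
      (Fin L → Fin n))), firstFailure C n j q) _ ?_) ?_
  · intro G hGs hG
    rw [Set.mem_compl_iff] at hG
    simp only [Set.mem_ofPred_eq] at hG
    push Not at hG
    obtain ⟨i, hi, H, φ, hfail⟩ := hG
    have hzero : G 0 = ⊤ := apply_zero_of_mem_support hGs
    have hstar := le_firstStep_iff.1 hi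
    have hgood : ∀ j, 0 < j → j < i →
        Accurate C (density n j) (G j) ∧ ZetaSmall w n (density n j) := by
      intro j hj0 hji
      by_contra hcon
      have := hstar j ⟨hj0, hcon⟩
      omega
    have hacc : ∀ j < i, Accurate C (density n j) (G j) := by
      intro j hji
      rcases Nat.eq_zero_or_pos j with rfl | hj0
      · rw [density_zero, hzero]
        exact accurate_top hn hC hl hCl'
      · exact (hgood j hj0 hji).1
    have hE : ∀ j ≤ i, Early (sqrtDelta (Fintype.card (Fin L)) ^ 2)
        (bigConst (Fintype.card (Fin L)) C) (logPower (Fintype.card (Fin L))) n j := by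
      intro j hji
      refine hearly j ?_
      -- Step `j - 1` is either 0, also when `j = 0`, or a positive time before `τ⋆`.
      rcases Nat.eq_zero_or_pos (j - 1) with hj0 | hj0
      · rw [hj0, density_zero]
        exact ⟨one_pos, min_le_right _ _⟩
      · have := (hgood (j - 1) hj0 (by omega)).2
        exact ⟨this.1, (min_le_left _ _).trans this.2⟩
    obtain ⟨j, hj, q, hq⟩ := exists_firstFailure (by omega) hC (antitone_of_mem_support hGs) hacc hE
      (H := H) (φ := φ) fun hcon => by
        obtain ⟨a1, a2, a3⟩ := hfail fun b1 b2 => hcon.1 b1 b2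
        exact absurd (hcon.2 a1 a2 a3.1) (not_le.2 a3.2)
    simp only [Set.mem_iUnion]
    exact ⟨j, hj, q, Finset.mem_univ q, hq⟩
  · refine (MeasureTheory.measure_biUnion_finset_le _ _).trans ?_
    refine (Finset.sum_le_card_nsmul _ _ _ fun j _ =>
      (MeasureTheory.measure_biUnion_finset_le _ _).trans
        (Finset.sum_le_card_nsmul _ _ _ fun q _ => firstFailure_le hC q)).trans_eq ?_
    rw [Finset.card_range, Finset.card_univ, Fintype.card_prod, Fintype.card_fun, Fintype.card_fin,
      Fintype.card_fin, nsmul_eq_mul, nsmul_eq_mul]
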